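/- **Theorem.** Let $\mathbb S=(S,\oplus,\otimes,0,1)$ be one of the following commutative semirings: the Boolean semiring $(\{0,1\},\vee,\wedge,0,1)$; $(\mathbb N,+,\times,0,1)$, $(\mathbb Z,+,\times,0,1)$, $(\mathbb Q,+,\times,0,1)$, $(\mathbb Q_{\ge 0},+,\times,0,1)$; or one of the tropical semirings $(\mathbb N\cup\{-\infty\},\max,+,-\infty,0)$, $(\mathbb Z\cup\{-\infty\},\max,+,-\infty,0)$, $(\mathbb N\cup\{+\infty\},\min,+,+\infty,0)$, $(\mathbb Z\cup\{+\infty\},\min,+,+\infty,0)$. Then the evaluation problem for weighted tiling systems over $\mathbb S$ is in $\mathrm{FPSPACE}$: there are a deterministic Turing machine and a polynomial $p$ such that, given any finite sets $\Gamma$ (edge names) and $\Sigma$ (node labels), any weighted tiling system $\mathcal T$ over $(\Gamma,\Sigma)$-graphs and $\mathbb S$, and any $(\Gamma,\Sigma)$-graph $G$, encoded by a word $x$, the machine halts with the encoding of the value $[\![\mathcal T]\!](G)\in S$ as its output, using space at most $p(|x|)$ (input and output included). The system is encoded by listing its tiles with their weights, and the graph by listing its node labels and its edges; all numbers, weights included,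 are written in binary, and rational numbers as reduced fractions of binary numbers. Here a *$(\Gamma,\Sigma)$-graph* $G=(V,(E_\gamma)_{\gamma\in\Gamma},\lambda)$ consists of a finite set $V$, relations $E_\gamma\subseteq V\times V$ such that every vertex has at most one outgoing and at most one incoming $\gamma$-edge for each $\gamma\in\Gamma$, and a map $\lambda\colon V\to\Sigma$. The *type* of a vertex is the pair $(\Gamma_{\mathrm{in}},\Gamma_{\mathrm{out}})$ of the sets of names of its incoming and of its outgoing edges. A *weighted tiling system* $\mathcal T=(Q,\Delta,\mathrm{wgt})$ consists of a finite set $Q$ of states, a set $\Delta=\bigcup_\tau\Delta_\tau$ of permissible tiles, where $\Delta_\tau\subseteq Q^{\Gamma_{\mathrm{in}}}\times Q\times\Sigma\times Q^{\Gamma_{\mathrm{out}}}$ for each type $\tau=(\Gamma_{\mathrm{in}},\Gamma_{\mathrm{out}})\in 2^\Gamma\times 2^\Gamma$, and a map $\mathrm{wgt}\colon\Delta\to S$. For a labeling $\rho\colon V\to Q$ and a vertex $v$ of type $(\Gamma_{\mathrm{in}},\Gamma_{\mathrm{out}})$ put $\mathrm{tile}_\rho(v)=(f_{\mathrm{in}},\rho(v),\lambda(v),f_{\mathrm{out}})$,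 where $f_{\mathrm{in}}(\gamma)=\rho(u)$ for the $u$ with $(u,v)\in E_\gamma$ and $f_{\mathrm{out}}(\gamma)=\rho(u)$ for the $u$ with $(v,u)\in E_\gamma$. The labeling $\rho$ is a *run* if $\mathrm{tile}_\rho(v)\in\Delta_\tau$ for every vertex $v$, $\tau$ being the type of $v$, and $$[\![\mathcal T]\!](G)=\bigoplus_{\rho\text{ a run of }\mathcal T\text{ on }G}\ \bigotimes_{v\in V}\mathrm{wgt}(\mathrm{tile}_\rho(v)).$$ -/

import Mathlib

/-! ### The commutative semirings -/

/-- The Boolean semiring `({0,1}, ∨, ∧, 0, 1)`. (Mathlib's ring structure on `Bool` is a different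
one: its addition is exclusive or.) -/
structure BoolSemiring where
  val : Bool

namespace BoolSemiring

theorem ext' {x y : BoolSemiring} (h : x.val = y.val) : x = y := by
  cases x; cases y; cases h; rfl

instance : Add BoolSemiring := ⟨fun x y => ⟨x.val || y.val⟩⟩

instance : Mul BoolSemiring := ⟨fun x y => ⟨x.val && y.val⟩⟩

instance : Zero BoolSemiring := ⟨⟨false⟩⟩

instance : One BoolSemiring := ⟨⟨true⟩⟩

instance : CommSemiring BoolSemiring where
  nsmul := nsmulRec
  npow := npowRec
  add_assoc x y z := ext' (Bool.or_assoc x.val y.val z.val)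
  zero_add x := ext' (Bool.false_or x.val)
  add_zero x := ext' (Bool.or_false x.val)
  add_comm x y := ext' (Bool.or_comm x.val y.val)
  mul_assoc x y z := ext' (Bool.and_assoc x.val y.val z.val)
  mul_comm x y := ext' (Bool.and_comm x.val y.val)
  one_mul x := ext' (Bool.true_and x.val)
  mul_one x := ext' (Bool.and_true x.val)
  left_distrib x y z := ext' (Bool.and_or_distrib_left x.val y.val z.val)
  right_distrib x y z := ext' (Bool.and_or_distrib_right x.val y.val z.val)
  zero_mul x := ext' (Bool.false_and x.val)
  mul_zero x := ext' (Bool.and_false x.val)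

end BoolSemiring

/-- The names of the nine semirings under consideration. -/
inductive SemiringName
  | boolean | natural | integer | rational | nonnegRational
  | maxPlusNat | maxPlusInt | minPlusNat | minPlusInt

/-- The carriers. `Tropical R` has `min` as its addition, `+` as its multiplication, and `⊤` as its
zero; over the order dual, `min` is the usual `max`, and the `⊤` that is added is `-∞`. -/
def SemiringName.Carrier : SemiringName → Type
  | .boolean => BoolSemiring
  | .natural => ℕ
  | .integer => ℤ
  | .rational => ℚ
  | .nonnegRational => ℚ≥0
  | .maxPlusNat => Tropical (WithTop ℕᵒᵈ)
  | .maxPlusInt => Tropical (WithTop ℤᵒᵈ)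
  | .minPlusNat => Tropical (WithTop ℕ)
  | .minPlusInt => Tropical (WithTop ℤ)

noncomputable instance SemiringName.instCommSemiring : (s : SemiringName) → CommSemiring s.Carrier
  | .boolean => inferInstanceAs (CommSemiring BoolSemiring)
  | .natural => inferInstanceAs (CommSemiring ℕ)
  | .integer => inferInstanceAs (CommSemiring ℤ)
  | .rational => inferInstanceAs (CommSemiring ℚ)
  | .nonnegRational => inferInstanceAs (CommSemiring ℚ≥0)
  | .maxPlusNat => inferInstanceAs (CommSemiring (Tropical (WithTop ℕᵒᵈ)))
  | .maxPlusInt => inferInstanceAs (CommSemiring (Tropical (WithTop ℤᵒᵈ)))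
  | .minPlusNat => inferInstanceAs (CommSemiring (Tropical (WithTop ℕ)))
  | .minPlusInt => inferInstanceAs (CommSemiring (Tropical (WithTop ℤ)))

/-! ### Graphs with named edges and labelled nodes -/

/-- A graph on the vertices `V` with edge names in `E` and node labels in `L`; every vertex has at
most one outgoing and at most one incoming edge of each name. -/
structure LabelledGraph (E L V : Type) where
  /-- `edge γ u v`: there is a `γ`-edge from `u` to `v` -/
  edge : E → V → V → Prop
  label : V → L
  out_unique : ∀ γ v u u', edge γ v u → edge γ v u' → u = u'
  in_unique : ∀ γ v u u', edge γ u v → edge γ u' v → u = u'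

/-- A vertex type: the set of names of incoming edges and the set of names of outgoing edges. -/
abbrev VertexType (E : Type) : Type := Set E × Set E

def LabelledGraph.vertexType {E L V : Type} (G : LabelledGraph E L V) (v : V) : VertexType E :=
  ({γ | ∃ u, G.edge γ u v}, {γ | ∃ u, G.edge γ v u})

/-! ### Weighted tiling systems -/

/-- A tile `(f_in, q, a, f_out)`. The functions `f_in`, `f_out` from sets of edge names to states
are written as partial functions on all edge names. -/
structure Tile (E L Q : Type) where
  inState : E → Option Q
  state : Q
  label : L
  outState : E → Option Q

/-- The type of a tile: the domains of `f_in` and `f_out`. -/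
def Tile.vertexType {E L Q : Type} (t : Tile E L Q) : VertexType E :=
  ({γ | (t.inState γ).isSome}, {γ | (t.outState γ).isSome})

/-- A weighted tiling system with states `Q` over graphs with edge names `E` and labels `L`, and
with weights in `S`. -/
structure WTS (E L Q S : Type) where
  /-- the set `Δ` of permissible tiles, of all types -/
  tiles : Set (Tile E L Q)
  wgt : tiles → S

namespace WTS

variable {E L Q V S : Type}

/-- The set `Δ_τ` of the permissible tiles of type `τ`. -/
def tilesOfType (T : WTS E L Q S) (τ : VertexType E) : Set (Tile E L Q) :=
  {t | t ∈ T.tiles ∧ t.vertexType = τ}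

open Classical in
/-- The tile of the vertex `v` with respect to the labelling `ρ`. -/
noncomputable def tileAt (G : LabelledGraph E L V) (ρ : V → Q) (v : V) : Tile E L Q where
  inState γ := if h : ∃ u, G.edge γ u v then some (ρ h.choose) else none
  state := ρ v
  label := G.label v
  outState γ := if h : ∃ u, G.edge γ v u then some (ρ h.choose) else none

/-- A run is a labelling of the vertices by states all of whose tiles are permissible. -/
def IsRun (T : WTS E L Q S) (G : LabelledGraph E L V) (ρ : V → Q) : Prop :=
  ∀ v, tileAt G ρ v ∈ T.tilesOfType (G.vertexType v)

/-- The weight of a run: the product of the weights of its tiles. -/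
noncomputable def runWeight [CommSemiring S] [Fintype V] (T : WTS E L Q S)
    (G : LabelledGraph E L V) (ρ : {ρ : V → Q // T.IsRun G ρ}) : S :=
  ∏ v, T.wgt ⟨tileAt G ρ.1 v, (ρ.2 v).1⟩

open Classical in
/-- The value of `T` on `G`: the sum of the weights of the runs. -/
noncomputable def value [CommSemiring S] [Fintype V] [Fintype Q] (T : WTS E L Q S)
    (G : LabelledGraph E L V) : S :=
  ∑ ρ : {ρ : V → Q // T.IsRun G ρ}, T.runWeight G ρ

end WTS

/-! ### The evaluation problem and its encoding by words -/

/-- An instance of the evaluation problem: finite sets of edge names, node labels, states and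
vertices (given as initial segments of the natural numbers), a weighted tiling system, a graph, and
arbitrary listings without repetition of its permissible tiles and of its edges, which fix the order
in which these are written on the input. -/
structure EvalInstance (S : Type) where
  numEdgeNames : ℕ
  numLabels : ℕ
  numStates : ℕ
  numVertices : ℕ
  T : WTS (Fin numEdgeNames) (Fin numLabels) (Fin numStates) S
  G : LabelledGraph (Fin numEdgeNames) (Fin numLabels) (Fin numVertices)
  tileList : List T.tiles
  tileList_nodup : tileList.Nodup
  mem_tileList : ∀ t, t ∈ tileList
  edgeList : List (Fin numEdgeNames × Fin numVertices × Fin numVertices)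
  edgeList_nodup : edgeList.Nodup
  mem_edgeList : ∀ γ u v, (γ, u, v) ∈ edgeList ↔ G.edge γ u v

/-- The function to be computed. -/
noncomputable def EvalInstance.value {S : Type} [CommSemiring S] (I : EvalInstance S) : S :=
  I.T.value I.G

/-- The letters of the input and output words. -/
inductive Letter
  | bit (b : Bool)
  | minus | slash | infinity
  | comma | bar | semicolon
  deriving DecidableEq, Fintype

namespace Letter

/-- A natural number in binary, least significant bit first. -/
def natWord (k : ℕ) : List Letter := k.bits.map bit

/-- An integer in binary: a sign if it is negative, then the absolute value. -/
def intWord (z : ℤ) : List Letter :=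
  if z < 0 then minus :: natWord z.natAbs else natWord z.natAbs

/-- A number followed by a delimiter. -/
def field (k : ℕ) : List Letter := natWord k ++ [comma]

end Letter

/-- The elements of the semirings as words: numbers in binary, rational numbers as reduced
fractions. -/
def SemiringName.word : (s : SemiringName) → s.Carrier → List Letter
  | .boolean => fun x : BoolSemiring => [Letter.bit x.val]
  | .natural => fun x : ℕ => Letter.natWord x
  | .integer => fun x : ℤ => Letter.intWord x
  | .rational => fun x : ℚ => Letter.intWord x.num ++ [Letter.slash] ++ Letter.natWord x.den
  | .nonnegRational => fun x : ℚ≥0 =>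
      Letter.natWord x.num ++ [Letter.slash] ++ Letter.natWord x.den
  | .maxPlusNat => fun x : Tropical (WithTop ℕᵒᵈ) =>
      match Tropical.untrop x with
      | ⊤ => [Letter.infinity]
      | WithTop.some k => Letter.natWord (OrderDual.ofDual k)
  | .maxPlusInt => fun x : Tropical (WithTop ℤᵒᵈ) =>
      match Tropical.untrop x with
      | ⊤ => [Letter.infinity]
      | WithTop.some k => Letter.intWord (OrderDual.ofDual k)
  | .minPlusNat => fun x : Tropical (WithTop ℕ) =>
      match Tropical.untrop x with
      | ⊤ => [Letter.infinity]
      | WithTop.some k => Letter.natWord k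
  | .minPlusInt => fun x : Tropical (WithTop ℤ) =>
      match Tropical.untrop x with
      | ⊤ => [Letter.infinity]
      | WithTop.some k => Letter.intWord k

/-- A partial function from edge names to states as the list of the pairs of its graph. -/
def partialFunWord {g q : ℕ} (f : Fin g → Option (Fin q)) : List Letter :=
  (List.finRange g).flatMap fun γ =>
    match f γ with
    | none => []
    | some p => Letter.field γ ++ Letter.field p

def Tile.word {g l q : ℕ} (t : Tile (Fin g) (Fin l) (Fin q)) : List Letter :=
  partialFunWord t.inState ++ [Letter.bar] ++ Letter.field t.state ++ Letter.field t.label ++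
    partialFunWord t.outState ++ [Letter.bar]

/-- The input word of an instance, `enc` being the encoding of the weights: the sizes of the four
sets, the weighted tiles, the labels of the vertices, and the edges. -/
def EvalInstance.word {S : Type} (enc : S → List Letter) (I : EvalInstance S) : List Letter :=
  Letter.field I.numEdgeNames ++ Letter.field I.numLabels ++ Letter.field I.numStates ++
    Letter.field I.numVertices ++ [Letter.semicolon] ++
  I.tileList.flatMap (fun t => t.1.word ++ enc (I.T.wgt t) ++ [Letter.semicolon]) ++
    [Letter.semicolon] ++
  (List.finRange I.numVertices).flatMap (fun v => Letter.field (I.G.label v)) ++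
    [Letter.semicolon] ++
  I.edgeList.flatMap (fun e =>
    Letter.field e.1 ++ Letter.field e.2.1 ++ Letter.field e.2.2) ++ [Letter.semicolon]

/-! ### Functions computable in polynomial space -/

/-- The space used by a configuration of a multi-stack Turing machine: the total number of symbols
on all its stacks, the input and output stacks included. -/
def Turing.FinTM2.space (tm : Turing.FinTM2) (c : tm.Cfg) : ℕ :=
  (@Finset.univ tm.K tm.kFin).sum fun k => (Turing.TM2.Cfg.stk c k).length

/-- `f` is computable in polynomial space with respect to the encodings `ea` of its arguments and
`eb` of its values: there are a deterministic Turing machine with finite alphabets and a polynomial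
`p` such that, on the word of every argument `a`, the machine halts with exactly the word of `f a`
on its output stack, and every configuration of this computation uses space at most
`p (length of the input word)`. -/
def InFPSpace {α β A B : Type} (ea : α → List A) (eb : β → List B) (f : α → β) : Prop :=
  ∃ (M : Turing.TM2ComputableAux A B) (p : Polynomial ℕ),
    (∀ k, Finite (M.tm.Γ k)) ∧
    ∀ a : α,
      StateTransition.Reaches M.tm.step
        (Turing.initList M.tm ((ea a).map M.inputAlphabet.symm))
        (Turing.haltList M.tm ((eb (f a)).map M.outputAlphabet.symm)) ∧
      ∀ c : M.tm.Cfg,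
        StateTransition.Reaches M.tm.step
          (Turing.initList M.tm ((ea a).map M.inputAlphabet.symm)) c →
        M.tm.space c ≤ p.eval (ea a).length

/-! A sum over exponentially many labellings can be accumulated in polynomial space because its
value has only polynomially many bits. A labelling of the vertices `V` by `q` states is a number `R
< q ^ |V|`, the state of the vertex `v` being digit `v` of `R` in base `q`; one binary counter of
polynomial size therefore enumerates all labellings. For given `R`, the tile of a vertex is compared
with the listed tiles. At most one of them matches, and a labelling that is not a run has a vertex
without a match. Hence the value is the sum over `R` of the product over `v` of the sum over the
matching tiles of their weights (`EvalInstance.value_eq_sum`). As every vertex has its label on the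
input, `|V|` is at most the input length. So the products of natural numbers that occur have
polynomial size (`Nat.size_prod_le`), and adding up `q ^ |V|` of them costs only the bits of `q ^
|V|` in addition (`Nat.size_sum_le`).

Turing machines are hidden behind the notion `PSpace`, which is closed under bounded primitive
recursion (`PSpace.rec`): the number of rounds may be exponential, and only the sizes of the
intermediate values are restricted. Since time does not count, arithmetic is built from binary
increment and decrement, while quotients, greatest common divisors and lengths of words are found by
exhaustive search (`PSpace.of_graph`). Words are treated as numbers in base 8, so that parsing the
input is arithmetic too. The underlying programs work on stacks that hold binary counters;
`StackProg.Run.reaches` compiles them into a machine, and `PSpace.inFPSpace` adds the conversion of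
input and output.

The semirings fall into four groups. Over the natural numbers and the integers, the sign of a
product is the parity of its number of negative factors, so the value is a difference of two sums of
natural numbers (`sum_prod_int`). Over the rationals, all weights are multiplied by a common
denominator `D`, the result is divided by `D ^ |V|`, and the fraction is reduced by a gcd
(`map_value_rat`). Over the Boolean semiring the sum is a search for an accepting labelling. The
tropical semirings are mapped to min-plus integers, by negation in the case of `max`; there a
labelling of least weight is found by comparing it with all others, and its weight is the value
(`untrop_map_value`). -/

open Letter

/-! ### Structured programs over stacks -/

/-- Structured programs over stacks of letters; tests read the top of a stack. -/
inductive StackProg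
  | push (r : ℕ) (x : Letter)
  | pop (r : ℕ)
  | seq (P Q : StackProg)
  | ite (r : ℕ) (t : Option Letter → Bool) (P Q : StackProg)
  | loop (r : ℕ) (t : Option Letter → Bool) (P : StackProg)

namespace StackProg

/-- `Run M P s s'`: the program `P` leads from the stacks `s` to the stacks `s'`, no push exceeding
the height `M`. -/
inductive Run (M : ℕ) : StackProg → (ℕ → List Letter) → (ℕ → List Letter) → Prop
  | push {r : ℕ} {x : Letter} {s s' : ℕ → List Letter} :
      (s r).length < M → s' = Function.update s r (x :: s r) → Run M (push r x) s s'
  | pop {r : ℕ} {s s' : ℕ → List Letter} :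
      s' = Function.update s r (s r).tail → Run M (pop r) s s'
  | seq {P Q : StackProg} {s s' s'' : ℕ → List Letter} :
      Run M P s s' → Run M Q s' s'' → Run M (seq P Q) s s''
  | iteT {r : ℕ} {t : Option Letter → Bool} {P Q : StackProg} {s s' : ℕ → List Letter} :
      t (s r).head? = true → Run M P s s' → Run M (ite r t P Q) s s'
  | iteF {r : ℕ} {t : Option Letter → Bool} {P Q : StackProg} {s s' : ℕ → List Letter} :
      t (s r).head? = false → Run M Q s s' → Run M (ite r t P Q) s s'
  | loopT {r : ℕ} {t : Option Letter → Bool} {P : StackProg} {s s' s'' : ℕ → List Letter} :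
      t (s r).head? = true → Run M P s s' → Run M (loop r t P) s' s'' →
      Run M (loop r t P) s s''
  | loopF {r : ℕ} {t : Option Letter → Bool} {P : StackProg} {s : ℕ → List Letter} :
      t (s r).head? = false → Run M (loop r t P) s s

theorem Run.length_le {M : ℕ} {P : StackProg} {s s' : ℕ → List Letter} (h : Run M P s s')
    (hs : ∀ j, (s j).length ≤ M) : ∀ j, (s' j).length ≤ M := by
  induction h with
  | @push r x s s' h e =>
    intro j
    subst e
    by_cases hj : j = r
    · subst hj; simpa using h
    · simpa [hj] using hs j
  | @pop r s s' e =>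
    intro j
    subst e
    by_cases hj : j = r
    · subst hj; simpa using (Nat.sub_le _ _).trans (hs j)
    · simpa [hj] using hs j
  | seq _ _ ih1 ih2 => exact ih2 (ih1 hs)
  | iteT _ _ ih => exact ih hs
  | iteF _ _ ih => exact ih hs
  | loopT _ _ _ ih1 ih2 => exact ih2 (ih1 hs)
  | loopF _ => exact hs

/-- The positions of a program. -/
def Lbl : StackProg → Type
  | push _ _ => Unit
  | pop _ => Unit
  | seq P Q => Lbl P ⊕ Lbl Q
  | ite _ _ P Q => Option (Lbl P ⊕ Lbl Q)
  | loop _ _ P => Option (Lbl P)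

def entry : (P : StackProg) → P.Lbl
  | push _ _ => ()
  | pop _ => ()
  | seq P _ => Sum.inl P.entry
  | ite _ _ _ _ => none
  | loop _ _ _ => none

theorem finite_lbl : (P : StackProg) → Finite P.Lbl
  | push _ _ => inferInstanceAs (Finite Unit)
  | pop _ => inferInstanceAs (Finite Unit)
  | seq P Q =>
    have := P.finite_lbl
    have := Q.finite_lbl
    inferInstanceAs (Finite (P.Lbl ⊕ Q.Lbl))
  | ite _ _ P Q =>
    have := P.finite_lbl
    have := Q.finite_lbl
    inferInstanceAs (Finite (Option (P.Lbl ⊕ Q.Lbl)))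
  | loop _ _ P =>
    have := P.finite_lbl
    inferInstanceAs (Finite (Option P.Lbl))

/-- A number above all stacks of a program. -/
def bound : StackProg → ℕ
  | push r _ => r + 1
  | pop r => r + 1
  | seq P Q => max P.bound Q.bound
  | ite r _ P Q => max (r + 1) (max P.bound Q.bound)
  | loop r _ P => max (r + 1) P.bound

variable {N : ℕ} {Λ : Type}

/-- One step of a machine to a configuration with stacks of height at most `M`. -/
def SafeStep (M : ℕ) (m : Λ → Turing.TM2.Stmt (fun _ : Fin N => Letter) Λ (Option Letter))
    (c c' : Turing.TM2.Cfg (fun _ : Fin N => Letter) Λ (Option Letter)) : Prop :=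
  Turing.TM2.step m c = some c' ∧ ∀ i, (c'.stk i).length ≤ M

theorem SafeStep.reaches {M : ℕ}
    {m : Λ → Turing.TM2.Stmt (fun _ : Fin N => Letter) Λ (Option Letter)}
    {c h : Turing.TM2.Cfg (fun _ : Fin N => Letter) Λ (Option Letter)}
    (hc : Relation.ReflTransGen (SafeStep M m) c h) :
    StateTransition.Reaches (Turing.TM2.step m) c h :=
  Relation.ReflTransGen.mono (fun _ _ h => h.1) _ _ hc

/-- The machine is deterministic and stops at `h`, so every reachable configuration lies on the one
path from `c` to `h`, and all configurations on that path are known to be small. -/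
theorem SafeStep.length_le {M : ℕ}
    {m : Λ → Turing.TM2.Stmt (fun _ : Fin N => Letter) Λ (Option Letter)}
    {c h c' : Turing.TM2.Cfg (fun _ : Fin N => Letter) Λ (Option Letter)}
    (hc : Relation.ReflTransGen (SafeStep M m) c h) (hh : Turing.TM2.step m h = none)
    (hcM : ∀ i, (c.stk i).length ≤ M)
    (hc' : StateTransition.Reaches (Turing.TM2.step m) c c') : ∀ i, (c'.stk i).length ≤ M := by
  induction hc using Relation.ReflTransGen.head_induction_on with
  | refl =>
    rcases Relation.ReflTransGen.cases_head hc' with rfl | ⟨b, hb, _⟩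
    · exact hcM
    · rw [hh] at hb; cases hb
  | @head a b hab _ ih =>
    rcases Relation.ReflTransGen.cases_head hc' with rfl | ⟨b', hb', hbc⟩
    · exact hcM
    · rw [hab.1] at hb'
      cases hb'
      exact ih hab.2 hbc

variable [NeZero N]

/-- The statement at a position of a program with exit label `k`, its positions being embedded
into the labels by `e`. -/
def stmt : (P : StackProg) → (P.Lbl → Λ) → Λ → P.Lbl →
    Turing.TM2.Stmt (fun _ : Fin N => Letter) Λ (Option Letter)
  | push r x, _, k, _ => .push (Fin.ofNat N r) (fun _ => x) (.goto fun _ => k)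
  | pop r, _, k, _ => .pop (Fin.ofNat N r) (fun v _ => v) (.goto fun _ => k)
  | seq P Q, e, _, Sum.inl l => P.stmt (fun l => e (Sum.inl l)) (e (Sum.inr Q.entry)) l
  | seq _ Q, e, k, Sum.inr l => Q.stmt (fun l => e (Sum.inr l)) k l
  | ite r t P Q, e, _, none => .peek (Fin.ofNat N r) (fun _ x => x)
      (.branch t (.goto fun _ => e (some (Sum.inl P.entry)))
        (.goto fun _ => e (some (Sum.inr Q.entry))))
  | ite _ _ P _, e, k, some (Sum.inl l) => P.stmt (fun l => e (some (Sum.inl l))) k l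
  | ite _ _ _ Q, e, k, some (Sum.inr l) => Q.stmt (fun l => e (some (Sum.inr l))) k l
  | loop r t P, e, k, none => .peek (Fin.ofNat N r) (fun _ x => x)
      (.branch t (.goto fun _ => e (some P.entry)) (.goto fun _ => k))
  | loop _ _ P, e, _, some l => P.stmt (fun l => e (some l)) (e none) l

/-- The configurations of a machine, given by a label, a variable, and stacks. -/
def cfg (l : Λ) (v : Option Letter) (s : ℕ → List Letter) :
    Turing.TM2.Cfg (fun _ : Fin N => Letter) Λ (Option Letter) :=
  ⟨some l, v, fun i => s i⟩

theorem update_restrict (s : ℕ → List Letter) {r : ℕ} (hr : r < N) (l : List Letter) :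
    Function.update (fun i : Fin N => s i) (Fin.ofNat N r) l =
      fun i : Fin N => Function.update s r l i := by
  funext i
  have h : (i = Fin.ofNat N r) ↔ (i : ℕ) = r := by
    rw [Fin.ext_iff]; simp [Nat.mod_eq_of_lt hr]
  by_cases hi : (i : ℕ) = r
  · rw [h.2 hi]; simp [Nat.mod_eq_of_lt hr]
  · rw [Function.update_of_ne (mt h.1 hi), Function.update_of_ne hi]

/-- Correctness of the compilation, by induction on the run, which unfolds the loops. The embedding
`e` and the exit `k` are arbitrary because the parts of a program sit inside larger label sets and
continue at different places; the variable only holds the letter read last. -/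
theorem Run.reaches {M : ℕ} {m : Λ → Turing.TM2.Stmt (fun _ : Fin N => Letter) Λ (Option Letter)}
    {P : StackProg} {s s' : ℕ → List Letter} (h : Run M P s s') (hs : ∀ j, (s j).length ≤ M)
    (hP : P.bound ≤ N) (e : P.Lbl → Λ) (k : Λ) (he : ∀ l, m (e l) = P.stmt e k l)
    (v : Option Letter) :
    ∃ v', Relation.ReflTransGen (SafeStep M m) (cfg (e P.entry) v s) (cfg k v' s') := by
  induction h generalizing v k with
  | @push r x s s' h ee =>
    refine ⟨v, .single ⟨?_, fun i => (Run.push (M := M) h ee).length_le hs i⟩⟩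
    simp only [bound] at hP
    have hr : r < N := hP
    simp only [cfg, he, stmt, Turing.TM2.step, Turing.TM2.stepAux, ee, ← update_restrict s hr]
    simp [Nat.mod_eq_of_lt hr]
  | @pop r s s' ee =>
    refine ⟨v, .single ⟨?_, fun i => (Run.pop (M := M) ee).length_le hs i⟩⟩
    simp only [bound] at hP
    have hr : r < N := hP
    simp only [cfg, he, stmt, Turing.TM2.step, Turing.TM2.stepAux, ee, ← update_restrict s hr]
    simp [Nat.mod_eq_of_lt hr]
  | @seq P Q s s' s'' h1 h2 ih1 ih2 =>
    simp only [bound, max_le_iff] at hP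
    obtain ⟨v1, r1⟩ := ih1 hs hP.1 (fun l => e (Sum.inl l)) (e (Sum.inr Q.entry))
      (fun l => he (Sum.inl l)) v
    obtain ⟨v2, r2⟩ := ih2 (h1.length_le hs) hP.2 (fun l => e (Sum.inr l)) k
      (fun l => he (Sum.inr l)) v1
    exact ⟨v2, r1.trans r2⟩
  | @iteT r t P Q s s' ht h1 ih =>
    simp only [bound, max_le_iff] at hP
    have hr : r < N := hP.1
    obtain ⟨v1, r1⟩ := ih hs hP.2.1 (fun l => e (some (Sum.inl l))) k
      (fun l => he (some (Sum.inl l))) (s r).head?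
    refine ⟨v1, Relation.ReflTransGen.head ⟨?_, fun i => hs i⟩ r1⟩
    have := he none
    simp only [stmt] at this
    simp [cfg, entry, this, Nat.mod_eq_of_lt hr, ht]
  | @iteF r t P Q s s' ht h1 ih =>
    simp only [bound, max_le_iff] at hP
    have hr : r < N := hP.1
    obtain ⟨v1, r1⟩ := ih hs hP.2.2 (fun l => e (some (Sum.inr l))) k
      (fun l => he (some (Sum.inr l))) (s r).head?
    refine ⟨v1, Relation.ReflTransGen.head ⟨?_, fun i => hs i⟩ r1⟩
    have := he none
    simp only [stmt] at this
    simp [cfg, entry, this, Nat.mod_eq_of_lt hr, ht]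
  | @loopT r t P s s' s'' ht h1 h2 ih1 ih2 =>
    have hP' := hP
    simp only [bound, max_le_iff] at hP
    have hr : r < N := hP.1
    obtain ⟨v1, r1⟩ := ih1 hs hP.2 (fun l => e (some l)) (e none)
      (fun l => he (some l)) (s r).head?
    obtain ⟨v2, r2⟩ := ih2 (h1.length_le hs) hP' e k he v1
    refine ⟨v2, Relation.ReflTransGen.head ⟨?_, fun i => hs i⟩ (r1.trans r2)⟩
    have := he none
    simp only [stmt] at this
    simp [cfg, entry, this, Nat.mod_eq_of_lt hr, ht]
  | @loopF r t P s ht =>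
    simp only [bound, max_le_iff] at hP
    have hr : r < N := hP.1
    refine ⟨(s r).head?, .single ⟨?_, fun i => hs i⟩⟩
    have := he none
    simp only [stmt] at this
    simp [cfg, entry, this, Nat.mod_eq_of_lt hr, ht]

/-- The machine of a program, its input stack being the stack `0` and its output stack the
stack `1`. -/
noncomputable def machine (P : StackProg) : Turing.FinTM2 :=
  letI := P.finite_lbl
  letI := Fintype.ofFinite P.Lbl
  { K := Fin (P.bound + 2)
    k₀ := 0
    k₁ := 1
    Γ := fun _ => Letter
    Λ := Option P.Lbl
    main := some P.entry
    σ := Option Letter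
    initialState := none
    Γk₀Fin := inferInstanceAs (Fintype Letter)
    m := fun l => match l with
      | none => .load (fun _ => none) .halt
      | some l => P.stmt some none l }

theorem inFPSpace {α β : Type} {ea : α → List Letter} {eb : β → List Letter} {f : α → β}
    (P : StackProg) (p : Polynomial ℕ)
    (h : ∀ a, Run (p.eval (ea a).length) P (Function.update (fun _ => []) 0 (ea a))
      (Function.update (fun _ => []) 1 (eb (f a)))) : InFPSpace ea eb f := by
  refine ⟨⟨P.machine, Equiv.refl Letter, Equiv.refl Letter⟩,
    -- A run bounds each stack separately, so the bound is multiplied by the number of stacks. The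
    -- summand `X` makes room for the input at the start.
    Polynomial.C (P.bound + 2) * (p + Polynomial.X), fun _ => inferInstanceAs (Finite Letter),
    fun a => ?_⟩
  set M := p.eval (ea a).length + (ea a).length with hM
  have hrun : Run M P (Function.update (fun _ => []) 0 (ea a))
      (Function.update (fun _ => []) 1 (eb (f a))) := by
    have : ∀ {M M' P s s'}, M ≤ M' → Run M P s s' → Run M' P s s' := by
      intro M M' P s s' hM h
      induction h with
      | push h e => exact .push (h.trans_le hM) e
      | pop e => exact .pop e
      | seq _ _ h1 h2 => exact .seq h1 h2
      | iteT t _ h => exact .iteT t h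
      | iteF t _ h => exact .iteF t h
      | loopT t _ _ h1 h2 => exact .loopT t h1 h2
      | loopF t => exact .loopF t
    exact this (Nat.le_add_right _ _) (h a)
  have hs : ∀ j, (Function.update (fun _ : ℕ => ([] : List Letter)) 0 (ea a) j).length ≤ M := by
    intro j
    by_cases hj : j = 0
    · subst hj; simp [M]
    · simp [hj]
  obtain ⟨v, hv⟩ := hrun.reaches (N := P.bound + 2) (m := P.machine.m) hs (Nat.le_add_right _ _)
    some none (fun _ => rfl) none
  have hinit : Turing.initList P.machine ((ea a).map (Equiv.refl Letter).symm) =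
      cfg (some P.entry) none (Function.update (fun _ => []) 0 (ea a)) := by
    change Turing.TM2.Cfg.mk _ _ _ = Turing.TM2.Cfg.mk _ _ _
    congr 1
    funext k
    by_cases hk : k = P.machine.k₀
    · subst hk; exact (dif_pos rfl).trans (List.map_id _)
    · have : @Fin.val (P.bound + 2) k ≠ 0 := fun h => hk (Fin.ext (n := P.bound + 2) h)
      exact (dif_neg hk).trans (Function.update_of_ne (f := fun _ => []) this _).symm
  have hhalt : Turing.haltList P.machine ((eb (f a)).map (Equiv.refl Letter).symm) =
      ⟨none, none, fun i : Fin (P.bound + 2) =>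
        Function.update (fun _ => []) 1 (eb (f a)) (i : ℕ)⟩ := by
    change Turing.TM2.Cfg.mk _ _ _ = Turing.TM2.Cfg.mk _ _ _
    congr 1
    funext k
    by_cases hk : k = P.machine.k₁
    · subst hk; exact (dif_pos rfl).trans (List.map_id _)
    · have : @Fin.val (P.bound + 2) k ≠ 1 := fun h => hk (Fin.ext (n := P.bound + 2) h)
      exact (dif_neg hk).trans (Function.update_of_ne (f := fun _ => []) this _).symm
  -- One more step leads from the exit label to the halting configuration; it resets the variable,
  -- as `haltList` requires.
  have hv' := hv.tail (c := ⟨none, none, fun i : Fin (P.bound + 2) =>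
        Function.update (fun _ => []) 1 (eb (f a)) (i : ℕ)⟩)
      ⟨rfl, fun i => hrun.length_le hs i⟩
  refine ⟨?_, fun c hc => ?_⟩
  · change StateTransition.Reaches P.machine.step
      (Turing.initList P.machine ((ea a).map (Equiv.refl Letter).symm))
      (Turing.haltList P.machine ((eb (f a)).map (Equiv.refl Letter).symm))
    rw [hinit, hhalt]
    exact SafeStep.reaches hv'
  · change StateTransition.Reaches P.machine.step
      (Turing.initList P.machine ((ea a).map (Equiv.refl Letter).symm)) c at hc
    rw [hinit] at hc
    have := SafeStep.length_le hv' rfl (fun i => hs i) hc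
    calc P.machine.space c ≤ (@Finset.univ P.machine.K P.machine.kFin).sum fun _ => M :=
          Finset.sum_le_sum fun i _ => this i
      _ = (P.bound + 2) * M := by
          rw [Finset.sum_const, smul_eq_mul]
          congr 1
          exact Finset.card_fin _
      _ = _ := by simp [hM]

end StackProg

/-! ### Counters -/

/-- The successor on binary words, least significant bit first. -/
def incBits : List Bool → List Bool
  | [] => [true]
  | false :: l => true :: l
  | true :: l => false :: incBits l

/-- The predecessor on binary words, least significant bit first. -/
def decBits : List Bool → List Bool
  | [] => []
  | false :: l => true :: decBits l
  | true :: [] => []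
  | true :: b :: l => false :: b :: l

theorem incBits_bits (n : ℕ) : incBits n.bits = (n + 1).bits := by
  induction n using Nat.binaryRec' with
  | zero => simp [incBits]
  | bit b n h ih =>
    rw [Nat.bits_append_bit n b h]
    cases b with
    | false =>
      have : Nat.bit false n + 1 = Nat.bit true n := by simp [Nat.bit]
      rw [this, Nat.bits_append_bit n true (fun _ => rfl), incBits]
    | true =>
      have : Nat.bit true n + 1 = Nat.bit false (n + 1) := by simp [Nat.bit]; ring
      rw [this, Nat.bits_append_bit (n + 1) false (by simp), incBits, ih]

/-- `Nat.bits` has no leading zeros. So the top digit `1` must be erased instead of becoming `0`,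
which is why `decBits` treats `[true]` separately. -/
theorem decBits_bits (n : ℕ) : decBits n.bits = (n - 1).bits := by
  induction n using Nat.binaryRec' with
  | zero => simp [decBits]
  | bit b n h ih =>
    rw [Nat.bits_append_bit n b h]
    cases b with
    | false =>
      have h0 : n ≠ 0 := fun h0 => by simpa using h h0
      have : Nat.bit false n - 1 = Nat.bit true (n - 1) := by simp [Nat.bit]; omega
      rw [this, Nat.bits_append_bit (n - 1) true (fun _ => rfl), decBits, ih]
    | true =>
      have : Nat.bit true n - 1 = 2 * n := by simp [Nat.bit]
      rw [this]
      by_cases h0 : n = 0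
      · subst h0; simp [decBits]
      · rw [Nat.bit0_bits n h0]
        match hn : n.bits with
        | [] =>
          have := Nat.size_eq_bits_len n
          rw [hn] at this
          exact absurd (Nat.size_eq_zero.1 this.symm) h0
        | b :: l => rfl

namespace StackProg

/-- Stacks with prescribed contents of the stack `R` and of the scratch stack `2`. -/
def st (s : ℕ → List Letter) (R : ℕ) (l t : List Letter) : ℕ → List Letter :=
  Function.update (Function.update s R l) 2 t

section st

variable {s : ℕ → List Letter} {R : ℕ} {l t : List Letter} (l' : List Letter) (hR : R ≠ 2)

@[simp] theorem st_two : st s R l t 2 = t := by simp [st]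

include hR in
@[simp] theorem st_self : st s R l t R = l := by simp [st, hR]

@[simp] theorem update_st_two : Function.update (st s R l t) 2 l' = st s R l l' := by
  simp [st]

include hR in
@[simp] theorem update_st_self : Function.update (st s R l t) R l' = st s R l' t := by
  rw [st, Function.update_comm hR.symm, Function.update_idem, st]

end st

/-- The program that does nothing. -/
def nop : StackProg := loop 0 (fun _ => false) (pop 0)

theorem Run.nop {M : ℕ} {s : ℕ → List Letter} : Run M nop s s := .loopF rfl

/-- Moving the scratch stack onto the stack `R`, all letters being replaced by `x`. -/
def backP (R : ℕ) (x : Letter) : StackProg := loop 2 (fun x => x.isSome) (seq (pop 2) (push R x))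

theorem Run.back {M R : ℕ} (hR : R ≠ 2) {s : ℕ → List Letter} (x : Letter) (k : ℕ)
    (l : List Letter) (h : k + l.length ≤ M) :
    Run M (backP R x) (st s R l (List.replicate k x))
      (st s R (List.replicate k x ++ l) []) := by
  induction k generalizing l with
  | zero => exact .loopF (by simp)
  | succ k ih =>
    refine .loopT (s' := st s R (x :: l) (List.replicate k x)) (by simp [List.replicate_succ])
      (.seq (.pop rfl) (.push ?_ ?_)) ?_
    · simp [hR]; omega
    · simp [hR, List.replicate_succ]
    · have := ih (x :: l) (by simp; omega)
      rwa [List.append_cons, ← List.replicate_succ'] at this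

/-- Carry propagation: the lowest ones are popped and parked as zeros on the scratch stack, the next
digit becomes `1` (also when the stack is exhausted), and the zeros return. -/
def incP (R : ℕ) : StackProg :=
  seq (loop R (fun x => decide (x = some (bit true))) (seq (pop R) (push 2 (bit false))))
    (seq (pop R) (seq (push R (bit true)) (backP R (bit false))))

theorem Run.inc {M R : ℕ} (hR : R ≠ 2) {s : ℕ → List Letter} (l : List Bool) (k : ℕ)
    (h : k + (incBits l).length ≤ M) :
    Run M (incP R) (st s R (l.map bit) (List.replicate k (bit false)))
      (st s R (List.replicate k (bit false) ++ (incBits l).map bit) []) := by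
  induction l generalizing k with
  | nil =>
    simp only [incBits, List.length_singleton] at h
    refine .seq (.loopF (by simp [hR])) (.seq (.pop rfl) (.seq (.push (by simp [hR]; omega) rfl) ?_))
    simp only [st_self hR, update_st_self _ hR, List.map_nil, List.tail_nil]
    exact Run.back hR _ _ _ (by simpa using h)
  | cons b l ih =>
    cases b with
    | false =>
      simp only [incBits, List.length_cons] at h
      refine .seq (.loopF (by simp [hR])) (.seq (.pop rfl)
        (.seq (.push (by simp [hR]; omega) rfl) ?_))
      simp only [st_self hR, update_st_self _ hR, List.map_cons, List.tail_cons]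
      exact Run.back hR _ _ _ (by simpa using h)
    | true =>
      simp only [incBits, List.length_cons] at h
      have := ih (k + 1) (by omega)
      -- The induction hypothesis runs the whole program. Its first part is the loop, to which one
      -- more round is prepended; the rest is kept.
      cases this with
      | seq h1 h2 =>
        refine .seq (.loopT (s' := st s R (l.map bit) (List.replicate (k + 1) (bit false)))
          (by simp [hR]) (.seq (.pop rfl) (.push ?_ ?_)) h1) ?_
        · simp [hR]; omega
        · simp [hR, List.replicate_succ]
        · simpa [List.replicate_succ', incBits] using h2

/-- Borrowing: the lowest zeros become ones and the first one becomes a zero, unless it was the top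
digit, in which case it disappears. The test after the pop detects this. -/
def decP (R : ℕ) : StackProg :=
  seq (loop R (fun x => decide (x = some (bit false))) (seq (pop R) (push 2 (bit true))))
    (seq (pop R) (seq (ite R (fun x => x.isSome) (push R (bit false)) nop) (backP R (bit true))))

theorem Run.dec {M R : ℕ} (hR : R ≠ 2) {s : ℕ → List Letter} (l : List Bool) (k : ℕ)
    (h : k + l.length ≤ M) :
    Run M (decP R) (st s R (l.map bit) (List.replicate k (bit true)))
      (st s R (List.replicate k (bit true) ++ (decBits l).map bit) []) := by
  induction l generalizing k with
  | nil =>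
    refine .seq (.loopF (by simp [hR])) (.seq (.pop rfl) (.seq (.iteF (by simp [hR]) .nop) ?_))
    simp only [st_self hR, update_st_self _ hR, List.map_nil, List.tail_nil]
    exact Run.back hR _ _ _ (by simpa using h)
  | cons b l ih =>
    simp only [List.length_cons] at h
    cases b with
    | true =>
      cases l with
      | nil =>
        refine .seq (.loopF (by simp [hR])) (.seq (.pop rfl) (.seq (.iteF (by simp [hR]) .nop) ?_))
        simp only [st_self hR, update_st_self _ hR, List.map_cons, List.tail_cons]
        exact Run.back hR _ _ _ (by simp at h; simp; omega)
      | cons c l =>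
        simp only [List.length_cons] at h
        refine .seq (.loopF (by simp [hR])) (.seq (.pop rfl) (.seq (.iteT (by simp [hR])
          (.push (by simp [hR]; omega) rfl)) ?_))
        simp only [st_self hR, update_st_self _ hR, List.map_cons, List.tail_cons]
        exact Run.back hR _ _ _ (by simp; omega)
    | false =>
      have := ih (k + 1) (by omega)
      cases this with
      | seq h1 h2 =>
        refine .seq (.loopT (s' := st s R (l.map bit) (List.replicate (k + 1) (bit true)))
          (by simp [hR]) (.seq (.pop rfl) (.push ?_ ?_)) h1) ?_
        · simp [hR]; omega
        · simp [hR, List.replicate_succ]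
        · simpa [List.replicate_succ', decBits] using h2

/-- The stacks holding the numbers `s j` in binary, with empty input, output and scratch stacks. -/
def counters (s : ℕ → ℕ) : ℕ → List Letter
  | 0 | 1 | 2 => []
  | j + 3 => natWord (s j)

theorem counters_update (s : ℕ → ℕ) (r m : ℕ) :
    counters (Function.update s r m) = Function.update (counters s) (r + 3) (natWord m) := by
  funext j
  match j with
  | 0 | 1 | 2 => simp [counters]
  | j + 3 =>
    by_cases h : j = r
    · subst h; simp [counters]
    · simp [counters, h]

theorem counters_update_st (s : ℕ → ℕ) (r m : ℕ) :
    counters (Function.update s r m) = st (counters s) (r + 3) (natWord m) [] := by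
  rw [counters_update, st, Function.update_comm (by omega)]
  congr 1
  funext j
  by_cases h : j = 2
  · subst h; simp [counters]
  · simp [h]

theorem natWord_length (k : ℕ) : (natWord k).length = k.size := by
  rw [natWord, List.length_map, Nat.size_eq_bits_len]

/-- Runs on counters. -/
def CRun (M : ℕ) (P : StackProg) (s s' : ℕ → ℕ) : Prop := Run M P (counters s) (counters s')

theorem CRun.seq {M : ℕ} {P Q : StackProg} {s s' s'' : ℕ → ℕ} (h : CRun M P s s')
    (h' : CRun M Q s' s'') : CRun M (seq P Q) s s'' := Run.seq h h'

theorem CRun.nop {M : ℕ} {s : ℕ → ℕ} : CRun M nop s s := Run.nop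

theorem CRun.inc {M : ℕ} {s : ℕ → ℕ} (r : ℕ) (h : (s r + 1).size ≤ M) :
    CRun M (incP (r + 3)) s (Function.update s r (s r + 1)) := by
  have := Run.inc (M := M) (R := r + 3) (by omega) (s := counters s) (s r).bits 0
    (by rwa [incBits_bits, Nat.size_eq_bits_len, zero_add])
  rw [incBits_bits] at this
  unfold CRun
  rw [counters_update_st]
  convert this using 1
  · conv_lhs => rw [← Function.update_eq_self r s, counters_update_st]
    rfl
  · rfl

theorem CRun.dec {M : ℕ} {s : ℕ → ℕ} (r : ℕ) (h : (s r).size ≤ M) :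
    CRun M (decP (r + 3)) s (Function.update s r (s r - 1)) := by
  have := Run.dec (M := M) (R := r + 3) (by omega) (s := counters s) (s r).bits 0
    (by rwa [Nat.size_eq_bits_len, zero_add])
  rw [decBits_bits] at this
  unfold CRun
  rw [counters_update_st]
  convert this using 1
  · conv_lhs => rw [← Function.update_eq_self r s, counters_update_st]
    rfl
  · rfl

/-- The loop that runs as long as the counter `r` is positive. -/
def whileP (r : ℕ) (P : StackProg) : StackProg := loop (r + 3) (fun x => x.isSome) P

theorem isSome_head_counters (s : ℕ → ℕ) (r : ℕ) :
    ((counters s) (r + 3)).head?.isSome = true ↔ s r ≠ 0 := by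
  have h := natWord_length (s r)
  simp only [counters]
  cases hw : natWord (s r) with
  | nil =>
    rw [hw] at h
    simp [Nat.size_eq_zero.1 h.symm]
  | cons a l =>
    rw [hw] at h
    have : s r ≠ 0 := fun h0 => by simp [h0] at h
    simpa using this

theorem CRun.whileT {M : ℕ} {s s' s'' : ℕ → ℕ} {r : ℕ} {P : StackProg} (h0 : s r ≠ 0)
    (h : CRun M P s s') (h' : CRun M (whileP r P) s' s'') : CRun M (whileP r P) s s'' :=
  Run.loopT ((isSome_head_counters s r).2 h0) h h'

theorem CRun.whileF {M : ℕ} {s : ℕ → ℕ} {r : ℕ} {P : StackProg} (h0 : s r = 0) :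
    CRun M (whileP r P) s s :=
  Run.loopF (by
    have := (isSome_head_counters s r).not.2 (not_not.2 h0)
    simpa using this)

/-- A loop that is run `k` times on the way along the states `S k, …, S 0`. -/
theorem CRun.while {M : ℕ} {r : ℕ} {P : StackProg} (S : ℕ → ℕ → ℕ) (k : ℕ)
    (hr : ∀ i, S i r = i) (h : ∀ i < k, CRun M P (S (i + 1)) (S i)) :
    CRun M (whileP r P) (S k) (S 0) := by
  induction k with
  | zero => exact .whileF (hr 0)
  | succ k ih =>
    exact .whileT (by simp [hr]) (h k k.lt_succ_self) (ih fun i hi => h i (hi.trans k.lt_succ_self))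

theorem CRun.size_le {M : ℕ} {P : StackProg} {s s' : ℕ → ℕ} (h : CRun M P s s')
    (hs : ∀ j, (s j).size ≤ M) (j : ℕ) : (s' j).size ≤ M := by
  have := Run.length_le h (fun j => ?_) (j + 3)
  · rwa [← natWord_length]
  · match j with
    | 0 | 1 | 2 => simp [counters]
    | j + 3 => simpa [counters, natWord_length] using hs j

end StackProg

namespace StackProg

/-! ### Elementary counter programs -/

def zeroP (r : ℕ) : StackProg := whileP r (decP (r + 3))

theorem CRun.zero {M : ℕ} {s : ℕ → ℕ} (r : ℕ) (h : (s r).size ≤ M) :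
    CRun M (zeroP r) s (Function.update s r 0) := by
  have := CRun.while (M := M) (r := r) (P := decP (r + 3)) (fun i => Function.update s r i) (s r)
    (fun i => by simp) (fun i hi => by
      have := CRun.dec (M := M) (s := Function.update s r (i + 1)) r
        (by simpa using (Nat.size_le_size hi).trans h)
      simpa using this)
  simpa [zeroP] using this

/-- Counting `r` down and `t` up takes time exponential in the sizes, but no extra space. -/
def moveP (r t : ℕ) : StackProg :=
  seq (zeroP t) (whileP r (seq (decP (r + 3)) (incP (t + 3))))

theorem CRun.move {M : ℕ} {s : ℕ → ℕ} {r t : ℕ} (hrt : r ≠ t) (hr : (s r).size ≤ M)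
    (ht : (s t).size ≤ M) :
    CRun M (moveP r t) s (Function.update (Function.update s t (s r)) r 0) := by
  refine (CRun.zero t ht).seq ?_
  have := CRun.while (M := M) (r := r) (P := StackProg.seq (decP (r + 3)) (incP (t + 3)))
    (fun i => Function.update (Function.update s t (s r - i)) r i) (s r)
    (fun i => by simp) (fun i hi => by
      refine (CRun.dec r ?_).seq ?_
      · simpa using (Nat.size_le_size hi).trans hr
      · convert CRun.inc (M := M) t ?_ using 1
        · funext j
          simp only [Function.update_apply]
          split_ifs <;> omega
        · simp only [Function.update_apply, hrt.symm, if_false, if_true]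
          exact (Nat.size_le_size (by omega)).trans hr)
  have e : Function.update (Function.update s t 0) r (s r) = Function.update s t 0 := by
    conv_rhs => rw [← Function.update_eq_self r (Function.update s t 0), Function.update_of_ne hrt]
  rwa [Nat.sub_self, Nat.sub_zero, e] at this

/-- Reading `r` destroys it, so two copies are made and the one in `t + 1` is moved back. -/
def copyP (r t : ℕ) : StackProg :=
  seq (whileP r (seq (decP (r + 3)) (StackProg.seq (incP (t + 3)) (incP (t + 1 + 3))))) (moveP (t + 1) r)

theorem CRun.copy {M : ℕ} {s : ℕ → ℕ} {r t : ℕ} (hrt : r < t) (hr : (s r).size ≤ M)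
    (ht : s t = 0) (ht' : s (t + 1) = 0) :
    CRun M (copyP r t) s (Function.update s t (s r)) := by
  have h1 := CRun.while (M := M) (r := r)
    (P := StackProg.seq (decP (r + 3)) (StackProg.seq (incP (t + 3)) (incP (t + 1 + 3))))
    (fun i => Function.update (Function.update (Function.update s t (s r - i)) (t + 1) (s r - i)) r i)
    (s r) (fun i => by simp) (fun i hi => by
      refine (CRun.dec r ?_).seq ((CRun.inc t ?_).seq ?_)
      · simpa using (Nat.size_le_size hi).trans hr
      · refine (Nat.size_le_size ?_).trans hr
        simp only [Function.update_apply]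
        split_ifs <;> omega
      · convert CRun.inc (M := M) (t + 1) ?_ using 1
        · funext j
          simp only [Function.update_apply]
          split_ifs <;> omega
        · refine (Nat.size_le_size ?_).trans hr
          simp only [Function.update_apply]
          split_ifs <;> omega)
  refine CRun.seq (s' := Function.update (Function.update (Function.update s t (s r))
    (t + 1) (s r)) r 0) ?_ ?_
  · convert h1 using 1
    · funext j
      simp only [Function.update_apply]
      split_ifs with h1 h2 h3
      · rw [h1]
      · rw [h2, ht', Nat.sub_self]
      · rw [h3, ht, Nat.sub_self]
      · rfl
    · simp
  · convert CRun.move (M := M) (r := t + 1) (t := r) (by omega) ?_ ?_ using 1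
    · funext j
      simp only [Function.update_apply]
      split_ifs with h1 h2 <;> first | omega | (subst_vars; simp_all)
    · simpa [Function.update_apply, show t + 1 ≠ r by omega] using hr
    · simp

end StackProg

/-! ### Functions computable in polynomial space -/

/-- `f` is bounded by a polynomial in `n`. -/
def PolyBound {ι : Type} (n f : ι → ℕ) : Prop := ∃ p : Polynomial ℕ, ∀ a, f a ≤ p.eval (n a)

namespace PolyBound

variable {ι : Type} {n f g : ι → ℕ}

theorem of_le (hg : PolyBound n g) (h : ∀ a, f a ≤ g a) : PolyBound n f :=
  hg.imp fun _ hp a => (h a).trans (hp a)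

theorem const (c : ℕ) : PolyBound n (fun _ => c) := ⟨Polynomial.C c, fun a => by simp⟩

theorem self : PolyBound n n := ⟨Polynomial.X, fun a => by simp⟩

theorem add (hf : PolyBound n f) (hg : PolyBound n g) : PolyBound n (fun a => f a + g a) := by
  obtain ⟨p, hp⟩ := hf
  obtain ⟨q, hq⟩ := hg
  exact ⟨p + q, fun a => by simpa using Nat.add_le_add (hp a) (hq a)⟩

theorem mul (hf : PolyBound n f) (hg : PolyBound n g) : PolyBound n (fun a => f a * g a) := by
  obtain ⟨p, hp⟩ := hf
  obtain ⟨q, hq⟩ := hg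
  exact ⟨p * q, fun a => by simpa using Nat.mul_le_mul (hp a) (hq a)⟩

theorem comp {κ : Type} (hf : PolyBound n f) (φ : κ → ι) :
    PolyBound (fun k => n (φ k)) (fun k => f (φ k)) :=
  hf.imp fun _ hp k => hp (φ k)

end PolyBound

/-- Points of `ι` together with an index below `N`. -/
structure Below {ι : Type} (N : ι → ℕ) where
  base : ι
  idx : ℕ
  lt : idx < N base

/-- The given functions on `ι`, and the index. -/
def Below.vars {ι : Type} (N : ι → ℕ) (X : Set (ι → ℕ)) : Set (Below N → ℕ) :=
  insert Below.idx ((fun x p => x p.base) '' X)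

open StackProg

/-- `f` is computable from the values of the functions in `X`, in space polynomial in `n`. The
program finds the value of `x` in the counter `r x`, and uses the counters from `d` on. -/
def PSpace {ι : Type} (n : ι → ℕ) (X : Set (ι → ℕ)) (f : ι → ℕ) : Prop :=
  PolyBound n (fun a => (f a).size) ∧
  ∀ (r : (ι → ℕ) → ℕ) (d : ℕ), (∀ x ∈ X, r x < d) →
    ∃ (P : StackProg) (p : Polynomial ℕ), ∀ (a : ι) (s : ℕ → ℕ) (M : ℕ), p.eval (n a) ≤ M →
      (∀ j, (s j).size ≤ M) → (∀ x ∈ X, s (r x) = x a) → (∀ j, d ≤ j → s j = 0) →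
      CRun M P s (Function.update s d (f a))

namespace PSpace

variable {ι : Type} {n : ι → ℕ} {X : Set (ι → ℕ)} {f g : ι → ℕ}

theorem mono {Y : Set (ι → ℕ)} (h : PSpace n X f) (hXY : X ⊆ Y) : PSpace n Y f :=
  ⟨h.1, fun r d hr => (h.2 r d fun x hx => hr x (hXY hx)).imp fun _ =>
    Exists.imp fun _ hP a s M hM hs hx => hP a s M hM hs fun x hx' => hx x (hXY hx')⟩

theorem comp {κ : Type} (h : PSpace n X f) (φ : κ → ι) :
    PSpace (fun k => n (φ k)) ((fun x k => x (φ k)) '' X) (fun k => f (φ k)) :=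
  ⟨h.1.comp φ, fun r d hr =>
    (h.2 (fun x => r fun k => x (φ k)) d fun x hx => hr _ ⟨x, hx, rfl⟩).imp fun _ =>
      Exists.imp fun _ hP k s M hM hs hx => hP (φ k) s M hM hs fun x hx' => hx _ ⟨x, hx', rfl⟩⟩

theorem lift {N : ι → ℕ} (h : PSpace n X f) :
    PSpace (fun p : Below N => n p.base) (Below.vars N X) (fun p => f p.base) :=
  (h.comp Below.base).mono (Set.subset_insert _ _)

theorem var {x : ι → ℕ} (hx : x ∈ X) (hb : PolyBound n (fun a => (x a).size)) : PSpace n X x := by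
  refine ⟨hb, fun r d hr => ⟨copyP (r x) d, 0, fun a s M _ hs hX h0 => ?_⟩⟩
  rw [← hX x hx]
  exact CRun.copy (hr x hx) (hs _) (h0 _ le_rfl) (h0 _ (Nat.le_succ _))

theorem zero : PSpace n X (fun _ => 0) := by
  refine ⟨(PolyBound.const 0).of_le fun a => by simp, fun r d _ => ⟨nop, 0, fun a s M _ _ _ h0 => ?_⟩⟩
  rw [← h0 d le_rfl, Function.update_eq_self]
  exact CRun.nop

theorem succ (hf : PSpace n X f) : PSpace n X (fun a => f a + 1) := by
  have hb : PolyBound n (fun a => (f a + 1).size) := (hf.1.add (.const 1)).of_le fun a => by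
    rw [Nat.size_le, pow_succ]
    have := Nat.lt_size_self (f a)
    omega
  refine ⟨hb, fun r d hr => ?_⟩
  obtain ⟨P, p, hP⟩ := hf.2 r d hr
  obtain ⟨q, hq⟩ := hb
  refine ⟨seq P (incP (d + 3)), p + q, fun a s M hM hs hX h0 => ?_⟩
  simp only [Polynomial.eval_add] at hM
  have h1 := (hP a s M (by omega) hs hX h0).seq
    (CRun.inc d (by have := hq a; simp only [Function.update_self] at this ⊢; omega))
  simpa using h1

theorem pred (hf : PSpace n X f) : PSpace n X (fun a => f a - 1) := by
  refine ⟨hf.1.of_le fun a => Nat.size_le_size (Nat.sub_le _ _), fun r d hr => ?_⟩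
  obtain ⟨P, p, hP⟩ := hf.2 r d hr
  refine ⟨seq P (decP (d + 3)), p, fun a s M hM hs hX h0 => ?_⟩
  have h1 := hP a s M hM hs hX h0
  simpa using h1.seq (CRun.dec d (h1.size_le hs d))

theorem lift_idx {N : ι → ℕ} (hN : PSpace n X N) :
    PSpace (fun p : Below N => n p.base) (Below.vars N X) Below.idx :=
  var (Set.mem_insert _ _) ((hN.1.comp Below.base).of_le fun p => Nat.size_le_size p.lt.le)

/-- Bounded primitive recursion. -/
theorem rec {N : ι → ℕ} {h : ι → ℕ → ℕ} (hN : PSpace n X N) (h0 : PSpace n X (fun a => h a 0))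
    (hb : ∃ b, PolyBound n b ∧ ∀ a, ∀ i ≤ N a, (h a i).size ≤ b a)
    (hs : ∀ Y, Below.vars N X ⊆ Y →
      PSpace (fun p : Below N => n p.base) Y (fun p => h p.base p.idx) →
      PSpace (fun p : Below N => n p.base) Y (fun p => h p.base (p.idx + 1))) :
    PSpace n X (fun a => h a (N a)) := by
  classical
  obtain ⟨b, ⟨pb, hpb⟩, hb⟩ := hb
  have hb' : ∀ a, ∀ i ≤ N a, (h a i).size ≤ pb.eval (n a) := fun a i hi => (hb a i hi).trans (hpb a)
  refine ⟨⟨pb, fun a => hb' a _ le_rfl⟩, fun r d hr => ?_⟩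
  -- The value reached so far becomes an additional available function, from which `hs` computes the
  -- next value.
  set hv : Below N → ℕ := fun p => h p.base p.idx with hhv
  have hs' := hs (insert hv (Below.vars N X)) (Set.subset_insert _ _)
    (var (Set.mem_insert _ _) ⟨pb, fun p => hb' _ _ p.lt.le⟩)
  obtain ⟨P₁, p₁, hP₁⟩ := hN.2 r d hr
  obtain ⟨P₀, p₀, hP₀⟩ := h0.2 r (d + 1) (fun x hx => (hr x hx).trans d.lt_succ_self)
  -- Inside the loop the index is found in `d + 2`, the value reached so far in `d + 1`, and the old
  -- functions where they were. Should two of these functions coincide, either place holds the right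
  -- number.
  set r' : (Below N → ℕ) → ℕ := fun y =>
    if y = Below.idx then d + 2 else if y = hv then d + 1 else
      if ex : ∃ x ∈ X, (fun p : Below N => x p.base) = y then r ex.choose else 0 with hr'
  obtain ⟨P₂, p₂, hP₂⟩ := hs'.2 r' (d + 3) (by
    intro y _
    simp only [hr']
    split_ifs with h1 h2 h3
    · omega
    · omega
    · have := hr _ h3.choose_spec.1
      omega
    · omega)
  obtain ⟨p₃, hp₃⟩ := hN.1
  -- Counter `d` holds the number of remaining rounds, `d + 1` the value, `d + 2` the index, and the
  -- loop body delivers its result in `d + 3`. At the end the index is cleared and the value is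
  -- moved to `d`.
  refine ⟨seq P₁ (seq P₀ (seq (whileP d (seq P₂ (seq (moveP (d + 3) (d + 1))
    (seq (incP (d + 2 + 3)) (decP (d + 3)))))) (seq (zeroP (d + 2)) (moveP (d + 1) d)))),
    p₀ + p₁ + p₂ + p₃ + pb, fun a s M hM hsM hX hd => ?_⟩
  simp only [Polynomial.eval_add] at hM
  have hNM : (N a).size ≤ M := (hp₃ a).trans (by omega)
  have hhM : ∀ i ≤ N a, (h a i).size ≤ M := fun i hi => (hb' a i hi).trans (by omega)
  set T : ℕ → ℕ → ℕ → ℕ → ℕ → ℕ := fun x₀ x₁ x₂ x₃ j =>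
    if j = d then x₀ else if j = d + 1 then x₁ else if j = d + 2 then x₂ else
      if j = d + 3 then x₃ else s j with hT
  have T0 : ∀ x₀ x₁ x₂ x₃, T x₀ x₁ x₂ x₃ d = x₀ := fun _ _ _ _ => by simp [hT]
  have T1 : ∀ x₀ x₁ x₂ x₃, T x₀ x₁ x₂ x₃ (d + 1) = x₁ := fun _ _ _ _ => by simp [hT]
  have T2 : ∀ x₀ x₁ x₂ x₃, T x₀ x₁ x₂ x₃ (d + 2) = x₂ := fun _ _ _ _ => by simp [hT]
  have T3 : ∀ x₀ x₁ x₂ x₃, T x₀ x₁ x₂ x₃ (d + 3) = x₃ := fun _ _ _ _ => by simp [hT]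
  have U0 : ∀ x₀ x₁ x₂ x₃ y, Function.update (T x₀ x₁ x₂ x₃) d y = T y x₁ x₂ x₃ := by
    intros; funext j; simp only [hT, Function.update_apply]; split_ifs <;> rfl
  have U1 : ∀ x₀ x₁ x₂ x₃ y, Function.update (T x₀ x₁ x₂ x₃) (d + 1) y = T x₀ y x₂ x₃ := by
    intros; funext j; simp only [hT, Function.update_apply]; split_ifs <;> first | rfl | omega
  have U2 : ∀ x₀ x₁ x₂ x₃ y, Function.update (T x₀ x₁ x₂ x₃) (d + 2) y = T x₀ x₁ y x₃ := by
    intros; funext j; simp only [hT, Function.update_apply]; split_ifs <;> first | rfl | omega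
  have U3 : ∀ x₀ x₁ x₂ x₃ y, Function.update (T x₀ x₁ x₂ x₃) (d + 3) y = T x₀ x₁ x₂ y := by
    intros; funext j; simp only [hT, Function.update_apply]; split_ifs <;> first | rfl | omega
  have hsT : s = T 0 0 0 0 := by
    funext j
    simp only [hT]
    split_ifs <;> first | rfl | exact hd j (by omega)
  have hTX : ∀ x₀ x₁ x₂ x₃, ∀ x ∈ X, T x₀ x₁ x₂ x₃ (r x) = x a := by
    intro _ _ _ _ x hx
    have := hr x hx
    simp only [hT]
    rw [if_neg (by omega), if_neg (by omega), if_neg (by omega), if_neg (by omega), hX x hx]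
  have hTM : ∀ x₀ x₁ x₂ x₃, x₀.size ≤ M → x₁.size ≤ M → x₂.size ≤ M → x₃.size ≤ M →
      ∀ j, (T x₀ x₁ x₂ x₃ j).size ≤ M := by
    intro _ _ _ _ h₀ h₁ h₂ h₃ j
    simp only [hT]
    split_ifs <;> first | assumption | exact hsM j
  have hz : Nat.size 0 ≤ M := by simp
  have hle : ∀ i ≤ N a, i.size ≤ M := fun i hi => (Nat.size_le_size hi).trans hNM
  -- With `i` rounds remaining, `N a - i` rounds have been done.
  have hloop : ∀ i < N a, CRun M (seq P₂ (seq (moveP (d + 3) (d + 1))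
      (seq (incP (d + 2 + 3)) (decP (d + 3))))) (T (i + 1) (h a (N a - (i + 1))) (N a - (i + 1)) 0)
      (T i (h a (N a - i)) (N a - i) 0) := by
    intro i hi
    have e : N a - (i + 1) + 1 = N a - i := by omega
    let q : Below N := ⟨a, N a - (i + 1), by omega⟩
    have c₁ := hP₂ q (T (i + 1) (h a (N a - (i + 1))) (N a - (i + 1)) 0) M
      (by simp only [q]; omega)
      (hTM _ _ _ _ (hle _ hi) (hhM _ (Nat.sub_le _ _)) (hle _ (Nat.sub_le _ _)) hz) (by
      intro y hy
      simp only [hr']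
      split_ifs with h1 h2 h3
      · rw [h1, T2]
      · rw [h2, T1]
      -- Distinct functions on `ι` may have the same restriction `y` to `Below N`, but they agree at
      -- the point in question.
      · have hc := h3.choose_spec
        have e1 : y q = h3.choose a := (congrFun hc.2 q).symm
        rw [e1, hTX _ _ _ _ _ hc.1]
      · rcases hy with hy | hy | ⟨x, hx, hy⟩
        · exact absurd hy h2
        · exact absurd hy h1
        · exact absurd ⟨x, hx, hy⟩ h3) (by
      intro j hj
      simp only [hT]
      split_ifs <;> first | omega | exact hd j (by omega))
    simp only [U3, q, e] at c₁
    have c₂ := CRun.move (M := M) (s := T (i + 1) (h a (N a - (i + 1))) (N a - (i + 1))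
      (h a (N a - i))) (r := d + 3) (t := d + 1) (by omega)
      (by rw [T3]; exact hhM _ (Nat.sub_le _ _)) (by rw [T1]; exact hhM _ (Nat.sub_le _ _))
    rw [T3, U1, U3] at c₂
    have c₃ := CRun.inc (M := M) (s := T (i + 1) (h a (N a - i)) (N a - (i + 1)) 0) (d + 2)
      (by rw [T2, e]; exact hle _ (Nat.sub_le _ _))
    rw [T2, U2, e] at c₃
    have c₄ := CRun.dec (M := M) (s := T (i + 1) (h a (N a - i)) (N a - i) 0) d
      (by rw [T0]; exact hle _ hi)
    rw [T0, U0] at c₄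
    exact c₁.seq (c₂.seq (c₃.seq c₄))
  have c₁ := hP₁ a s M (by omega) hsM hX hd
  rw [hsT, U0] at c₁
  have c₀ := hP₀ a (T (N a) 0 0 0) M (by omega) (hTM _ _ _ _ hNM hz hz hz) (hTX _ _ _ _) (by
    intro j hj
    simp only [hT]
    split_ifs <;> first | rfl | omega | exact hd j (by omega))
  rw [U1] at c₀
  have c₂ := CRun.while (M := M) (r := d) (fun i => T i (h a (N a - i)) (N a - i) 0) (N a)
    (fun i => T0 _ _ _ _) hloop
  simp only [Nat.sub_self, Nat.sub_zero] at c₂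
  have c₃ := CRun.zero (M := M) (s := T 0 (h a (N a)) (N a) 0) (d + 2) (by rwa [T2])
  rw [U2] at c₃
  have c₄ := CRun.move (M := M) (s := T 0 (h a (N a)) 0 0) (r := d + 1) (t := d) (by omega)
    (by rw [T1]; exact hhM _ le_rfl) (by rwa [T0])
  rw [T1, U0, U1] at c₄
  rw [hsT, U0]
  exact c₁.seq (c₀.seq (c₂.seq (c₃.seq c₄)))

end PSpace

/-! ### Binary sizes of sums and products -/

theorem Nat.size_add_le (a b : ℕ) : (a + b).size ≤ a.size + b.size + 1 := by
  rw [Nat.size_le]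
  have h1 := (Nat.lt_size_self a).trans_le (Nat.pow_le_pow_right two_pos (Nat.le_add_right a.size b.size))
  have h2 := (Nat.lt_size_self b).trans_le (Nat.pow_le_pow_right two_pos (Nat.le_add_left b.size a.size))
  rw [pow_succ]
  omega

theorem Nat.size_mul_le (a b : ℕ) : (a * b).size ≤ a.size + b.size := by
  rcases Nat.eq_zero_or_pos b with rfl | hb
  · simp
  rw [Nat.size_le, pow_add]
  exact Nat.mul_lt_mul_of_lt_of_le (Nat.lt_size_self a) (Nat.lt_size_self b).le
    (Nat.two_pow_pos _)

theorem Nat.size_le_self (a : ℕ) : a.size ≤ a := Nat.size_le.2 a.lt_two_pow_self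

/-- The sum is less than `N * 2 ^ b` when `N` is positive. The number of terms enters through its
size only, so exponentially many terms are harmless. -/
theorem Nat.size_sum_le (f : ℕ → ℕ) (N b : ℕ) (h : ∀ i < N, (f i).size ≤ b) :
    (∑ i ∈ Finset.range N, f i).size ≤ N.size + b := by
  rw [Nat.size_le]
  rcases Nat.eq_zero_or_pos N with rfl | hN
  · simp
  calc ∑ i ∈ Finset.range N, f i < ∑ _i ∈ Finset.range N, 2 ^ b :=
        Finset.sum_lt_sum_of_nonempty (by simpa using hN.ne')
          fun i hi => Nat.size_le.1 (h i (Finset.mem_range.1 hi))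
    _ = N * 2 ^ b := by simp
    _ ≤ 2 ^ N.size * 2 ^ b := Nat.mul_le_mul_right _ (Nat.lt_size_self N).le
    _ = _ := (pow_add _ _ _).symm

/-- Sizes add up under multiplication, so here the number of factors itself has to be polynomial. -/
theorem Nat.size_prod_le (f : ℕ → ℕ) (N b : ℕ) (h : ∀ i < N, (f i).size ≤ b) :
    (∏ i ∈ Finset.range N, f i).size ≤ N * b + 1 := by
  induction N with
  | zero => simp
  | succ N ih =>
    rw [Finset.prod_range_succ]
    refine (Nat.size_mul_le _ _).trans ?_
    have h1 := ih fun i hi => h i (hi.trans N.lt_succ_self)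
    have h2 := h N N.lt_succ_self
    rw [Nat.succ_mul]
    omega

/-! ### Arithmetic by iteration, and predicates as 0-1-valued functions -/

open Classical in
/-- The truth value `1` or `0` of a proposition. -/
noncomputable def truthValue (P : Prop) : ℕ := if P then 1 else 0

/-- `P` is decidable from the values of the functions in `X`, in space polynomial in `n`. -/
def PSpacePred {ι : Type} (n : ι → ℕ) (X : Set (ι → ℕ)) (P : ι → Prop) : Prop :=
  PSpace n X (fun a => truthValue (P a))

namespace PSpace

variable {ι : Type} {n : ι → ℕ} {X : Set (ι → ℕ)} {f g k : ι → ℕ}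

theorem const (c : ℕ) : PSpace n X (fun _ => c) := by
  induction c with
  | zero => exact zero
  | succ c ih => exact ih.succ

theorem of_eq (hf : PSpace n X f) (h : ∀ a, f a = g a) : PSpace n X g := funext h ▸ hf

theorem add (hf : PSpace n X f) (hg : PSpace n X g) : PSpace n X (fun a => f a + g a) := by
  refine rec (h := fun a i => f a + i) hg hf
    ⟨_, (hf.1.add hg.1).add (.const 1), fun a i hi => (Nat.size_add_le _ _).trans ?_⟩
    fun Y _ h => h.succ
  have := Nat.size_le_size hi
  omega

theorem sub (hf : PSpace n X f) (hg : PSpace n X g) : PSpace n X (fun a => f a - g a) :=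
  rec (h := fun a i => f a - i) hg hf
    ⟨_, hf.1, fun _ _ _ => Nat.size_le_size (Nat.sub_le _ _)⟩ fun _ _ h => h.pred

theorem mul (hf : PSpace n X f) (hg : PSpace n X g) : PSpace n X (fun a => f a * g a) :=
  rec (h := fun a i => f a * i) hg zero
    ⟨_, hf.1.add hg.1, fun _ _ hi => (Nat.size_mul_le _ _).trans
      (Nat.add_le_add_left (Nat.size_le_size hi) _)⟩
    fun _ hY h => h.add (hf.lift.mono hY)

/-- A recursion of length `f a` whose step forgets the previous value: without any round it yields
`g a`, after at least one round `k a`. -/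
theorem ite_zero (hf : PSpace n X f) (hg : PSpace n X g) (hk : PSpace n X k) :
    PSpace n X (fun a => if f a = 0 then g a else k a) := by
  refine (rec (h := fun a i => if i = 0 then g a else k a) hf hg
    ⟨_, hg.1.add hk.1, fun _ _ _ => ?_⟩ fun _ hY _ => (hk.lift.mono hY).of_eq fun p => by simp)
  split_ifs <;> omega

end PSpace

namespace PSpacePred

variable {ι : Type} {n : ι → ℕ} {X : Set (ι → ℕ)} {f g : ι → ℕ} {P Q : ι → Prop}

theorem of_iff (h : PSpacePred n X P) (hPQ : ∀ a, P a ↔ Q a) : PSpacePred n X Q :=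
  (funext fun a => propext (hPQ a) : P = Q) ▸ h

theorem mono {Y : Set (ι → ℕ)} (h : PSpacePred n X P) (hXY : X ⊆ Y) : PSpacePred n Y P :=
  PSpace.mono h hXY

theorem eq_zero (hf : PSpace n X f) : PSpacePred n X (fun a => f a = 0) :=
  (hf.ite_zero (.const 1) .zero).of_eq fun a => by simp [truthValue]

theorem not (h : PSpacePred n X P) : PSpacePred n X (fun a => ¬P a) :=
  (PSpace.sub (.const 1) h).of_eq fun a => by by_cases hP : P a <;> simp [truthValue, hP]

theorem and (hP : PSpacePred n X P) (hQ : PSpacePred n X Q) : PSpacePred n X (fun a => P a ∧ Q a) :=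
  (PSpace.mul hP hQ).of_eq fun a => by
    by_cases h : P a <;> by_cases h' : Q a <;> simp [truthValue, h, h']

theorem or (hP : PSpacePred n X P) (hQ : PSpacePred n X Q) : PSpacePred n X (fun a => P a ∨ Q a) :=
  (hP.not.and hQ.not).not.of_iff fun a => by tauto

theorem imp (hP : PSpacePred n X P) (hQ : PSpacePred n X Q) : PSpacePred n X (fun a => P a → Q a) :=
  (hP.not.or hQ).of_iff fun a => by tauto

theorem iff (hP : PSpacePred n X P) (hQ : PSpacePred n X Q) :
    PSpacePred n X (fun a => P a ↔ Q a) :=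
  ((hP.imp hQ).and (hQ.imp hP)).of_iff fun a => by tauto

theorem le (hf : PSpace n X f) (hg : PSpace n X g) : PSpacePred n X (fun a => f a ≤ g a) :=
  (eq_zero (hf.sub hg)).of_iff fun _ => Nat.sub_eq_zero_iff_le

theorem lt (hf : PSpace n X f) (hg : PSpace n X g) : PSpacePred n X (fun a => f a < g a) :=
  le hf.succ hg

theorem eq (hf : PSpace n X f) (hg : PSpace n X g) : PSpacePred n X (fun a => f a = g a) :=
  ((le hf hg).and (le hg hf)).of_iff fun _ => le_antisymm_iff.symm

end PSpacePred

namespace PSpace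

variable {ι : Type} {n : ι → ℕ} {X : Set (ι → ℕ)} {f g : ι → ℕ} {P : ι → Prop}

theorem ite [DecidablePred P] (hP : PSpacePred n X P) (hf : PSpace n X f) (hg : PSpace n X g) :
    PSpace n X (fun a => if P a then f a else g a) :=
  (PSpace.ite_zero hP hg hf).of_eq fun a => by by_cases h : P a <;> simp [truthValue, h]

theorem sum {N : ι → ℕ} {f : ι → ℕ → ℕ} (hN : PSpace n X N)
    (hf : PSpace (fun p : Below N => n p.base) (Below.vars N X) (fun p => f p.base p.idx)) :
    PSpace n X (fun a => ∑ i ∈ Finset.range (N a), f a i) := by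
  obtain ⟨p, hp⟩ := hf.1
  refine rec (h := fun a i => ∑ j ∈ Finset.range i, f a j) hN
    (zero.of_eq fun a => by simp) ⟨_, hN.1.add ⟨p, fun a => le_rfl⟩, fun a i hi => ?_⟩ ?_
  · exact (Nat.size_sum_le _ i _ fun j hj => hp ⟨a, j, hj.trans_le hi⟩).trans
      (Nat.add_le_add_right (Nat.size_le_size hi) _)
  · intro Y hY h
    exact (h.add (hf.mono hY)).of_eq fun p => (Finset.sum_range_succ _ _).symm

theorem prod {N : ι → ℕ} {f : ι → ℕ → ℕ} (hN : PSpace n X N) (hNb : PolyBound n N)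
    (hf : PSpace (fun p : Below N => n p.base) (Below.vars N X) (fun p => f p.base p.idx)) :
    PSpace n X (fun a => ∏ i ∈ Finset.range (N a), f a i) := by
  obtain ⟨p, hp⟩ := hf.1
  refine rec (h := fun a i => ∏ j ∈ Finset.range i, f a j) hN
    ((const 1).of_eq fun a => by simp)
    ⟨_, (hNb.mul ⟨p, fun a => le_rfl⟩).add (.const 1), fun a i hi => ?_⟩ ?_
  · exact (Nat.size_prod_le _ i _ fun j hj => hp ⟨a, j, hj.trans_le hi⟩).trans
      (Nat.add_le_add_right (Nat.mul_le_mul_right _ hi) _)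
  · intro Y hY h
    exact (h.mul (hf.mono hY)).of_eq fun p => (Finset.prod_range_succ _ _).symm

theorem pow (hf : PSpace n X f) (hg : PSpace n X g) (hgb : PolyBound n g) :
    PSpace n X (fun a => f a ^ g a) :=
  (prod (f := fun a _ => f a) hg hgb hf.lift).of_eq fun a => by simp

end PSpace

namespace PSpacePred

variable {ι : Type} {n : ι → ℕ} {X : Set (ι → ℕ)} {N : ι → ℕ} {P : ι → ℕ → Prop}

/-- The witnesses are counted, and the count is compared with zero. The range may be exponentially
long. -/
theorem exists_lt (hN : PSpace n X N)
    (hP : PSpacePred (fun p : Below N => n p.base) (Below.vars N X) (fun p => P p.base p.idx)) :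
    PSpacePred n X (fun a => ∃ i < N a, P a i) :=
  (eq_zero (PSpace.sum (f := fun a i => truthValue (P a i)) hN hP)).not.of_iff
    fun a => by simp [truthValue]

theorem forall_lt (hN : PSpace n X N)
    (hP : PSpacePred (fun p : Below N => n p.base) (Below.vars N X) (fun p => P p.base p.idx)) :
    PSpacePred n X (fun a => ∀ i < N a, P a i) :=
  (exists_lt (P := fun a i => ¬P a i) hN hP.not).not.of_iff fun a => by simp

end PSpacePred

/-! ### Division by exhaustive search -/

namespace PSpace

variable {ι : Type} {n : ι → ℕ} {X : Set (ι → ℕ)} {f g : ι → ℕ} {P : ι → Prop}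

/-- A function is computable if it is bounded by a computable one and its graph is decidable. -/
theorem of_graph {B : ι → ℕ} (hB : PSpace n X B) (hfB : ∀ a, f a < B a)
    (hf : PSpacePred (fun p : Below B => n p.base) (Below.vars B X) (fun p => f p.base = p.idx)) :
    PSpace n X f :=
  -- Only the term with `i = f a` survives in the sum.
  (sum (f := fun a i => truthValue (f a = i) * i) hB
    (PSpace.mul hf hB.lift_idx)).of_eq fun a => by simp [truthValue, hfB]

/-- The quotient is the `i` with `i * g a ≤ f a < (i + 1) * g a`, and it is at most `f a`. Division
by zero gives `0` and is a separate case of the graph. -/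
theorem div (hf : PSpace n X f) (hg : PSpace n X g) : PSpace n X (fun a => f a / g a) := by
  refine of_graph (B := fun a => f a + 1) hf.succ
    (fun a => Nat.lt_succ_of_le (Nat.div_le_self _ _)) ?_
  have hi := hf.succ.lift_idx
  have hf' := hf.lift (N := fun a => f a + 1)
  have hg' := hg.lift (N := fun a => f a + 1)
  refine (((PSpacePred.eq_zero hg').and (.eq_zero hi)).or ((PSpacePred.lt zero hg').and
    ((PSpacePred.le (hi.mul hg') hf').and (.lt hf' (hi.succ.mul hg'))))).of_iff fun p => ?_
  rcases Nat.eq_zero_or_pos (g p.base) with h | h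
  · simp [h, eq_comm]
  · rw [Nat.div_eq_iff h]
    have := Nat.add_one_mul p.idx (g p.base)
    omega

theorem mod (hf : PSpace n X f) (hg : PSpace n X g) : PSpace n X (fun a => f a % g a) :=
  (hf.sub (hg.mul (hf.div hg))).of_eq fun a => by
    have := Nat.div_add_mod (f a) (g a)
    omega

/-- Iterated division. -/
theorem div_pow {k : ι → ℕ} (hf : PSpace n X f) (hg : PSpace n X g) (hk : PSpace n X k) :
    PSpace n X (fun a => f a / g a ^ k a) :=
  -- Dividing `k a` times by `g a` avoids the power `g a ^ k a`, whose size need not be polynomial.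
  rec (h := fun a i => f a / g a ^ i) hk (hf.of_eq fun a => by simp)
    ⟨_, hf.1, fun _ _ _ => Nat.size_le_size (Nat.div_le_self _ _)⟩ fun _ hY h =>
      (h.div (hg.lift.mono hY)).of_eq fun p => by rw [Nat.div_div_eq_div_mul, pow_succ]

end PSpace

/-! ### Words as numbers -/

namespace Letter

/-- The three bits of a letter. -/
def toBits : Letter → Bool × Bool × Bool
  | bit b => (b, false, false)
  | minus => (false, true, false)
  | slash => (true, true, false)
  | infinity => (false, false, true)
  | comma => (true, false, true)
  | bar => (false, true, true)
  | semicolon => (true, true, true)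

def ofBits : Bool → Bool → Bool → Letter
  | b, false, false => bit b
  | false, true, false => minus
  | true, true, false => slash
  | false, false, true => infinity
  | true, false, true => comma
  | false, true, true => bar
  | true, true, true => semicolon

theorem ofBits_toBits (x : Letter) : ofBits x.toBits.1 x.toBits.2.1 x.toBits.2.2 = x := by
  rcases x with _ | _ | _ | _ | _ | _ | _ <;> rfl

/-- The number below `8` of a letter. -/
def code (x : Letter) : ℕ := x.toBits.1.toNat + 2 * x.toBits.2.1.toNat + 4 * x.toBits.2.2.toNat

theorem code_lt (x : Letter) : x.code < 8 := by
  rcases x with (_ | _) | _ | _ | _ | _ | _ | _ <;> decide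

theorem code_injective : Function.Injective code := by
  intro x y h
  rcases x with (_ | _) | _ | _ | _ | _ | _ | _ <;>
    rcases y with (_ | _) | _ | _ | _ | _ | _ | _ <;> first | rfl | (exact absurd h (by decide))

end Letter

/-- The number of a word, in base `8` with a leading digit `1`. -/
def wordCode : List Letter → ℕ
  | [] => 1
  | x :: w => 8 * wordCode w + x.code

theorem wordCode_pos (w : List Letter) : 0 < wordCode w := by
  induction w with
  | nil => exact one_pos
  | cons x w ih => rw [wordCode]; omega

theorem natWord_two_mul_add (b : Bool) (c : ℕ) (hc : 0 < c) :
    natWord (2 * c + b.toNat) = bit b :: natWord c := by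
  have : 2 * c + b.toNat = Nat.bit b c := by simp [Nat.bit_val]
  rw [natWord, this, Nat.bits_append_bit c b (fun h => absurd h hc.ne')]
  rfl

/-- Putting a letter in front of a word means pushing three bits on the binary stack. The leading
digit `1` protects the zero bits of the last letters, which would otherwise be leading zeros. -/
theorem natWord_wordCode_cons (x : Letter) (w : List Letter) :
    natWord (wordCode (x :: w)) = bit x.toBits.1 :: bit x.toBits.2.1 :: bit x.toBits.2.2 ::
      natWord (wordCode w) := by
  have h := wordCode_pos w
  have e : wordCode (x :: w) = 2 * (2 * (2 * wordCode w + x.toBits.2.2.toNat) +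
      x.toBits.2.1.toNat) + x.toBits.1.toNat := by
    rw [wordCode, Letter.code]; ring
  rw [e, natWord_two_mul_add _ _ (by omega), natWord_two_mul_add _ _ (by omega),
    natWord_two_mul_add _ _ h]

theorem natWord_one : natWord 1 = [bit true] := by simp [natWord]

theorem natWord_wordCode_length (w : List Letter) :
    (natWord (wordCode w)).length = 3 * w.length + 1 := by
  induction w with
  | nil => simp [wordCode, natWord_one]
  | cons x w ih => rw [natWord_wordCode_cons]; simp [ih]; ring

/-! ### From the input word to its number, and from the resulting number to the output word -/

namespace StackProg

/-- Stacks, only the first five of which may be nonempty. -/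
def fiveStacks (l₀ l₁ l₂ l₃ l₄ : List Letter) : ℕ → List Letter
  | 0 => l₀
  | 1 => l₁
  | 2 => l₂
  | 3 => l₃
  | 4 => l₄
  | _ => []

section

variable (l₀ l₁ l₂ l₃ l₄ l : List Letter)

@[simp] theorem fiveStacks_zero : fiveStacks l₀ l₁ l₂ l₃ l₄ 0 = l₀ := rfl
@[simp] theorem fiveStacks_one : fiveStacks l₀ l₁ l₂ l₃ l₄ 1 = l₁ := rfl
@[simp] theorem fiveStacks_two : fiveStacks l₀ l₁ l₂ l₃ l₄ 2 = l₂ := rfl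
@[simp] theorem fiveStacks_three : fiveStacks l₀ l₁ l₂ l₃ l₄ 3 = l₃ := rfl
@[simp] theorem fiveStacks_four : fiveStacks l₀ l₁ l₂ l₃ l₄ 4 = l₄ := rfl

@[simp] theorem update_fiveStacks_zero :
    Function.update (fiveStacks l₀ l₁ l₂ l₃ l₄) 0 l = fiveStacks l l₁ l₂ l₃ l₄ := by
  funext j; match j with
  | 0 | 1 | 2 | 3 | 4 | j + 5 => simp [fiveStacks]

@[simp] theorem update_fiveStacks_one :
    Function.update (fiveStacks l₀ l₁ l₂ l₃ l₄) 1 l = fiveStacks l₀ l l₂ l₃ l₄ := by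
  funext j; match j with
  | 0 | 1 | 2 | 3 | 4 | j + 5 => simp [fiveStacks]

@[simp] theorem update_fiveStacks_two :
    Function.update (fiveStacks l₀ l₁ l₂ l₃ l₄) 2 l = fiveStacks l₀ l₁ l l₃ l₄ := by
  funext j; match j with
  | 0 | 1 | 2 | 3 | 4 | j + 5 => simp [fiveStacks]

@[simp] theorem update_fiveStacks_three :
    Function.update (fiveStacks l₀ l₁ l₂ l₃ l₄) 3 l = fiveStacks l₀ l₁ l₂ l l₄ := by
  funext j; match j with
  | 0 | 1 | 2 | 3 | 4 | j + 5 => simp [fiveStacks]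

@[simp] theorem update_fiveStacks_four :
    Function.update (fiveStacks l₀ l₁ l₂ l₃ l₄) 4 l = fiveStacks l₀ l₁ l₂ l₃ l := by
  funext j; match j with
  | 0 | 1 | 2 | 3 | 4 | j + 5 => simp [fiveStacks]

end

theorem counters_eq_fiveStacks (c c' : ℕ) :
    counters (Function.update (Function.update (fun _ => 0) 0 c) 1 c') =
      fiveStacks [] [] [] (natWord c) (natWord c') := by
  funext j; match j with
  | 0 | 1 | 2 | 3 | 4 | j + 5 => simp [counters, fiveStacks, natWord]

/-- Popping a letter from the stack `R` and continuing according to the letter. -/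
def caseP (R : ℕ) (k : Letter → StackProg) : StackProg :=
  [minus, slash, infinity, comma, bar, semicolon, bit true].foldr
    (fun x P => ite R (fun y => decide (y = some x)) (seq (pop R) (k x)) P)
    (seq (pop R) (k (bit false)))

theorem Run.case {M R : ℕ} {k : Letter → StackProg} {s s' : ℕ → List Letter} {x : Letter}
    {l : List Letter} (hR : s R = x :: l) (h : Run M (k x) (Function.update s R l) s') :
    Run M (caseP R k) s s' := by
  have h' : Run M (StackProg.seq (StackProg.pop R) (k x)) s s' := .seq (.pop (by rw [hR]; rfl)) h
  rcases x with (_ | _) | _ | _ | _ | _ | _ | _ <;>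
    repeat first
      | exact h'
      | exact .iteT (by simp [hR]) h'
      | refine .iteF (by simp [hR]) ?_

/-- Moving the stack `A` to the stack `B`. -/
def reverseP (A B : ℕ) : StackProg := loop A (fun x => x.isSome) (caseP A (push B))

theorem Run.reverse_input {M : ℕ} (l t : List Letter) (h : l.length + t.length ≤ M) :
    Run M (reverseP 0 2) (fiveStacks l [] t [] []) (fiveStacks [] [] (l.reverse ++ t) [] []) := by
  induction l generalizing t with
  | nil => exact .loopF rfl
  | cons x l ih =>
    simp only [List.length_cons] at h
    refine .loopT (s' := fiveStacks l [] (x :: t) [] []) rfl (.case rfl (.push ?_ ?_)) ?_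
    · simp; omega
    · simp
    · simp only [List.reverse_cons, List.append_assoc, List.singleton_append]
      exact ih (x :: t) (by simp; omega)

theorem Run.reverse_output {M : ℕ} (l t : List Letter) (h : l.length + t.length ≤ M) :
    Run M (reverseP 2 1) (fiveStacks [] t l [] []) (fiveStacks [] (l.reverse ++ t) [] [] []) := by
  induction l generalizing t with
  | nil => exact .loopF rfl
  | cons x l ih =>
    simp only [List.length_cons] at h
    refine .loopT (s' := fiveStacks [] (x :: t) l [] []) rfl (.case rfl (.push ?_ ?_)) ?_
    · simp; omega
    · simp
    · simp only [List.reverse_cons, List.append_assoc, List.singleton_append]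
      exact ih (x :: t) (by simp; omega)

/-- Turning the word on the stack `2`, last letter on top, into its number on the stack `3`. -/
def encodeP : StackProg :=
  loop 2 (fun x => x.isSome) (caseP 2 fun x =>
    seq (push 3 (bit x.toBits.2.2)) (seq (push 3 (bit x.toBits.2.1)) (push 3 (bit x.toBits.1))))

theorem Run.encode {M : ℕ} (l w : List Letter) (h : 3 * (l.length + w.length) + 1 ≤ M) :
    Run M encodeP (fiveStacks [] [] l (natWord (wordCode w)) [])
      (fiveStacks [] [] [] (natWord (wordCode (l.reverse ++ w))) []) := by
  induction l generalizing w with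
  | nil => exact .loopF rfl
  | cons x l ih =>
    simp only [List.length_cons] at h
    refine .loopT (s' := fiveStacks [] [] l (natWord (wordCode (x :: w))) []) rfl
      (.case rfl (.seq (.push ?_ rfl) (.seq (.push ?_ rfl) (.push ?_ ?_)))) ?_
    · simp [natWord_wordCode_length]; omega
    · simp [natWord_wordCode_length]; omega
    · simp [natWord_wordCode_length]; omega
    · simp [natWord_wordCode_cons]
    · simp only [List.reverse_cons, List.append_assoc, List.singleton_append]
      exact ih (x :: w) (by simp; omega)

/-- Popping a bit from the stack `4` and continuing according to the bit. -/
def bitP (k : Bool → StackProg) : StackProg :=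
  ite 4 (fun y => decide (y = some (bit true))) (seq (pop 4) (k true)) (seq (pop 4) (k false))

theorem Run.bit {M : ℕ} {k : Bool → StackProg} {s s' : ℕ → List Letter} {b : Bool}
    {l : List Letter} (hR : s 4 = Letter.bit b :: l)
    (h : Run M (k b) (Function.update s 4 l) s') : Run M (bitP k) s s' := by
  have h' : Run M (StackProg.seq (StackProg.pop 4) (k b)) s s' := .seq (.pop (by rw [hR]; rfl)) h
  cases b with
  | true => exact .iteT (by simp [hR]) h'
  | false => exact .iteF (by simp [hR]) h'

/-- Turning the number of a word on the stack `4` into the word on the stack `2`, last letter on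
top. -/
def decodeP : StackProg :=
  loop 4 (fun x => x.isSome) (bitP fun b₀ => ite 4 (fun x => x.isSome)
    (bitP fun b₁ => bitP fun b₂ => push 2 (ofBits b₀ b₁ b₂)) nop)

/-- The bit that leaves the stack empty is the leading digit `1`; it marks the end of the word and
yields no letter. -/
theorem Run.decode {M : ℕ} (w l : List Letter) (h : w.length + l.length ≤ M) :
    Run M decodeP (fiveStacks [] [] l [] (natWord (wordCode w)))
      (fiveStacks [] [] (w.reverse ++ l) [] []) := by
  induction w generalizing l with
  | nil =>
    refine .loopT (s' := fiveStacks [] [] l [] []) ?_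
      (.bit (b := true) (l := []) (by simp [wordCode, natWord_one]) (.iteF (by simp) ?_)) (.loopF rfl)
    · simp [wordCode, natWord_one]
    · simpa using .nop
  | cons x w ih =>
    simp only [List.length_cons] at h
    refine .loopT (s' := fiveStacks [] [] (x :: l) [] (natWord (wordCode w))) ?_
      (.bit (b := x.toBits.1) (by rw [fiveStacks_four, natWord_wordCode_cons]) (.iteT ?_
        (.bit (b := x.toBits.2.1) (by rw [update_fiveStacks_four, fiveStacks_four])
        (.bit (b := x.toBits.2.2) (by rw [update_fiveStacks_four, update_fiveStacks_four, fiveStacks_four])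
          (.push ?_ ?_))))) ?_
    · simp [natWord_wordCode_cons]
    · simp
    · simp; omega
    · simp [ofBits_toBits]
    · simp only [List.reverse_cons, List.append_assoc, List.singleton_append]
      exact ih (x :: l) (by simp; omega)

end StackProg

-- The input is reversed onto the scratch stack and encoded in counter `0`, that is, on stack `3`.
-- The program delivers the number of the output in counter `1`, on stack `4`. Counter `0` is
-- cleared, since at the end all stacks except the output must be empty. The term `3 * X + 1` of the
-- bound is the length of the encoded input.
open StackProg in
theorem PSpace.inFPSpace {α β : Type} {ea : α → List Letter} {eb : β → List Letter} {f : α → β}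
    (h : PSpace (fun a => (ea a).length) {fun a => wordCode (ea a)}
      (fun a => wordCode (eb (f a)))) : InFPSpace ea eb f := by
  obtain ⟨⟨q, hq⟩, h⟩ := h
  obtain ⟨P, p, hP⟩ := h (fun _ => 0) 1 (fun _ _ => one_pos)
  refine StackProg.inFPSpace (seq (reverseP 0 2) (seq (push 3 (Letter.bit true)) (seq encodeP (seq P
    (seq (zeroP 0) (seq decodeP (reverseP 2 1))))))) (p + q + 3 * Polynomial.X + 1) fun a => ?_
  set M := (p + q + 3 * Polynomial.X + 1).eval (ea a).length with hM
  simp only [Polynomial.eval_add, Polynomial.eval_mul, Polynomial.eval_X, Polynomial.eval_one,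
    Polynomial.eval_ofNat] at hM
  have hlen : (eb (f a)).length ≤ M := by
    have h1 := natWord_wordCode_length (eb (f a))
    rw [natWord_length] at h1
    have := hq a
    dsimp only at this
    omega
  have h1 : Function.update (fun _ => []) 0 (ea a) = fiveStacks (ea a) [] [] [] [] := by
    funext j; match j with
    | 0 | 1 | 2 | 3 | 4 | j + 5 => simp [fiveStacks]
  have h2 : Function.update (fun _ => []) 1 (eb (f a)) = fiveStacks [] (eb (f a)) [] [] [] := by
    funext j; match j with
    | 0 | 1 | 2 | 3 | 4 | j + 5 => simp [fiveStacks]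
  rw [h1, h2]
  set s : ℕ → ℕ := Function.update (Function.update (fun _ => 0) 0 (wordCode (ea a))) 1 0 with hs
  have hsM : ∀ j, (s j).size ≤ M := by
    intro j
    simp only [hs, Function.update_apply]
    split_ifs
    · simp
    · rw [← natWord_length, natWord_wordCode_length]; omega
    · simp
  have hr := hP a s M (by dsimp only; omega) hsM (by
    rintro x rfl
    simp [hs]) (by
    intro j hj
    simp only [hs, Function.update_apply]
    split_ifs <;> first | rfl | omega)
  have hz := CRun.zero (M := M) 0 (hr.size_le hsM 0)
  refine .seq (.reverse_input _ [] (by simp; omega)) (.seq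
    (s' := fiveStacks [] [] (ea a).reverse [Letter.bit true] [])
    (.push ?_ (by simp)) (.seq (s' := counters s) ?_
    (.seq hr (.seq (s' := fiveStacks [] [] [] [] (natWord (wordCode (eb (f a))))) ?_
      (.seq (.decode _ [] (by simpa using hlen)) ?_)))))
  · simp; omega
  · have := Run.encode (M := M) (ea a).reverse [] (by simp; omega)
    rw [counters_eq_fiveStacks]
    simpa [wordCode, natWord_one, natWord] using this
  · have e : Function.update (Function.update s 1 (wordCode (eb (f a)))) 0 0 =
        Function.update (Function.update (fun _ => 0) 0 0) 1 (wordCode (eb (f a))) := by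
      funext j
      simp only [hs, Function.update_apply]
      split_ifs <;> first | rfl | omega
    unfold CRun at hz
    rw [e, counters_eq_fiveStacks] at hz
    simpa [natWord] using hz
  · simpa using Run.reverse_output (M := M) (eb (f a)).reverse [] (by simpa using hlen)

/-! ### Operations on words -/

/-- The code of the letter at a position, `8` beyond the end. -/
def codeAt (w : List Letter) (i : ℕ) : ℕ := (w[i]?).elim 8 Letter.code

theorem wordCode_div_pow (w : List Letter) (k : ℕ) :
    wordCode w / 8 ^ k = if k ≤ w.length then wordCode (w.drop k) else 0 := by
  induction w generalizing k with
  | nil =>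
    cases k with
    | zero => simp
    | succ k => simp [wordCode]
  | cons x w ih =>
    cases k with
    | zero => simp
    | succ k =>
      have := x.code_lt
      rw [pow_succ', ← Nat.div_div_eq_div_mul, wordCode,
        show (8 * wordCode w + x.code) / 8 = wordCode w by omega, ih]
      simp

/-- As long as a letter remains, the quotient has a nonzero digit above its lowest one, hence is at
least `8`; at the end of the word it is `1`, and beyond it `0`. -/
theorem codeAt_eq (w : List Letter) (i : ℕ) :
    codeAt w i = if wordCode w / 8 ^ i ≤ 1 then 8 else wordCode w / 8 ^ i % 8 := by
  rw [wordCode_div_pow, codeAt]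
  by_cases hi : i < w.length
  · have h := wordCode_pos (w.drop (i + 1))
    have := (w[i]).code_lt
    rw [if_pos hi.le, List.drop_eq_getElem_cons hi, wordCode, if_neg (by omega),
      List.getElem?_eq_getElem hi]
    simp only [Option.elim_some]
    omega
  · rw [List.getElem?_eq_none (by omega)]
    have : w.drop i = [] := List.drop_eq_nil_of_le (by omega)
    rw [this, wordCode]
    split_ifs <;> simp at *

theorem codeAt_eq_code (w : List Letter) (i : ℕ) (x : Letter) :
    codeAt w i = x.code ↔ w[i]? = some x := by
  rw [codeAt]
  cases w[i]? with
  | none => simpa using x.code_lt.ne'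
  | some y => simpa using Letter.code_injective.eq_iff

/-- The remainder consists of the first `k` digits; the leading `1` has to be supplied anew. -/
theorem wordCode_mod_pow (w : List Letter) (k : ℕ) (hk : k ≤ w.length) :
    wordCode w % 8 ^ k + 8 ^ k = wordCode (w.take k) := by
  induction w generalizing k with
  | nil =>
    have : k = 0 := by simpa using hk
    simp [this, wordCode]
  | cons x w ih =>
    cases k with
    | zero => simp [wordCode, Nat.mod_one]
    | succ k =>
      have := x.code_lt
      have := ih k (by simpa using hk)
      rw [pow_succ', Nat.mod_mul, wordCode, List.take_succ_cons, wordCode,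
        show (8 * wordCode w + x.code) / 8 = wordCode w by omega]
      omega

/-- The leading digit of `u` is replaced by the digits of `v`; the subtraction stands on the other
side. -/
theorem wordCode_append (u v : List Letter) :
    wordCode (u ++ v) + 8 ^ u.length = wordCode u + 8 ^ u.length * wordCode v := by
  induction u with
  | nil => simp [wordCode]; ring
  | cons x u ih =>
    simp only [List.cons_append, wordCode, List.length_cons, pow_succ']
    have : 8 * 8 ^ u.length * wordCode v = 8 * (8 ^ u.length * wordCode v) := by ring
    omega

theorem wordCode_size (w : List Letter) : (wordCode w).size = 3 * w.length + 1 := by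
  rw [← StackProg.natWord_length, natWord_wordCode_length]

theorem natWord_of_pos (m : ℕ) (hm : 0 < m) :
    natWord m = bit (decide (m % 2 = 1)) :: natWord (m / 2) := by
  rw [natWord, natWord, ← List.map_cons]
  congr 1
  have h : m = Nat.bit (decide (m % 2 = 1)) (m / 2) := by
    rw [Nat.bit_val]
    rcases Nat.mod_two_eq_zero_or_one m with h | h <;> simp [h] <;> omega
  conv_lhs => rw [h]
  refine Nat.bits_append_bit _ _ fun h0 => ?_
  have : m = 1 := by omega
  simp [this]

/-- The number written in binary by the bits of a word. -/
noncomputable def natVal : List Letter → ℕ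
  | [] => 0
  | x :: w => truthValue (x = bit true) + 2 * natVal w

theorem natVal_natWord (k : ℕ) : natVal (natWord k) = k := by
  induction k using Nat.strongRec with
  | ind k ih =>
    rcases Nat.eq_zero_or_pos k with rfl | hk
    · simp [natWord, natVal]
    · rw [natWord_of_pos k hk, natVal, ih _ (by omega)]
      rcases Nat.mod_two_eq_zero_or_one k with h | h <;> simp [h, truthValue] <;> omega

theorem natVal_eq_sum (w : List Letter) :
    natVal w = ∑ i ∈ Finset.range w.length, truthValue (codeAt w i = (bit true).code) * 2 ^ i := by
  induction w with
  | nil => simp [natVal]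
  | cons x w ih =>
    rw [natVal, ih, List.length_cons, Finset.sum_range_succ', Finset.mul_sum, add_comm]
    congr 1
    · refine Finset.sum_congr rfl fun i _ => ?_
      simp only [codeAt, List.getElem?_cons_succ, pow_succ]
      ring
    · simp [codeAt_eq_code]

theorem count_eq_sum (x : Letter) (w : List Letter) :
    w.count x = ∑ i ∈ Finset.range w.length, truthValue (codeAt w i = x.code) := by
  induction w with
  | nil => simp
  | cons y w ih =>
    rw [List.count_cons, ih, List.length_cons, Finset.sum_range_succ']
    congr 1
    simp [codeAt_eq_code, truthValue]

/-- A description of the graph with a bounded quantifier, fit for `PSpace.of_graph`. It includes the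
default `w.length` for a missing letter. -/
theorem idxOf_eq_iff (x : Letter) (w : List Letter) (y : ℕ) :
    w.idxOf x = y ↔ (codeAt w y = x.code ∨ y = w.length) ∧ ∀ i < y, ¬codeAt w i = x.code := by
  simp only [codeAt_eq_code]
  induction w generalizing y with
  | nil =>
    simp only [List.idxOf_nil, List.length_nil]
    constructor
    · rintro rfl; simp
    · rintro ⟨h, _⟩; simpa [eq_comm] using h
  | cons z w ih =>
    rw [List.idxOf_cons]
    by_cases hz : z = x
    · subst hz
      simp only [BEq.rfl, cond_true]
      constructor
      · rintro rfl; simp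
      · rintro ⟨_, h⟩
        by_contra h0
        exact h 0 (by omega) (by simp)
    · simp only [beq_eq_false_iff_ne.2 hz, cond_false]
      cases y with
      | zero => simp [hz]
      | succ y =>
        rw [Nat.add_right_cancel_iff, ih]
        simp only [List.getElem?_cons_succ, List.length_cons, Nat.add_right_cancel_iff]
        refine and_congr_right fun _ => ⟨fun h i hi => ?_, fun h i hi => ?_⟩
        · cases i with
          | zero => simpa using hz
          | succ i => simpa using h i (by omega)
        · simpa using h (i + 1) (by omega)

/-- What follows the first occurrence of `x`. -/
def afterSep (x : Letter) (w : List Letter) : List Letter := w.drop (w.idxOf x + 1)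

/-- The `j`-th of the pieces into which `w` is cut by the occurrences of `x`. -/
def piece (x : Letter) (w : List Letter) (j : ℕ) : List Letter :=
  ((afterSep x)^[j] w).take (((afterSep x)^[j] w).idxOf x)

theorem afterSep_append (x : Letter) (u t : List Letter) (hu : x ∉ u) :
    afterSep x (u ++ x :: t) = t := by
  rw [afterSep, List.idxOf_append_of_notMem hu]
  simp

theorem piece_append_zero (x : Letter) (u t : List Letter) (hu : x ∉ u) :
    piece x (u ++ x :: t) 0 = u := by
  simp [piece, List.idxOf_append_of_notMem hu]

theorem piece_zero_of_notMem (x : Letter) (u : List Letter) (hu : x ∉ u) : piece x u 0 = u := by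
  simp [piece, List.idxOf_of_notMem hu]

theorem piece_append_succ (x : Letter) (u t : List Letter) (hu : x ∉ u) (j : ℕ) :
    piece x (u ++ x :: t) (j + 1) = piece x t j := by
  simp [piece, afterSep_append x u t hu]

/-- The concatenation of pieces, each followed by `x`. -/
def joinSep (x : Letter) (ps : List (List Letter)) : List Letter := ps.flatMap (· ++ [x])

theorem joinSep_cons (x : Letter) (u : List Letter) (ps : List (List Letter)) :
    joinSep x (u :: ps) = u ++ x :: joinSep x ps := by simp [joinSep]

theorem joinSep_append (x : Letter) (ps qs : List (List Letter)) :
    joinSep x (ps ++ qs) = joinSep x ps ++ joinSep x qs := by simp [joinSep]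

/-- Cutting at `x` undoes joining because no piece contains `x`; beyond the last piece the result is
the empty word. -/
theorem piece_joinSep (x : Letter) (ps : List (List Letter)) (hps : ∀ u ∈ ps, x ∉ u) (j : ℕ) :
    piece x (joinSep x ps) j = (ps[j]?).getD [] := by
  induction ps generalizing j with
  | nil =>
    have h : ∀ j, (afterSep x)^[j] [] = [] := fun j => Function.iterate_fixed rfl j
    simp [piece, joinSep, h]
  | cons u ps ih =>
    rw [joinSep_cons]
    cases j with
    | zero => simp [piece_append_zero x u _ (hps u (by simp))]
    | succ j =>
      rw [piece_append_succ x u _ (hps u (by simp)), ih fun v hv => hps v (by simp [hv])]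
      simp

theorem count_joinSep (x : Letter) (ps : List (List Letter)) (hps : ∀ u ∈ ps, x ∉ u) :
    (joinSep x ps).count x = ps.length := by
  induction ps with
  | nil => simp [joinSep]
  | cons u ps ih =>
    rw [joinSep_cons, List.count_append, List.count_cons_self,
      ih fun v hv => hps v (by simp [hv]), List.count_eq_zero.2 (hps u (by simp))]
    simp

/-! ### Polynomial-space computations on words -/

/-- `w` is a word computable in polynomial space. -/
def PSpaceWord {ι : Type} (n : ι → ℕ) (X : Set (ι → ℕ)) (w : ι → List Letter) : Prop :=
  PSpace n X (fun a => wordCode (w a))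

namespace PSpaceWord

variable {ι : Type} {n : ι → ℕ} {X : Set (ι → ℕ)} {w u : ι → List Letter} {k : ι → ℕ}

theorem lift {N : ι → ℕ} (h : PSpaceWord n X w) :
    PSpaceWord (fun p : Below N => n p.base) (Below.vars N X) (fun p => w p.base) :=
  PSpace.lift h

theorem of_eq (h : PSpaceWord n X w) (e : ∀ a, w a = u a) : PSpaceWord n X u := funext e ▸ h

theorem const (v : List Letter) : PSpaceWord n X (fun _ => v) := PSpace.const _

theorem codeAt (hw : PSpaceWord n X w) (hk : PSpace n X k) :
    PSpace n X (fun a => codeAt (w a) (k a)) := by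
  have h := PSpace.div_pow hw (.const 8) hk
  exact (PSpace.ite (.le h (.const 1)) (.const 8) (h.mod (.const 8))).of_eq fun a => by
    rw [codeAt_eq]

theorem letter (hw : PSpaceWord n X w) (hk : PSpace n X k) (x : Letter) :
    PSpacePred n X (fun a => (w a)[k a]? = some x) :=
  (PSpacePred.eq (hw.codeAt hk) (.const x.code)).of_iff fun _ => codeAt_eq_code _ _ _

theorem length_polyBound (hw : PSpaceWord n X w) : PolyBound n (fun a => (w a).length) :=
  hw.1.of_le fun a => by rw [wordCode_size]; omega

/-- The length is the exponent `k` for which dividing the number of the word by `8 ^ k` leaves only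
the leading digit `1`. -/
theorem length (hw : PSpaceWord n X w) : PSpace n X (fun a => (w a).length) := by
  refine PSpace.of_graph hw (fun a => ?_) ?_
  · have := Nat.size_le_self (wordCode (w a))
    rw [wordCode_size] at this
    omega
  · have hi := PSpace.lift_idx hw
    refine (PSpacePred.eq (PSpace.div_pow hw.lift (.const 8) hi) (.const 1)).of_iff fun p => ?_
    rw [wordCode_div_pow]
    constructor
    · intro h
      split_ifs at h with h'
      cases hd : (w p.base).drop p.idx with
      | nil => exact le_antisymm (by simpa using hd) h'
      | cons x v =>
        rw [hd, wordCode] at h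
        have := wordCode_pos v
        omega
    · intro h
      simp [← h, wordCode]

theorem drop (hw : PSpaceWord n X w) (hk : PSpace n X k) :
    PSpaceWord n X (fun a => (w a).drop (k a)) := by
  have h := PSpace.div_pow hw (.const 8) hk
  refine (h.ite_zero (.const 1) h).of_eq fun a => ?_
  rw [wordCode_div_pow]
  have := wordCode_pos ((w a).drop (k a))
  split_ifs with h1 h2 h3
  · omega
  · rfl
  · dsimp only
    rw [List.drop_eq_nil_of_le (by omega), wordCode]
  · omega

theorem take (hw : PSpaceWord n X w) (hk : PSpace n X k) :
    PSpaceWord n X (fun a => (w a).take (k a)) := by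
  -- The power `8 ^ k a` could be too large, so `k a` is first cut down to the length of the word.
  have hm : PSpace n X (fun a => min (k a) (w a).length) :=
    (PSpace.ite (.le hk hw.length) hk hw.length).of_eq fun a => by rw [min_def]
  have hp := PSpace.pow (.const 8) hm (hw.length_polyBound.of_le fun a => min_le_right _ _)
  refine ((PSpace.mod hw hp).add hp).of_eq fun a => ?_
  rw [wordCode_mod_pow _ _ (min_le_right _ _), ← List.take_eq_take_min]

theorem append (hw : PSpaceWord n X w) (hu : PSpaceWord n X u) :
    PSpaceWord n X (fun a => w a ++ u a) := by
  have hp := PSpace.pow (.const 8) hw.length hw.length_polyBound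
  refine ((PSpace.add hw (hp.mul hu)).sub hp).of_eq fun a => ?_
  rw [← wordCode_append, Nat.add_sub_cancel]

theorem idxOf (hw : PSpaceWord n X w) (x : Letter) : PSpace n X (fun a => (w a).idxOf x) := by
  refine PSpace.of_graph hw.length.succ (fun a => Nat.lt_succ_of_le List.idxOf_le_length) ?_
  have hi := hw.length.succ.lift_idx
  refine PSpacePred.of_iff ?_ fun p => (idxOf_eq_iff x (w p.base) p.idx).symm
  refine ((PSpacePred.eq (hw.lift.codeAt hi) (.const _)).or (.eq hi hw.length.lift)).and ?_
  exact .forall_lt (P := fun (p : Below fun a => (w a).length + 1) i =>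
    ¬_root_.codeAt (w p.base) i = x.code) hi
    (PSpacePred.eq (hw.lift.lift.codeAt hi.lift_idx) (.const _)).not

theorem count (hw : PSpaceWord n X w) (x : Letter) : PSpace n X (fun a => (w a).count x) :=
  (PSpace.sum (f := fun a i => truthValue (_root_.codeAt (w a) i = x.code)) hw.length
    (PSpacePred.eq (hw.lift.codeAt hw.length.lift_idx) (.const _))).of_eq fun a =>
      (count_eq_sum x (w a)).symm

theorem natVal (hw : PSpaceWord n X w) : PSpace n X (fun a => natVal (w a)) := by
  have hi := hw.length.lift_idx
  refine (PSpace.sum (f := fun a i => truthValue (_root_.codeAt (w a) i = (bit true).code) * 2 ^ i)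
    hw.length (PSpace.mul (PSpacePred.eq (hw.lift.codeAt hi) (.const _))
      (.pow (.const 2) hi ?_))).of_eq fun a => (natVal_eq_sum (w a)).symm
  exact (hw.length_polyBound.comp Below.base).of_le fun p => p.lt.le

theorem piece (hw : PSpaceWord n X w) (x : Letter) (hk : PSpace n X k) :
    PSpaceWord n X (fun a => piece x (w a) (k a)) := by
  have h : PSpaceWord n X (fun a => (afterSep x)^[k a] (w a)) := by
    refine PSpace.rec (h := fun a i => wordCode ((afterSep x)^[i] (w a))) hk hw
      ⟨_, hw.1, fun a i _ => ?_⟩ fun Y _ (h : PSpaceWord _ _ _) => ?_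
    -- The iterates are suffixes of the original word, hence no longer than it.
    · simp only [wordCode_size]
      have : ((afterSep x)^[i] (w a)).length ≤ (w a).length := by
        induction i with
        | zero => exact le_rfl
        | succ i ih =>
          rw [Function.iterate_succ_apply', afterSep, List.length_drop]
          omega
      omega
    · refine (h.drop (h.idxOf x).succ).of_eq fun p => ?_
      rw [Function.iterate_succ_apply', afterSep]
  exact h.take (h.idxOf x)

/-- The word is built from the most significant bit down: after `i` rounds it spells `k a / 2 ^ (k a
- i)`. There are `k a` rounds, more than needed; as long as the quotient is zero the word stays
empty. -/
theorem natWord (hk : PSpace n X k) : PSpaceWord n X (fun a => natWord (k a)) := by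
  refine (PSpace.rec (h := fun a i => wordCode (Letter.natWord (k a / 2 ^ (k a - i)))) hk
    ((PSpace.const 1).of_eq fun a => ?_)
    ⟨_, (hk.1.add (hk.1.add hk.1)).add (.const 1), fun a i _ => ?_⟩ fun Y hY h => ?_).of_eq
      fun a => by simp
  · rw [Nat.sub_zero, Nat.div_eq_of_lt (k a).lt_two_pow_self]
    simp [Letter.natWord, wordCode]
  · rw [wordCode_size, StackProg.natWord_length]
    have := Nat.size_le_size (Nat.div_le_self (k a) (2 ^ (k a - i)))
    omega
  · have hi := hk.lift_idx.mono hY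
    have hk' := (hk.lift (N := k)).mono hY
    have hm := hk'.div_pow (.const 2) (hk'.sub hi.succ)
    refine (hm.ite_zero (.const 1) (((PSpace.const 8).mul h).add (hm.mod (.const 2)))).of_eq
      fun p => ?_
    have e : k p.base / 2 ^ (k p.base - p.idx) = k p.base / 2 ^ (k p.base - (p.idx + 1)) / 2 := by
      have := p.lt
      rw [Nat.div_div_eq_div_mul, ← pow_succ]
      congr 2
      omega
    rw [e]
    generalize k p.base / 2 ^ (k p.base - (p.idx + 1)) = m
    split_ifs with h0
    · simp [h0, Letter.natWord, wordCode]
    · rw [natWord_of_pos m (by omega), wordCode]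
      rcases Nat.mod_two_eq_zero_or_one m with h | h <;> simp [h, Letter.code, toBits]

end PSpaceWord

/-! ### Reading the word of an instance -/

/-- Numbers in binary, each followed by a comma. -/
def numsWord (ks : List ℕ) : List Letter := joinSep comma (ks.map natWord)

/-- The `j`-th of the numbers in a list. -/
noncomputable def numAt (w : List Letter) (j : ℕ) : ℕ := natVal (piece comma w j)

theorem mem_natWord {x : Letter} {k : ℕ} (h : x ∈ natWord k) : ∃ b, x = bit b := by
  obtain ⟨b, _, hb⟩ := List.mem_map.1 h
  exact ⟨b, hb.symm⟩

theorem mem_numsWord {x : Letter} {ks : List ℕ} (h : x ∈ numsWord ks) :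
    (∃ b, x = bit b) ∨ x = comma := by
  obtain ⟨u, hu, hx⟩ := List.mem_flatMap.1 h
  obtain ⟨k, _, rfl⟩ := List.mem_map.1 hu
  rcases List.mem_append.1 hx with hx | hx
  · exact .inl (mem_natWord hx)
  · exact .inr (by simpa using hx)

theorem comma_notMem_natWord {u : List Letter} {ks : List ℕ} (hu : u ∈ ks.map natWord) :
    comma ∉ u := by
  obtain ⟨k, _, rfl⟩ := List.mem_map.1 hu
  intro h
  obtain ⟨b, hb⟩ := mem_natWord h
  cases hb

theorem numAt_numsWord (ks : List ℕ) (j : ℕ) : numAt (numsWord ks) j = (ks[j]?).getD 0 := by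
  rw [numAt, numsWord, piece_joinSep _ _ fun u hu => comma_notMem_natWord hu, List.getElem?_map]
  cases ks[j]? with
  | none => simp [natVal]
  | some k => simp [natVal_natWord]

theorem count_numsWord (ks : List ℕ) : (numsWord ks).count comma = ks.length := by
  rw [numsWord, count_joinSep _ _ fun u hu => comma_notMem_natWord hu, List.length_map]

theorem numsWord_append (ks ls : List ℕ) : numsWord (ks ++ ls) = numsWord ks ++ numsWord ls := by
  rw [numsWord, List.map_append, joinSep_append]; rfl

theorem numsWord_flatMap {α : Type} (l : List α) (f : α → List ℕ) :
    numsWord (l.flatMap f) = l.flatMap fun x => numsWord (f x) := by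
  induction l with
  | nil => rfl
  | cons x l ih => simp [numsWord_append, ih]

theorem field_eq (k : ℕ) : field k = numsWord [k] := by simp [field, numsWord, joinSep]

namespace InstanceWord

/-- The list of numbers `u` has, from position `o` on, the pair `γ, p`. -/
def HasPair (u : List Letter) (o γ p : ℕ) : Prop :=
  ∃ i < u.count comma, o + 2 * i + 1 < u.count comma ∧ numAt u (o + 2 * i) = γ ∧
    numAt u (o + 2 * i + 1) = p

/-- The head `ls` is needed because the second part of a tile starts with its state and its label,
after which the outgoing pairs follow at offset `2`. -/
theorem hasPair_numsWord (ls : List ℕ) (ps : List (ℕ × ℕ)) (γ p : ℕ) :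
    HasPair (numsWord (ls ++ ps.flatMap fun x => [x.1, x.2])) ls.length γ p ↔ (γ, p) ∈ ps := by
  have h : ∀ (ps : List (ℕ × ℕ)) (i : ℕ),
      (ps.flatMap fun x => [x.1, x.2])[2 * i]? = (ps[i]?).map Prod.fst ∧
      (ps.flatMap fun x => [x.1, x.2])[2 * i + 1]? = (ps[i]?).map Prod.snd := by
    intro ps
    induction ps with
    | nil => simp
    | cons x ps ih =>
      intro i
      cases i with
      | zero => simp
      | succ i => simpa [Nat.mul_add] using ih i
  have hl : (ps.flatMap fun x => [x.1, x.2]).length = 2 * ps.length := by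
    simp [List.length_flatMap, mul_comm]
  simp only [HasPair, count_numsWord, numAt_numsWord, List.length_append, hl]
  constructor
  · rintro ⟨i, _, hi, h1, h2⟩
    have hi' : i < ps.length := by omega
    rw [List.getElem?_append_right (by omega), Nat.add_sub_cancel_left, (h ps i).1,
      List.getElem?_eq_getElem hi'] at h1
    rw [List.getElem?_append_right (by omega), Nat.add_assoc, Nat.add_sub_cancel_left, (h ps i).2,
      List.getElem?_eq_getElem hi'] at h2
    simp only [Option.map_some, Option.getD_some] at h1 h2
    rw [← h1, ← h2]
    exact List.getElem_mem hi'
  · intro hm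
    obtain ⟨i, hi, e⟩ := List.getElem_of_mem hm
    refine ⟨i, by omega, by omega, ?_, ?_⟩
    · rw [List.getElem?_append_right (by omega), Nat.add_sub_cancel_left, (h ps i).1,
        List.getElem?_eq_getElem hi, e]
      rfl
    · rw [List.getElem?_append_right (by omega), Nat.add_assoc, Nat.add_sub_cancel_left, (h ps i).2,
        List.getElem?_eq_getElem hi, e]
      rfl

/-- The list of numbers `u` has the triple `γ, p, q`. -/
def HasTriple (u : List Letter) (γ p q : ℕ) : Prop :=
  ∃ i < u.count comma, 3 * i + 2 < u.count comma ∧ numAt u (3 * i) = γ ∧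
    numAt u (3 * i + 1) = p ∧ numAt u (3 * i + 2) = q

theorem hasTriple_numsWord (ps : List (ℕ × ℕ × ℕ)) (γ p q : ℕ) :
    HasTriple (numsWord (ps.flatMap fun x => [x.1, x.2.1, x.2.2])) γ p q ↔ (γ, p, q) ∈ ps := by
  have h : ∀ (ps : List (ℕ × ℕ × ℕ)) (i : ℕ),
      (ps.flatMap fun x => [x.1, x.2.1, x.2.2])[3 * i]? = (ps[i]?).map (·.1) ∧
      (ps.flatMap fun x => [x.1, x.2.1, x.2.2])[3 * i + 1]? = (ps[i]?).map (·.2.1) ∧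
      (ps.flatMap fun x => [x.1, x.2.1, x.2.2])[3 * i + 2]? = (ps[i]?).map (·.2.2) := by
    intro ps
    induction ps with
    | nil => simp
    | cons x ps ih =>
      intro i
      cases i with
      | zero => simp
      | succ i => simpa [Nat.mul_add] using ih i
  have hl : (ps.flatMap fun x => [x.1, x.2.1, x.2.2]).length = 3 * ps.length := by
    simp [List.length_flatMap, mul_comm]
  simp only [HasTriple, count_numsWord, numAt_numsWord, hl]
  constructor
  · rintro ⟨i, _, hi, h1, h2, h3⟩
    have hi' : i < ps.length := by omega
    rw [(h ps i).1, List.getElem?_eq_getElem hi'] at h1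
    rw [(h ps i).2.1, List.getElem?_eq_getElem hi'] at h2
    rw [(h ps i).2.2, List.getElem?_eq_getElem hi'] at h3
    simp only [Option.map_some, Option.getD_some] at h1 h2 h3
    rw [← h1, ← h2, ← h3]
    exact List.getElem_mem hi'
  · intro hm
    obtain ⟨i, hi, e⟩ := List.getElem_of_mem hm
    refine ⟨i, by omega, by omega, ?_, ?_, ?_⟩
    · rw [(h ps i).1, List.getElem?_eq_getElem hi, e]; rfl
    · rw [(h ps i).2.1, List.getElem?_eq_getElem hi, e]; rfl
    · rw [(h ps i).2.2, List.getElem?_eq_getElem hi, e]; rfl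

variable (w : List Letter)

noncomputable def numEdgeNames : ℕ := numAt (piece semicolon w 0) 0

noncomputable def numStates : ℕ := numAt (piece semicolon w 0) 2

/-- Each tile ends with a semicolon. The other four end the header, the list of tiles, the labels
and the edges. -/
def numTiles : ℕ := w.count semicolon - 4

/-- Piece `0` is the header, the tiles follow, and piece `numTiles w + 1` is the empty word before
the semicolon that ends the list of tiles. -/
def labelText : List Letter := piece semicolon w (numTiles w + 2)

def edgeText : List Letter := piece semicolon w (numTiles w + 3)

/-- The vertices are counted by their labels instead of being read off the header, so that their
number is visibly at most the length of the word. -/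
def numVertices : ℕ := (labelText w).count comma

/-- The edges and the state in the middle of the `j`-th tile, and its weight, are separated by
bars. -/
def tileText (j i : ℕ) : List Letter := piece bar (piece semicolon w (j + 1)) i

/-- The state of the vertex `v` in the labelling with the number `R`. -/
noncomputable def stateAt (R v : ℕ) : ℕ := R / numStates w ^ v % numStates w

/-- The number of labellings of the vertices by states. -/
noncomputable def numLabellings : ℕ := numStates w ^ numVertices w

/-- The `j`-th tile is the tile of the vertex `v` in the labelling with the number `R`. -/
def TileMatches (R v j : ℕ) : Prop :=
  numAt (tileText w j 1) 0 = stateAt w R v ∧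
  numAt (tileText w j 1) 1 = numAt (labelText w) v ∧
  ∀ γ < numEdgeNames w, ∀ p < numStates w,
    (HasPair (tileText w j 0) 0 γ p ↔
      ∃ u < numVertices w, HasTriple (edgeText w) γ u v ∧ stateAt w R u = p) ∧
    (HasPair (tileText w j 1) 2 γ p ↔
      ∃ u < numVertices w, HasTriple (edgeText w) γ v u ∧ stateAt w R u = p)

end InstanceWord

/-! ### Parsing and matching in polynomial space -/

section PSpace

variable {ι : Type} {n : ι → ℕ} {X : Set (ι → ℕ)} {w : ι → List Letter}

theorem PSpaceWord.numAt {k : ι → ℕ} (hw : PSpaceWord n X w) (hk : PSpace n X k) :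
    PSpace n X (fun a => numAt (w a) (k a)) := (hw.piece comma hk).natVal

open InstanceWord

theorem PSpaceWord.hasPair {γ p : ι → ℕ} (hw : PSpaceWord n X w) (o : ℕ) (hγ : PSpace n X γ)
    (hp : PSpace n X p) : PSpacePred n X (fun a => HasPair (w a) o (γ a) (p a)) := by
  have hc := hw.count comma
  have hi := ((PSpace.const o).add ((PSpace.const 2).mul hc.lift_idx))
  exact .exists_lt (P := fun a i => o + 2 * i + 1 < (w a).count comma ∧
    _root_.numAt (w a) (o + 2 * i) = γ a ∧ _root_.numAt (w a) (o + 2 * i + 1) = p a) hc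
    ((PSpacePred.lt hi.succ hc.lift).and ((PSpacePred.eq (hw.lift.numAt hi) hγ.lift).and
      (.eq (hw.lift.numAt hi.succ) hp.lift)))

theorem PSpaceWord.hasTriple {γ p q : ι → ℕ} (hw : PSpaceWord n X w) (hγ : PSpace n X γ)
    (hp : PSpace n X p) (hq : PSpace n X q) :
    PSpacePred n X (fun a => HasTriple (w a) (γ a) (p a) (q a)) := by
  have hc := hw.count comma
  have hi := (PSpace.const 3).mul hc.lift_idx
  exact .exists_lt (P := fun a i => 3 * i + 2 < (w a).count comma ∧
    _root_.numAt (w a) (3 * i) = γ a ∧ _root_.numAt (w a) (3 * i + 1) = p a ∧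
    _root_.numAt (w a) (3 * i + 2) = q a) hc
    ((PSpacePred.lt hi.succ.succ hc.lift).and ((PSpacePred.eq (hw.lift.numAt hi) hγ.lift).and
      ((PSpacePred.eq (hw.lift.numAt hi.succ) hp.lift).and
        (.eq (hw.lift.numAt hi.succ.succ) hq.lift))))

variable {R v j : ι → ℕ} (hw : PSpaceWord n X w)

include hw

theorem PSpaceWord.numEdgeNames : PSpace n X (fun a => numEdgeNames (w a)) :=
  (hw.piece _ .zero).numAt .zero

theorem PSpaceWord.numStates : PSpace n X (fun a => numStates (w a)) :=
  (hw.piece _ .zero).numAt (.const 2)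

theorem PSpaceWord.numTiles : PSpace n X (fun a => numTiles (w a)) :=
  (hw.count _).sub (.const 4)

theorem PSpaceWord.numTiles_polyBound : PolyBound n (fun a => InstanceWord.numTiles (w a)) :=
  hw.length_polyBound.of_le fun _ => (Nat.sub_le _ _).trans List.count_le_length

theorem PSpaceWord.labelText : PSpaceWord n X (fun a => labelText (w a)) :=
  hw.piece _ (hw.numTiles.add (.const 2))

theorem PSpaceWord.edgeText : PSpaceWord n X (fun a => edgeText (w a)) :=
  hw.piece _ (hw.numTiles.add (.const 3))

theorem PSpaceWord.numVertices : PSpace n X (fun a => numVertices (w a)) :=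
  hw.labelText.count _

theorem PSpaceWord.numVertices_polyBound : PolyBound n (fun a => InstanceWord.numVertices (w a)) :=
  hw.labelText.length_polyBound.of_le fun _ => List.count_le_length

theorem PSpaceWord.tileText (hj : PSpace n X j) (i : ℕ) :
    PSpaceWord n X (fun a => tileText (w a) (j a) i) :=
  (hw.piece _ hj.succ).piece _ (.const i)

theorem PSpaceWord.numLabellings : PSpace n X (fun a => numLabellings (w a)) :=
  hw.numStates.pow hw.numVertices hw.numVertices_polyBound

theorem PSpaceWord.stateAt (hR : PSpace n X R) (hv : PSpace n X v) :
    PSpace n X (fun a => stateAt (w a) (R a) (v a)) :=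
  (hR.div_pow hw.numStates hv).mod hw.numStates

/-- All quantifiers have computable bounds. The numbers of edge names and of states are given in
binary, so these searches may be exponentially long. -/
theorem PSpaceWord.tileMatches (hR : PSpace n X R) (hv : PSpace n X v) (hj : PSpace n X j) :
    PSpacePred n X (fun a => TileMatches (w a) (R a) (v a) (j a)) := by
  have hm := hw.tileText hj 1
  refine (PSpacePred.eq (hm.numAt .zero) (hw.stateAt hR hv)).and
    ((PSpacePred.eq (hm.numAt (.const 1)) (hw.labelText.numAt hv)).and ?_)
  have hG := hw.numEdgeNames
  have hQ := hw.numStates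
  refine .forall_lt (P := fun a γ => ∀ p < InstanceWord.numStates (w a),
    (HasPair (InstanceWord.tileText (w a) (j a) 0) 0 γ p ↔ ∃ u < InstanceWord.numVertices (w a),
      HasTriple (InstanceWord.edgeText (w a)) γ u (v a) ∧ InstanceWord.stateAt (w a) (R a) u = p) ∧
    (HasPair (InstanceWord.tileText (w a) (j a) 1) 2 γ p ↔ ∃ u < InstanceWord.numVertices (w a),
      HasTriple (InstanceWord.edgeText (w a)) γ (v a) u ∧ InstanceWord.stateAt (w a) (R a) u = p))
    hG ?_
  refine .forall_lt (N := fun a : Below fun a => InstanceWord.numEdgeNames (w a) =>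
      InstanceWord.numStates (w a.base)) (P := fun a p =>
    (HasPair (InstanceWord.tileText (w a.base) (j a.base) 0) 0 a.idx p ↔
      ∃ u < InstanceWord.numVertices (w a.base), HasTriple (InstanceWord.edgeText (w a.base))
        a.idx u (v a.base) ∧ InstanceWord.stateAt (w a.base) (R a.base) u = p) ∧
    (HasPair (InstanceWord.tileText (w a.base) (j a.base) 1) 2 a.idx p ↔
      ∃ u < InstanceWord.numVertices (w a.base), HasTriple (InstanceWord.edgeText (w a.base))
        a.idx (v a.base) u ∧ InstanceWord.stateAt (w a.base) (R a.base) u = p))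
    hQ.lift ?_
  have hw' := hw.lift (N := fun a => InstanceWord.numEdgeNames (w a)) |>.lift
    (N := fun a => InstanceWord.numStates (w a.base))
  have hR' := hR.lift (N := fun a => InstanceWord.numEdgeNames (w a)) |>.lift
    (N := fun a => InstanceWord.numStates (w a.base))
  have hv' := hv.lift (N := fun a => InstanceWord.numEdgeNames (w a)) |>.lift
    (N := fun a => InstanceWord.numStates (w a.base))
  have hj' := hj.lift (N := fun a => InstanceWord.numEdgeNames (w a)) |>.lift
    (N := fun a => InstanceWord.numStates (w a.base))
  have hγ := hG.lift_idx.lift (N := fun a => InstanceWord.numStates (w a.base))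
  have hp := hQ.lift (N := fun a => InstanceWord.numEdgeNames (w a)) |>.lift_idx
  have hV := hw'.numVertices
  have hS := PSpacePred.eq (hw'.lift.stateAt hR'.lift hV.lift_idx) hp.lift
  exact (((hw'.tileText hj' 0).hasPair 0 hγ hp).iff (.exists_lt hV
      ((hw'.lift.edgeText.hasTriple hγ.lift hV.lift_idx hv'.lift).and hS))).and
    (((hw'.tileText hj' 1).hasPair 2 hγ hp).iff (.exists_lt hV
      ((hw'.lift.edgeText.hasTriple hγ.lift hv'.lift hV.lift_idx).and hS)))

end PSpace

/-! ### The values of an instance in terms of its word -/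

/-- The graph of a partial function as a list of pairs of numbers. -/
def graphList {g q : ℕ} (f : Fin g → Option (Fin q)) : List (ℕ × ℕ) :=
  (List.finRange g).filterMap fun γ => (f γ).map fun p : Fin q => (γ.val, p.val)

theorem mem_graphList {g q : ℕ} (f : Fin g → Option (Fin q)) (γ : Fin g) (p : Fin q) :
    ((γ : ℕ), (p : ℕ)) ∈ graphList f ↔ f γ = some p := by
  simp only [graphList, List.mem_filterMap, List.mem_finRange, true_and, Option.map_eq_some_iff,
    Prod.mk.injEq]
  constructor
  · rintro ⟨γ', p', h, h1, h2⟩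
    rwa [← Fin.ext h1, ← Fin.ext h2]
  · intro h
    exact ⟨γ, p, h, rfl, rfl⟩

theorem partialFunWord_eq {g q : ℕ} (f : Fin g → Option (Fin q)) :
    partialFunWord f = numsWord ((graphList f).flatMap fun x => [x.1, x.2]) := by
  rw [partialFunWord, graphList]
  induction List.finRange g with
  | nil => rfl
  | cons γ l ih =>
    rw [List.flatMap_cons, ih]
    cases h : f γ with
    | none => simp [h]
    | some p =>
      rw [List.filterMap_cons, h]
      simp only [Option.map_some, List.flatMap_cons, numsWord_append, field_eq]
      rw [← numsWord_append]
      rfl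

theorem joinSep_pair_append (x : Letter) (u v t : List Letter) :
    joinSep x [u, v] ++ t = u ++ x :: (v ++ x :: t) := by simp [joinSep]

theorem Tile.word_eq {g l q : ℕ} (t : Tile (Fin g) (Fin l) (Fin q)) :
    t.word = joinSep bar [numsWord ((graphList t.inState).flatMap fun x => [x.1, x.2]),
      numsWord ([(t.state : ℕ), (t.label : ℕ)] ++
        (graphList t.outState).flatMap fun x => [x.1, x.2])] := by
  have h : ∀ k l : ℕ, numsWord [k, l] = numsWord [k] ++ numsWord [l] := fun k l =>
    numsWord_append [k] [l]
  simp only [Tile.word, partialFunWord_eq, field_eq, joinSep, List.flatMap_cons, List.flatMap_nil,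
    numsWord_append, h]
  simp

theorem notMem_numsWord {x : Letter} (hx : x = semicolon ∨ x = bar) (ks : List ℕ) :
    x ∉ numsWord ks := by
  intro h
  rcases mem_numsWord h with ⟨b, rfl⟩ | rfl <;> simp at hx

theorem semicolon_notMem_tileWord {g l q : ℕ} (t : Tile (Fin g) (Fin l) (Fin q)) :
    semicolon ∉ t.word := by
  rw [Tile.word_eq]
  simp [joinSep, notMem_numsWord (.inl rfl)]

/-! ### Runs and the value as a sum over all labellings -/

namespace WTS

variable {E L Q V : Type} (G : LabelledGraph E L V) (ρ : V → Q) (v : V) (γ : E) (q : Q)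

/-- By `in_unique` the neighbour chosen in `tileAt` is the only one. -/
theorem inState_tileAt : (tileAt G ρ v).inState γ = some q ↔ ∃ u, G.edge γ u v ∧ ρ u = q := by
  by_cases h : ∃ u, G.edge γ u v
  · simp only [tileAt, dif_pos h, Option.some.injEq]
    constructor
    · intro e
      exact ⟨_, h.choose_spec, e⟩
    · rintro ⟨u, hu, rfl⟩
      rw [G.in_unique γ v _ _ h.choose_spec hu]
  · simp only [tileAt, dif_neg h, reduceCtorEq, false_iff]
    rintro ⟨u, hu, _⟩
    exact h ⟨u, hu⟩

theorem outState_tileAt : (tileAt G ρ v).outState γ = some q ↔ ∃ u, G.edge γ v u ∧ ρ u = q := by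
  by_cases h : ∃ u, G.edge γ v u
  · simp only [tileAt, dif_pos h, Option.some.injEq]
    constructor
    · intro e
      exact ⟨_, h.choose_spec, e⟩
    · rintro ⟨u, hu, rfl⟩
      rw [G.out_unique γ v _ _ h.choose_spec hu]
  · simp only [tileAt, dif_neg h, reduceCtorEq, false_iff]
    rintro ⟨u, hu, _⟩
    exact h ⟨u, hu⟩

/-- Thus the condition on types in the definition of a run holds automatically, and only membership
in the set of tiles is left to check. -/
theorem vertexType_tileAt : (tileAt G ρ v).vertexType = G.vertexType v := by
  refine Prod.ext (Set.ext fun γ => ?_) (Set.ext fun γ => ?_)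
  · simp only [Tile.vertexType, LabelledGraph.vertexType, Set.mem_ofPred_eq, tileAt]
    split_ifs with h <;> simp [h]
  · simp only [Tile.vertexType, LabelledGraph.vertexType, Set.mem_ofPred_eq, tileAt]
    split_ifs with h <;> simp [h]

-- A labelling that is not a run has some vertex whose tile is not permissible, so its product
-- contains a factor zero.
open Classical in
theorem value_eq_sum {S : Type} [CommSemiring S] [Fintype V] [DecidableEq V] [Fintype Q]
    (T : WTS E L Q S) :
    T.value G = ∑ ρ : V → Q, ∏ v, if h : tileAt G ρ v ∈ T.tiles then T.wgt ⟨_, h⟩ else 0 := by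
  have hrun : ∀ ρ : V → Q, T.IsRun G ρ ↔ ∀ v, tileAt G ρ v ∈ T.tiles := fun ρ =>
    forall_congr' fun v => and_iff_left (vertexType_tileAt G ρ v)
  rw [value, ← Finset.sum_filter_of_ne (p := T.IsRun G)]
  · rw [Finset.sum_subtype (p := T.IsRun G) _ (by simp)]
    refine Finset.sum_congr rfl fun ρ _ => ?_
    exact Finset.prod_congr rfl fun v _ => by rw [dif_pos (ρ.2 v).1]
  · intro ρ _ hρ
    rw [hrun]
    intro v
    by_contra h
    exact hρ (Finset.prod_eq_zero (Finset.mem_univ v) (dif_neg h))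

end WTS

/-! ### Correctness of parsing -/

namespace EvalInstance

variable {S : Type} (enc : S → List Letter) (I : EvalInstance S)

/-- The pieces of the word of an instance. -/
def pieces : List (List Letter) :=
  numsWord [I.numEdgeNames, I.numLabels, I.numStates, I.numVertices] ::
    (I.tileList.map (fun t => t.1.word ++ enc (I.T.wgt t)) ++
    [[], numsWord ((List.finRange I.numVertices).map fun v => (I.G.label v : ℕ)),
      numsWord ((I.edgeList.map fun e => ((e.1 : ℕ), (e.2.1 : ℕ), (e.2.2 : ℕ))).flatMap
        fun x => [x.1, x.2.1, x.2.2])])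

theorem word_eq : I.word enc = joinSep semicolon (I.pieces enc) := by
  have h1 : numsWord ((List.finRange I.numVertices).map fun v => (I.G.label v : ℕ)) =
      (List.finRange I.numVertices).flatMap fun v => field (I.G.label v) := by
    simp [numsWord, joinSep, field, List.flatMap_map]
  have h2 : numsWord ((I.edgeList.map fun e => ((e.1 : ℕ), (e.2.1 : ℕ), (e.2.2 : ℕ))).flatMap
      fun x => [x.1, x.2.1, x.2.2]) =
      I.edgeList.flatMap fun e => field e.1 ++ field e.2.1 ++ field e.2.2 := by
    rw [numsWord_flatMap, List.flatMap_map]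
    simp [numsWord, joinSep, field]
  rw [pieces, h1, h2, joinSep_cons, joinSep_append]
  simp [word, joinSep, numsWord, field, List.flatMap_map]

variable {enc} (henc : ∀ x, ∀ y ∈ enc x, y ≠ semicolon ∧ y ≠ bar)

include henc

theorem semicolon_notMem_pieces : ∀ u ∈ I.pieces enc, semicolon ∉ u := by
  intro u hu h
  simp only [pieces, List.mem_cons, List.mem_append, List.mem_map, List.not_mem_nil,
    or_false] at hu
  rcases hu with rfl | ⟨t, _, rfl⟩ | rfl | rfl | rfl
  · exact notMem_numsWord (.inl rfl) _ h
  · rcases List.mem_append.1 h with h | h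
    · exact semicolon_notMem_tileWord _ h
    · exact (henc _ _ h).1 rfl
  · cases h
  · exact notMem_numsWord (.inl rfl) _ h
  · exact notMem_numsWord (.inl rfl) _ h

theorem piece_word (j : ℕ) : piece semicolon (I.word enc) j = ((I.pieces enc)[j]?).getD [] := by
  rw [word_eq, piece_joinSep _ _ (I.semicolon_notMem_pieces henc)]

theorem numTiles_word : InstanceWord.numTiles (I.word enc) = I.tileList.length := by
  rw [InstanceWord.numTiles, word_eq, count_joinSep _ _ (I.semicolon_notMem_pieces henc), pieces]
  simp

theorem numEdgeNames_word : InstanceWord.numEdgeNames (I.word enc) = I.numEdgeNames := by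
  rw [InstanceWord.numEdgeNames, I.piece_word henc]
  simp [pieces, numAt_numsWord]

theorem numStates_word : InstanceWord.numStates (I.word enc) = I.numStates := by
  rw [InstanceWord.numStates, I.piece_word henc]
  simp [pieces, numAt_numsWord]

theorem labelText_word : InstanceWord.labelText (I.word enc) =
    numsWord ((List.finRange I.numVertices).map fun v => (I.G.label v : ℕ)) := by
  rw [InstanceWord.labelText, I.piece_word henc, I.numTiles_word henc, pieces,
    List.getElem?_cons_succ, List.getElem?_append_right (by simp)]
  simp

theorem edgeText_word : InstanceWord.edgeText (I.word enc) =
    numsWord ((I.edgeList.map fun e => ((e.1 : ℕ), (e.2.1 : ℕ), (e.2.2 : ℕ))).flatMap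
        fun x => [x.1, x.2.1, x.2.2]) := by
  rw [InstanceWord.edgeText, I.piece_word henc, I.numTiles_word henc, pieces,
    List.getElem?_cons_succ, List.getElem?_append_right (by simp)]
  simp

theorem numVertices_word : InstanceWord.numVertices (I.word enc) = I.numVertices := by
  rw [InstanceWord.numVertices, I.labelText_word henc, count_numsWord]
  simp

theorem numLabellings_word :
    InstanceWord.numLabellings (I.word enc) = I.numStates ^ I.numVertices := by
  rw [InstanceWord.numLabellings, I.numStates_word henc, I.numVertices_word henc]

theorem hasTriple_edgeText (γ : Fin I.numEdgeNames) (u v : Fin I.numVertices) :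
    InstanceWord.HasTriple (InstanceWord.edgeText (I.word enc)) γ u v ↔ I.G.edge γ u v := by
  rw [I.edgeText_word henc, InstanceWord.hasTriple_numsWord, ← I.mem_edgeList]
  simp only [List.mem_map, Prod.mk.injEq]
  constructor
  · rintro ⟨⟨a, b, c⟩, h, h1, h2, h3⟩
    rwa [← Fin.ext h1, ← Fin.ext h2, ← Fin.ext h3]
  · intro h
    exact ⟨_, h, rfl, rfl, rfl⟩

section tileText

variable (j : ℕ) (hj : j < I.tileList.length)

theorem tile_piece : piece semicolon (I.word enc) (j + 1) =
    (I.tileList[j]).1.word ++ enc (I.T.wgt I.tileList[j]) := by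
  rw [I.piece_word henc, pieces, List.getElem?_cons_succ,
    List.getElem?_append_left (by simpa using hj)]
  simp [hj]

theorem tileText_zero : InstanceWord.tileText (I.word enc) j 0 =
    numsWord ((graphList (I.tileList[j]).1.inState).flatMap fun x => [x.1, x.2]) := by
  rw [InstanceWord.tileText, I.tile_piece henc j hj, Tile.word_eq, joinSep_pair_append,
    piece_append_zero _ _ _ (notMem_numsWord (.inr rfl) _)]

theorem tileText_one : InstanceWord.tileText (I.word enc) j 1 =
    numsWord ([((I.tileList[j]).1.state : ℕ), ((I.tileList[j]).1.label : ℕ)] ++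
        (graphList (I.tileList[j]).1.outState).flatMap fun x => [x.1, x.2]) := by
  rw [InstanceWord.tileText, I.tile_piece henc j hj, Tile.word_eq, joinSep_pair_append,
    piece_append_succ _ _ _ (notMem_numsWord (.inr rfl) _),
    piece_append_zero _ _ _ (notMem_numsWord (.inr rfl) _)]

theorem tileText_two : InstanceWord.tileText (I.word enc) j 2 = enc (I.T.wgt I.tileList[j]) := by
  rw [InstanceWord.tileText, I.tile_piece henc j hj, Tile.word_eq, joinSep_pair_append,
    piece_append_succ _ _ _ (notMem_numsWord (.inr rfl) _),
    piece_append_succ _ _ _ (notMem_numsWord (.inr rfl) _)]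
  exact piece_zero_of_notMem _ _ fun h => (henc _ _ h).2 rfl

end tileText

/-- The labelling of the vertices with the number `R`. -/
def labelling (R : Fin (I.numStates ^ I.numVertices)) : Fin I.numVertices → Fin I.numStates :=
  finFunctionFinEquiv.symm R

/-- `finFunctionFinEquiv` is the expansion in base `numStates`, least significant digit first. -/
theorem stateAt_word (R : Fin (I.numStates ^ I.numVertices)) (v : Fin I.numVertices) :
    InstanceWord.stateAt (I.word enc) R v = I.labelling R v := by
  rw [InstanceWord.stateAt, I.numStates_word henc, labelling, finFunctionFinEquiv_symm_apply_val]

/-- A partial function is determined by the pairs in its graph, so agreement of all pairs, together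
with the state and the label, is equality of tiles. -/
theorem tileMatches_iff (R : Fin (I.numStates ^ I.numVertices)) (v : Fin I.numVertices) (j : ℕ)
    (hj : j < I.tileList.length) : InstanceWord.TileMatches (I.word enc) R v j ↔
      (I.tileList[j]).1 = WTS.tileAt I.G (I.labelling R) v := by
  have hin : ∀ γ p, (∃ u < I.numVertices, InstanceWord.HasTriple
      (InstanceWord.edgeText (I.word enc)) (γ : Fin I.numEdgeNames) u v ∧
        InstanceWord.stateAt (I.word enc) R u = (p : Fin I.numStates)) ↔
      (WTS.tileAt I.G (I.labelling R) v).inState γ = some p := by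
    intro γ p
    rw [WTS.inState_tileAt]
    constructor
    · rintro ⟨u, hu, h1, h2⟩
      refine ⟨⟨u, hu⟩, (I.hasTriple_edgeText henc γ ⟨u, hu⟩ v).1 h1, Fin.ext ?_⟩
      rw [← h2, ← I.stateAt_word henc]
    · rintro ⟨u, h1, rfl⟩
      exact ⟨u, u.2, (I.hasTriple_edgeText henc γ u v).2 h1, I.stateAt_word henc R u⟩
  have hout : ∀ γ p, (∃ u < I.numVertices, InstanceWord.HasTriple
      (InstanceWord.edgeText (I.word enc)) (γ : Fin I.numEdgeNames) v u ∧
        InstanceWord.stateAt (I.word enc) R u = (p : Fin I.numStates)) ↔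
      (WTS.tileAt I.G (I.labelling R) v).outState γ = some p := by
    intro γ p
    rw [WTS.outState_tileAt]
    constructor
    · rintro ⟨u, hu, h1, h2⟩
      refine ⟨⟨u, hu⟩, (I.hasTriple_edgeText henc γ v ⟨u, hu⟩).1 h1, Fin.ext ?_⟩
      rw [← h2, ← I.stateAt_word henc]
    · rintro ⟨u, h1, rfl⟩
      exact ⟨u, u.2, (I.hasTriple_edgeText henc γ v u).2 h1, I.stateAt_word henc R u⟩
  have hlabel : numAt (InstanceWord.labelText (I.word enc)) v = I.G.label v := by
    rw [I.labelText_word henc, numAt_numsWord]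
    simp
  have hp0 : ∀ (γ : Fin I.numEdgeNames) (p : Fin I.numStates),
      InstanceWord.HasPair (InstanceWord.tileText (I.word enc) j 0) 0 γ p ↔
        (I.tileList[j]).1.inState γ = some p := by
    intro γ p
    rw [← mem_graphList, I.tileText_zero henc j hj]
    exact InstanceWord.hasPair_numsWord [] _ _ _
  have hp1 : ∀ (γ : Fin I.numEdgeNames) (p : Fin I.numStates),
      InstanceWord.HasPair (InstanceWord.tileText (I.word enc) j 1) 2 γ p ↔
        (I.tileList[j]).1.outState γ = some p := by
    intro γ p
    rw [← mem_graphList, I.tileText_one henc j hj]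
    exact InstanceWord.hasPair_numsWord [_, _] _ _ _
  rw [InstanceWord.TileMatches, I.numEdgeNames_word henc, I.numStates_word henc,
    I.numVertices_word henc, hlabel, I.stateAt_word henc]
  simp only [Nat.forall_lt_iff_fin, hin, hout, hp0, hp1]
  rw [I.tileText_one henc j hj, numAt_numsWord, numAt_numsWord]
  generalize (I.tileList[j]).1 = t
  constructor
  · rintro ⟨h1, h2, h3⟩
    obtain ⟨t1, t2, t3, t4⟩ := t
    have e2 : t2 = I.labelling R v := Fin.ext (by simpa using h1)
    have e3 : t3 = I.G.label v := Fin.ext (by simpa using h2)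
    have e1 : t1 = (WTS.tileAt I.G (I.labelling R) v).inState :=
      funext fun γ => Option.ext fun p => (h3 γ p).1
    have e4 : t4 = (WTS.tileAt I.G (I.labelling R) v).outState :=
      funext fun γ => Option.ext fun p => (h3 γ p).2
    subst e1 e2 e3 e4
    rfl
  · rintro rfl
    exact ⟨by simp [WTS.tileAt], by simp [WTS.tileAt], fun γ p => ⟨Iff.rfl, Iff.rfl⟩⟩

omit henc in
/-- The weight of the `j`-th tile. -/
def weightAt [Zero S] (j : ℕ) : S := (I.tileList[j]?).elim 0 I.T.wgt

omit henc in
theorem weightAt_eq [Zero S] (j : ℕ) (hj : j < I.tileList.length) :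
    I.weightAt j = I.T.wgt I.tileList[j] := by
  rw [weightAt, List.getElem?_eq_getElem hj]; rfl

/-- Both tiles equal the tile of `v`, and the list has no repetitions. Hence sums over the matching
tiles have at most one term. -/
theorem tileMatches_unique (R : Fin (I.numStates ^ I.numVertices)) (v : Fin I.numVertices)
    {j j' : ℕ} (hj : j < I.tileList.length) (hj' : j' < I.tileList.length)
    (h : InstanceWord.TileMatches (I.word enc) R v j)
    (h' : InstanceWord.TileMatches (I.word enc) R v j') : j = j' := by
  rw [I.tileMatches_iff henc R v _ hj] at h
  rw [I.tileMatches_iff henc R v _ hj'] at h'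
  exact (I.tileList_nodup.getElem_inj_iff).1 (Subtype.ext (h.trans h'.symm))

-- The inner sum is the weight of the tile of `v` if that tile is permissible, and is zero
-- otherwise; the labellings are replaced by their numbers.
open Classical in
theorem value_eq_sum [CommSemiring S] : I.value = ∑ R ∈ Finset.range (I.numStates ^ I.numVertices),
    ∏ v ∈ Finset.range I.numVertices, ∑ j ∈ Finset.range I.tileList.length,
      if InstanceWord.TileMatches (I.word enc) R v j then I.weightAt j else 0 := by
  rw [value, WTS.value_eq_sum, Finset.sum_range, ← finFunctionFinEquiv.symm.sum_comp]
  refine Finset.sum_congr rfl fun R _ => ?_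
  rw [Finset.prod_range]
  refine Finset.prod_congr rfl fun v _ => ?_
  change (if h : WTS.tileAt I.G (I.labelling R) v ∈ I.T.tiles then I.T.wgt ⟨_, h⟩ else 0) = _
  split_ifs with h
  · obtain ⟨j, hj, e⟩ := List.getElem_of_mem (I.mem_tileList ⟨_, h⟩)
    have hm : InstanceWord.TileMatches (I.word enc) R v j :=
      (I.tileMatches_iff henc R v j hj).2 (by rw [e])
    rw [Finset.sum_eq_single_of_mem j (Finset.mem_range.2 hj), if_pos hm, I.weightAt_eq j hj, e]
    intro j' hj' hne
    exact if_neg fun hm' => hne (I.tileMatches_unique henc R v (Finset.mem_range.1 hj') hj hm' hm)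
  · refine (Finset.sum_eq_zero fun j hj => if_neg fun hm => h ?_).symm
    rw [I.tileMatches_iff henc R v j (Finset.mem_range.1 hj)] at hm
    rw [← hm]
    exact Subtype.coe_prop _

end EvalInstance

/-! ### Sums over the labellings with integer weights -/

/-- `F` is computable in polynomial space, uniformly in its two arguments. -/
def WordPSpace (F : List Letter → ℕ → ℕ) : Prop :=
  ∀ {ι : Type} {n : ι → ℕ} {X : Set (ι → ℕ)} {w : ι → List Letter} {j : ι → ℕ},
    PSpaceWord n X w → PSpace n X j → PSpace n X (fun a => F (w a) (j a))

namespace InstanceWord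

/-- The number `F w j` for the tile `j` of the vertex `v` in the labelling with the number `R`. -/
noncomputable def selected (F : List Letter → ℕ → ℕ) (w : List Letter) (R v : ℕ) : ℕ :=
  ∑ j ∈ Finset.range (numTiles w), truthValue (TileMatches w R v j) * F w j

noncomputable def selectedSum (F : List Letter → ℕ → ℕ) (w : List Letter) (R : ℕ) : ℕ :=
  ∑ v ∈ Finset.range (numVertices w), selected F w R v

noncomputable def selectedProd (F : List Letter → ℕ → ℕ) (w : List Letter) (R : ℕ) : ℕ :=
  ∏ v ∈ Finset.range (numVertices w), selected F w R v

/-- The sum of the products of the numbers `F w j` over those labellings for which the parity of the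
sum of the numbers `s w j` is `b`. -/
noncomputable def paritySum (b : ℕ) (s F : List Letter → ℕ → ℕ) (w : List Letter) : ℕ :=
  ∑ R ∈ Finset.range (numLabellings w),
    truthValue (selectedSum s w R % 2 = b) * selectedProd F w R

end InstanceWord

section PSpace

variable {ι : Type} {n : ι → ℕ} {X : Set (ι → ℕ)} {w : ι → List Letter} {R v : ι → ℕ}
  {F s : List Letter → ℕ → ℕ}

open InstanceWord

theorem WordPSpace.selected (hF : WordPSpace F) (hw : PSpaceWord n X w) (hR : PSpace n X R)
    (hv : PSpace n X v) : PSpace n X (fun a => selected F (w a) (R a) (v a)) :=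
  PSpace.sum (f := fun a j => truthValue (TileMatches (w a) (R a) (v a) j) * F (w a) j) hw.numTiles
    (PSpace.mul (hw.lift.tileMatches hR.lift hv.lift hw.numTiles.lift_idx)
      (hF hw.lift hw.numTiles.lift_idx))

theorem WordPSpace.selectedSum (hF : WordPSpace F) (hw : PSpaceWord n X w) (hR : PSpace n X R) :
    PSpace n X (fun a => selectedSum F (w a) (R a)) :=
  PSpace.sum (f := fun a v => InstanceWord.selected F (w a) (R a) v) hw.numVertices
    (hF.selected hw.lift hR.lift hw.numVertices.lift_idx)

theorem WordPSpace.selectedProd (hF : WordPSpace F) (hw : PSpaceWord n X w) (hR : PSpace n X R) :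
    PSpace n X (fun a => selectedProd F (w a) (R a)) :=
  PSpace.prod (f := fun a v => InstanceWord.selected F (w a) (R a) v) hw.numVertices
    hw.numVertices_polyBound (hF.selected hw.lift hR.lift hw.numVertices.lift_idx)

theorem WordPSpace.paritySum (hs : WordPSpace s) (hF : WordPSpace F) (hw : PSpaceWord n X w)
    (b : ℕ) : PSpace n X (fun a => paritySum b s F (w a)) := by
  have hi := hw.numLabellings.lift_idx
  exact PSpace.sum (f := fun a R => truthValue (InstanceWord.selectedSum s (w a) R % 2 = b) *
    InstanceWord.selectedProd F (w a) R) hw.numLabellings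
    (PSpace.mul (PSpacePred.eq ((hs.selectedSum hw.lift hi).mod (.const 2)) (.const b))
      (hF.selectedProd hw.lift hi))

end PSpace

/-- Only natural numbers can be computed, so a signed number is split into its contributions to an
even and to an odd sum. -/
theorem neg_one_pow_mul_eq (m k : ℕ) : (-1) ^ m * (k : ℤ) =
    (truthValue (m % 2 = 0) * k : ℕ) - (truthValue (m % 2 = 1) * k : ℕ) := by
  rcases Nat.even_or_odd m with hm | hm
  · simp [hm.neg_one_pow, Nat.even_iff.1 hm, truthValue]
  · simp [hm.neg_one_pow, Nat.odd_iff.1 hm, truthValue]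

namespace EvalInstance

variable {S : Type} {enc : S → List Letter} (henc : ∀ x, ∀ y ∈ enc x, y ≠ semicolon ∧ y ≠ bar)
  (I : EvalInstance S)

open InstanceWord

include henc

-- The selected tile does not depend on the summands. The quantification over `K` inside the
-- alternatives lets one case distinction serve weights, signs and absolute values alike.
open Classical in
theorem selection_cases (R : Fin (I.numStates ^ I.numVertices)) (v : Fin I.numVertices) :
    (∀ {K : Type} [AddCommMonoid K] (f : ℕ → K), ∑ j ∈ Finset.range I.tileList.length,
      (if TileMatches (I.word enc) R v j then f j else 0) = 0) ∨
    ∃ j < I.tileList.length, TileMatches (I.word enc) R v j ∧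
      ∀ {K : Type} [AddCommMonoid K] (f : ℕ → K), ∑ j ∈ Finset.range I.tileList.length,
        (if TileMatches (I.word enc) R v j then f j else 0) = f j := by
  by_cases h : ∃ j < I.tileList.length, TileMatches (I.word enc) R v j
  · obtain ⟨j, hj, hm⟩ := h
    refine .inr ⟨j, hj, hm, fun f => ?_⟩
    rw [Finset.sum_eq_single_of_mem j (Finset.mem_range.2 hj), if_pos hm]
    intro j' hj' hne
    exact if_neg fun hm' => hne (I.tileMatches_unique henc R v (Finset.mem_range.1 hj') hj hm' hm)
  · exact .inl fun f => Finset.sum_eq_zero fun j hj =>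
      if_neg fun hm => h ⟨j, Finset.mem_range.1 hj, hm⟩

open Classical in
theorem selected_word (F : List Letter → ℕ → ℕ) (R v : ℕ) : selected F (I.word enc) R v =
    ∑ j ∈ Finset.range I.tileList.length,
      if TileMatches (I.word enc) R v j then F (I.word enc) j else 0 := by
  rw [selected, I.numTiles_word henc]
  exact Finset.sum_congr rfl fun j _ => by rw [truthValue, ite_mul, one_mul, zero_mul]

open Classical in
theorem selected_int {s F : List Letter → ℕ → ℕ} (z : ℕ → ℤ)
    (hz : ∀ j < I.tileList.length, z j = (-1) ^ s (I.word enc) j * F (I.word enc) j)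
    (R v : ℕ) (hR : R < I.numStates ^ I.numVertices) (hv : v < I.numVertices) :
    ∑ j ∈ Finset.range I.tileList.length,
      (if TileMatches (I.word enc) R v j then z j else 0) =
      (-1) ^ selected s (I.word enc) R v * (selected F (I.word enc) R v : ℤ) := by
  rw [I.selected_word henc, I.selected_word henc]
  lift R to Fin _ using hR
  lift v to Fin _ using hv
  rcases I.selection_cases henc R v with h | ⟨j, hj, _, h⟩
  · rw [h, h, h, Nat.cast_zero, mul_zero]
  · rw [h, h, h, hz j hj]

-- The exponents of `-1` add up along a product, so its sign is the parity of `selectedSum s` and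
-- its absolute value is `selectedProd F`. If no tile matches, the factor `selected F` vanishes,
-- whatever the sign.
open Classical in
theorem sum_prod_int {s F : List Letter → ℕ → ℕ} (z : ℕ → ℤ)
    (hz : ∀ j < I.tileList.length, z j = (-1) ^ s (I.word enc) j * F (I.word enc) j) :
    ∑ R ∈ Finset.range (I.numStates ^ I.numVertices), ∏ v ∈ Finset.range I.numVertices,
      ∑ j ∈ Finset.range I.tileList.length,
        (if TileMatches (I.word enc) R v j then z j else 0) =
      (paritySum 0 s F (I.word enc) : ℤ) - paritySum 1 s F (I.word enc) := by
  rw [paritySum, paritySum, I.numLabellings_word henc, Nat.cast_sum, Nat.cast_sum,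
    ← Finset.sum_sub_distrib]
  refine Finset.sum_congr rfl fun R hR => ?_
  rw [Finset.prod_congr rfl fun v hv => I.selected_int henc z hz R v
      (Finset.mem_range.1 hR) (Finset.mem_range.1 hv),
    Finset.prod_mul_distrib, Finset.prod_pow_eq_pow_sum, selectedSum, selectedProd,
    I.numVertices_word henc, ← Nat.cast_prod]
  exact neg_one_pow_mul_eq _ _

end EvalInstance

/-! ### Integers as words -/

/-- The sign of an integer word, `1` for negative numbers. -/
noncomputable def intSign (u : List Letter) : ℕ := truthValue (u[0]? = some minus)

/-- The absolute value of an integer word. -/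
noncomputable def intAbs (u : List Letter) : ℕ := natVal (u.drop (intSign u))

theorem intSign_natWord_append (k : ℕ) (u : List Letter) (hu : u[0]? ≠ some minus) :
    intSign (natWord k ++ u) = 0 := by
  rw [intSign, truthValue, if_neg]
  cases h : natWord k with
  | nil => simpa using hu
  | cons x v =>
    obtain ⟨b, rfl⟩ := mem_natWord (x := x) (k := k) (by rw [h]; simp)
    simp

theorem intSign_natWord (k : ℕ) : intSign (natWord k) = 0 := by
  simpa using intSign_natWord_append k [] (by simp)

theorem eq_sign_mul_abs (z : ℤ) : z = (-1) ^ intSign (intWord z) * intAbs (intWord z) := by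
  rw [intAbs]
  by_cases h : z < 0
  · have hs : intSign (minus :: natWord z.natAbs) = 1 := by simp [intSign, truthValue]
    rw [intWord, if_pos h, hs]
    simp only [List.drop_succ_cons, List.drop_zero, natVal_natWord]
    omega
  · rw [intWord, if_neg h, intSign_natWord]
    simp only [List.drop_zero, natVal_natWord]
    omega

theorem mem_intWord {x : Letter} {z : ℤ} (h : x ∈ intWord z) : (∃ b, x = bit b) ∨ x = minus := by
  rw [intWord] at h
  split_ifs at h
  · rcases List.mem_cons.1 h with h | h
    · exact .inr h
    · exact .inl (mem_natWord h)
  · exact .inl (mem_natWord h)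

section PSpace

variable {ι : Type} {n : ι → ℕ} {X : Set (ι → ℕ)} {w : ι → List Letter} {f g : ι → ℕ}

theorem PSpaceWord.intSign (hw : PSpaceWord n X w) : PSpace n X (fun a => intSign (w a)) :=
  hw.letter .zero minus

theorem PSpaceWord.intAbs (hw : PSpaceWord n X w) : PSpace n X (fun a => intAbs (w a)) :=
  (hw.drop hw.intSign).natVal

theorem PSpaceWord.ite {P : ι → Prop} [DecidablePred P] {u : ι → List Letter}
    (hP : PSpacePred n X P) (hw : PSpaceWord n X w) (hu : PSpaceWord n X u) :
    PSpaceWord n X (fun a => if P a then w a else u a) :=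
  (PSpace.ite hP hw hu).of_eq fun a => by dsimp only; split_ifs <;> rfl

theorem PSpaceWord.intWord_sub (hf : PSpace n X f) (hg : PSpace n X g) :
    PSpaceWord n X (fun a => intWord ((f a : ℤ) - g a)) := by
  refine (PSpaceWord.ite (.lt hf hg) ((PSpaceWord.const [minus]).append (.natWord (hg.sub hf)))
    (.natWord (hf.sub hg))).of_eq fun a => ?_
  rw [intWord]
  split_ifs with h1 h2 h2
  · rw [show ((f a : ℤ) - g a).natAbs = g a - f a by omega]; rfl
  · omega
  · omega
  · rw [show ((f a : ℤ) - g a).natAbs = f a - g a by omega]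

end PSpace

/-- The input word. -/
theorem EvalInstance.pspaceWord_word {S : Type} (enc : S → List Letter) :
    PSpaceWord (fun I : EvalInstance S => (I.word enc).length)
      {fun I => wordCode (I.word enc)} (fun I => I.word enc) :=
  PSpace.var rfl (((PolyBound.const 3).mul .self).add (.const 1) |>.of_le fun I => by
    rw [wordCode_size])

/-- The evaluation problem over a subsemiring of the integers. -/
theorem inFPSpace_of_int {S : Type} [CommSemiring S] (φ : S →+* ℤ) {enc : S → List Letter}
    (henc : ∀ x, enc x = intWord (φ x)) :
    InFPSpace (EvalInstance.word enc) enc (EvalInstance.value : EvalInstance S → S) := by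
  have henc' : ∀ x, ∀ y ∈ enc x, y ≠ semicolon ∧ y ≠ bar := by
    intro x y hy
    rw [henc] at hy
    rcases mem_intWord hy with ⟨b, rfl⟩ | rfl <;> simp
  set s : List Letter → ℕ → ℕ := fun w j => intSign (InstanceWord.tileText w j 2) with hs
  set F : List Letter → ℕ → ℕ := fun w j => intAbs (InstanceWord.tileText w j 2) with hF
  have hs' : WordPSpace s := fun hw hj => (hw.tileText hj 2).intSign
  have hF' : WordPSpace F := fun hw hj => (hw.tileText hj 2).intAbs
  have hval : ∀ I : EvalInstance S, φ I.value =
      (InstanceWord.paritySum 0 s F (I.word enc) : ℤ) -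
        InstanceWord.paritySum 1 s F (I.word enc) := by
    intro I
    rw [← I.sum_prod_int henc' (fun j => φ (I.weightAt j)), I.value_eq_sum henc', map_sum]
    · refine Finset.sum_congr rfl fun R _ => ?_
      rw [map_prod]
      refine Finset.prod_congr rfl fun v _ => ?_
      rw [map_sum]
      exact Finset.sum_congr rfl fun j _ => by rw [apply_ite φ, map_zero]
    · intro j hj
      simp only [hs, hF]
      rw [I.tileText_two henc' j hj, I.weightAt_eq j hj, henc]
      exact eq_sign_mul_abs _
  refine PSpace.inFPSpace ?_
  have hw := EvalInstance.pspaceWord_word enc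
  refine PSpaceWord.of_eq (.intWord_sub (hs'.paritySum hF' hw 0) (hs'.paritySum hF' hw 1)) fun I => ?_
  rw [henc, hval]

/-! ### Rational numbers -/

section PSpace

variable {ι : Type} {n : ι → ℕ} {X : Set (ι → ℕ)} {f g : ι → ℕ}

theorem PSpacePred.dvd (hf : PSpace n X f) (hg : PSpace n X g) :
    PSpacePred n X (fun a => f a ∣ g a) :=
  (eq_zero (hg.mod hf)).of_iff fun _ => (Nat.dvd_iff_mod_eq_zero ..).symm

/-- Search for the common divisor that every common divisor in the range divides. The range below `f
a + g a + 1` contains the gcd itself. -/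
theorem PSpace.gcd (hf : PSpace n X f) (hg : PSpace n X g) :
    PSpace n X (fun a => (f a).gcd (g a)) := by
  have hB := (hf.add hg).succ
  have hlt : ∀ a, (f a).gcd (g a) < f a + g a + 1 := by
    intro a
    rcases Nat.eq_zero_or_pos (f a) with h | h
    · simp [h]
    · have := Nat.gcd_le_left (g a) h
      omega
  refine of_graph (B := fun a => f a + g a + 1) hB hlt ?_
  have hi := hB.lift_idx
  have hf' := hf.lift (N := fun a => f a + g a + 1)
  have hg' := hg.lift (N := fun a => f a + g a + 1)
  have hB' := hB.lift (N := fun a => f a + g a + 1)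
  have hc := hB'.lift_idx
  refine (((PSpacePred.dvd hi hf').and (.dvd hi hg')).and (.forall_lt
    (P := fun (p : Below fun a => f a + g a + 1) c => c ∣ f p.base ∧ c ∣ g p.base → c ∣ p.idx) hB'
    (((PSpacePred.dvd hc hf'.lift).and (.dvd hc hg'.lift)).imp (.dvd hc hi.lift)))).of_iff ?_
  intro p
  constructor
  · rintro ⟨⟨h1, h2⟩, h3⟩
    exact Nat.dvd_antisymm (h3 _ (hlt _) ⟨Nat.gcd_dvd_left _ _, Nat.gcd_dvd_right _ _⟩)
      (Nat.dvd_gcd h1 h2)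
  · intro h
    rw [← h]
    exact ⟨⟨Nat.gcd_dvd_left _ _, Nat.gcd_dvd_right _ _⟩, fun c _ hc => Nat.dvd_gcd hc.1 hc.2⟩

end PSpace

/-- The reduced fraction for `(a - b) / k`. -/
theorem Rat.num_den_sub_div (a b k : ℕ) (hk : 0 < k) :
    (((a : ℚ) - b) / k).num = (((a - b) / (a - b + (b - a)).gcd k : ℕ) : ℤ) -
        ((b - a) / (a - b + (b - a)).gcd k : ℕ) ∧
      (((a : ℚ) - b) / k).den = k / (a - b + (b - a)).gcd k := by
  -- One of the two truncated differences is zero, so their sum is the absolute value of `a - b`.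
  set g := (a - b + (b - a)).gcd k with hg
  have hg0 : 0 < g := Nat.gcd_pos_of_pos_right _ hk
  obtain ⟨k', hk'⟩ := Nat.gcd_dvd_right (a - b + (b - a)) k
  have hgab : g ∣ a - b ∧ g ∣ b - a := by
    have h := Nat.gcd_dvd_left (a - b + (b - a)) k
    rw [← hg] at h
    rcases le_total a b with hab | hab
    · rw [Nat.sub_eq_zero_of_le hab] at h ⊢
      simpa using h
    · rw [Nat.sub_eq_zero_of_le hab] at h ⊢
      simpa using h
  obtain ⟨⟨x, hx⟩, ⟨y, hy⟩⟩ := hgab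
  rw [← hg] at hk'
  have hk0 : 0 < k' := by
    rcases Nat.eq_zero_or_pos k' with rfl | h
    · simp at hk'; omega
    · exact h
  have hxy : x = 0 ∨ y = 0 := by
    rcases le_total a b with hab | hab
    · left
      rw [Nat.sub_eq_zero_of_le hab] at hx
      exact (Nat.mul_eq_zero.1 hx.symm).resolve_left hg0.ne'
    · right
      rw [Nat.sub_eq_zero_of_le hab] at hy
      exact (Nat.mul_eq_zero.1 hy.symm).resolve_left hg0.ne'
  have hcop : Nat.Coprime (x + y) k' := by
    have h : g * (x + y).gcd k' = g * 1 := by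
      rw [← Nat.gcd_mul_left, mul_add, ← hx, ← hy, ← hk', mul_one]
    exact Nat.eq_of_mul_eq_mul_left hg0 h
  have habs : ((x : ℤ) - y).natAbs = x + y := by omega
  have hq : ((a : ℚ) - b) / k = (((x : ℤ) - y : ℤ) : ℚ) / ((k' : ℤ) : ℚ) := by
    have e : (a : ℤ) - b = g * ((x : ℤ) - y) := by
      have h1 : (a : ℤ) - b = ((a - b : ℕ) : ℤ) - ((b - a : ℕ) : ℤ) := by omega
      rw [h1, hx, hy]
      push_cast
      ring
    have e' : (a : ℚ) - b = g * (((x : ℤ) - y : ℤ) : ℚ) := by exact_mod_cast e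
    have hgq : (g : ℚ) ≠ 0 := by exact_mod_cast hg0.ne'
    rw [e', hk', Nat.cast_mul, Int.cast_natCast, mul_div_mul_left _ _ hgq]
  have hcop' : Nat.Coprime ((x : ℤ) - y).natAbs (k' : ℤ).natAbs := by
    rwa [habs, Int.natAbs_natCast]
  rw [hq, Rat.num_div_eq_of_coprime (by exact_mod_cast hk0) hcop', hx, hy, hk',
    Nat.mul_div_cancel_left _ hg0, Nat.mul_div_cancel_left _ hg0, Nat.mul_div_cancel_left _ hg0]
  refine ⟨rfl, ?_⟩
  have := Rat.den_div_eq_of_coprime (a := (x : ℤ) - y) (b := k') (by exact_mod_cast hk0) hcop'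
  exact_mod_cast this

namespace InstanceWord

variable (w : List Letter) (j : ℕ)

noncomputable def weightSign : ℕ := intSign (piece slash (tileText w j 2) 0)

noncomputable def weightDen : ℕ := natVal (piece slash (tileText w j 2) 1)

/-- The product of all denominators is used instead of their least common multiple; it has as many
factors as there are tiles, hence polynomial size. -/
noncomputable def commonDen : ℕ := ∏ i ∈ Finset.range (numTiles w), weightDen w i

/-- The absolute value of the product of the `j`-th weight and the common denominator. -/
noncomputable def scaledAbs : ℕ :=
  intAbs (piece slash (tileText w j 2) 0) * (commonDen w / weightDen w j)

end InstanceWord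

section PSpace

variable {ι : Type} {n : ι → ℕ} {X : Set (ι → ℕ)} {w : ι → List Letter} {j : ι → ℕ}

theorem PSpaceWord.weightDen (hw : PSpaceWord n X w) (hj : PSpace n X j) :
    PSpace n X (fun a => InstanceWord.weightDen (w a) (j a)) :=
  ((hw.tileText hj 2).piece _ (.const 1)).natVal

theorem PSpaceWord.commonDen (hw : PSpaceWord n X w) :
    PSpace n X (fun a => InstanceWord.commonDen (w a)) :=
  PSpace.prod (f := fun a i => InstanceWord.weightDen (w a) i) hw.numTiles hw.numTiles_polyBound
    (hw.lift.weightDen hw.numTiles.lift_idx)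

theorem wordPSpace_weightSign : WordPSpace InstanceWord.weightSign := fun hw hj =>
  ((hw.tileText hj 2).piece _ .zero).intSign

theorem wordPSpace_scaledAbs : WordPSpace InstanceWord.scaledAbs := fun hw hj =>
  (((hw.tileText hj 2).piece _ .zero).intAbs).mul (hw.commonDen.div (hw.weightDen hj))

end PSpace

/-- A rational number as a reduced fraction. -/
def ratWord (q : ℚ) : List Letter := intWord q.num ++ [slash] ++ natWord q.den

theorem slash_notMem_intWord (z : ℤ) : slash ∉ intWord z := fun h => by
  rcases mem_intWord h with ⟨b, hb⟩ | hb <;> cases hb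

theorem slash_notMem_natWord (k : ℕ) : slash ∉ natWord k := fun h => by
  obtain ⟨b, hb⟩ := mem_natWord h; cases hb

theorem piece_ratWord_zero (q : ℚ) : piece slash (ratWord q) 0 = intWord q.num := by
  rw [ratWord, List.append_assoc]
  exact piece_append_zero _ _ _ (slash_notMem_intWord _)

theorem piece_ratWord_one (q : ℚ) : piece slash (ratWord q) 1 = natWord q.den := by
  rw [ratWord, List.append_assoc]
  exact (piece_append_succ _ _ _ (slash_notMem_intWord _) 0).trans
    (piece_zero_of_notMem _ _ (slash_notMem_natWord _))

namespace EvalInstance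

variable {S : Type} [CommSemiring S] (φ : S →+* ℚ) {enc : S → List Letter}
  (henc : ∀ x, enc x = ratWord (φ x)) (I : EvalInstance S)

open InstanceWord

include henc

theorem ratWord_letters (x : S) : ∀ y ∈ enc x, y ≠ semicolon ∧ y ≠ bar := by
  intro y hy
  rw [henc, ratWord] at hy
  rcases List.mem_append.1 hy with hy | hy
  · rcases List.mem_append.1 hy with hy | hy
    · rcases mem_intWord hy with ⟨b, rfl⟩ | rfl <;> simp
    · rw [List.mem_singleton.1 hy]; simp
  · obtain ⟨b, rfl⟩ := mem_natWord hy; simp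

theorem weightDen_word (j : ℕ) (hj : j < I.tileList.length) :
    weightDen (I.word enc) j = (φ (I.weightAt j)).den := by
  rw [weightDen, I.tileText_two (ratWord_letters φ henc) j hj, henc, piece_ratWord_one,
    natVal_natWord, I.weightAt_eq j hj]

theorem commonDen_word_pos : 0 < commonDen (I.word enc) := by
  refine Finset.prod_pos fun j hj => ?_
  rw [I.numTiles_word (ratWord_letters φ henc), Finset.mem_range] at hj
  rw [I.weightDen_word φ henc j hj]
  exact Rat.den_pos _

/-- The denominator of each weight is a factor of the common one, so the scaled weight is an integer
with the sign of the weight. -/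
theorem weight_mul_commonDen (j : ℕ) (hj : j < I.tileList.length) :
    φ (I.weightAt j) * commonDen (I.word enc) =
      (((-1) ^ weightSign (I.word enc) j * scaledAbs (I.word enc) j : ℤ) : ℚ) := by
  have hdvd : weightDen (I.word enc) j ∣ commonDen (I.word enc) :=
    Finset.dvd_prod_of_mem _ (by rwa [I.numTiles_word (ratWord_letters φ henc), Finset.mem_range])
  obtain ⟨k, hk⟩ := hdvd
  have hd : weightDen (I.word enc) j = _ := I.weightDen_word φ henc j hj
  have hpos : 0 < (φ (I.weightAt j)).den := Rat.den_pos _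
  rw [scaledAbs, hk, hd, Nat.mul_div_cancel_left _ hpos, weightSign,
    I.tileText_two (ratWord_letters φ henc) j hj, henc, piece_ratWord_zero, ← I.weightAt_eq j hj,
    Nat.cast_mul, Nat.cast_mul, ← mul_assoc, ← mul_assoc, ← eq_sign_mul_abs, Rat.mul_den_eq_num]
  push_cast
  rfl

-- Every labelling contributes a product of exactly one factor per vertex, so the same power of the
-- common denominator clears all of them.
open Classical in
theorem map_value_rat : φ I.value =
    ((paritySum 0 weightSign scaledAbs (I.word enc) : ℚ) -
      paritySum 1 weightSign scaledAbs (I.word enc)) /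
        (commonDen (I.word enc) ^ InstanceWord.numVertices (I.word enc) : ℕ) := by
  have henc' := ratWord_letters φ henc
  have hD : (commonDen (I.word enc) : ℚ) ≠ 0 := by
    exact_mod_cast (I.commonDen_word_pos φ henc).ne'
  have h := congrArg (Int.cast : ℤ → ℚ) (I.sum_prod_int henc' (s := weightSign) (F := scaledAbs)
    (fun j => (-1) ^ weightSign (I.word enc) j * scaledAbs (I.word enc) j) fun _ _ => rfl)
  rw [Int.cast_sub, Int.cast_natCast, Int.cast_natCast] at h
  rw [← h, Nat.cast_pow, eq_div_iff (pow_ne_zero _ hD), I.value_eq_sum henc', map_sum,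
    Finset.sum_mul, Int.cast_sum]
  refine Finset.sum_congr rfl fun R _ => ?_
  rw [map_prod, I.numVertices_word henc', ← Finset.card_range I.numVertices, ← Finset.prod_const,
    Finset.card_range, ← Finset.prod_mul_distrib, Int.cast_prod]
  refine Finset.prod_congr rfl fun v _ => ?_
  rw [map_sum, Finset.sum_mul, Int.cast_sum]
  refine Finset.sum_congr rfl fun j hj => ?_
  rw [apply_ite φ, map_zero, ite_mul, zero_mul, apply_ite (Int.cast : ℤ → ℚ), Int.cast_zero,
    I.weight_mul_commonDen φ henc j (Finset.mem_range.1 hj)]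

end EvalInstance

/-- The evaluation problem over a subsemiring of the rational numbers. -/
theorem inFPSpace_of_rat {S : Type} [CommSemiring S] (φ : S →+* ℚ) {enc : S → List Letter}
    (henc : ∀ x, enc x = ratWord (φ x)) :
    InFPSpace (EvalInstance.word enc) enc (EvalInstance.value : EvalInstance S → S) := by
  refine PSpace.inFPSpace ?_
  have hw := EvalInstance.pspaceWord_word enc
  have ha := wordPSpace_weightSign.paritySum wordPSpace_scaledAbs hw 0
  have hb := wordPSpace_weightSign.paritySum wordPSpace_scaledAbs hw 1
  have hk := hw.commonDen.pow hw.numVertices hw.numVertices_polyBound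
  have hg := ((ha.sub hb).add (hb.sub ha)).gcd hk
  refine PSpaceWord.of_eq (((PSpaceWord.intWord_sub ((ha.sub hb).div hg) ((hb.sub ha).div hg)).append
    (.const [slash])).append (.natWord (hk.div hg))) fun I => ?_
  obtain ⟨h1, h2⟩ := Rat.num_den_sub_div _ _ _ (pow_pos (I.commonDen_word_pos φ henc) _)
  rw [henc, ratWord, I.map_value_rat φ henc, h1, h2]

/-! ### Labellings whose tiles all have weights with a given property -/

/-- The property `P` of words is decidable in polynomial space. -/
def WordPSpacePred (P : List Letter → Prop) : Prop :=
  ∀ {ι : Type} {n : ι → ℕ} {X : Set (ι → ℕ)} {w : ι → List Letter},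
    PSpaceWord n X w → PSpacePred n X (fun a => P (w a))

namespace InstanceWord

/-- In the labelling with the number `R`, every vertex has a permissible tile, the weight of which
satisfies `P`. -/
def AllWeights (P : List Letter → Prop) (w : List Letter) (R : ℕ) : Prop :=
  ∀ v < numVertices w, ∃ j < numTiles w, TileMatches w R v j ∧ P (tileText w j 2)

end InstanceWord

open InstanceWord in
theorem WordPSpacePred.allWeights {P : List Letter → Prop} (hP : WordPSpacePred P) {ι : Type}
    {n : ι → ℕ} {X : Set (ι → ℕ)} {w : ι → List Letter} {R : ι → ℕ} (hw : PSpaceWord n X w)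
    (hR : PSpace n X R) : PSpacePred n X (fun a => AllWeights P (w a) (R a)) := by
  have hv := hw.numVertices.lift_idx
  have hm := hw.numTiles.lift (N := fun a => numVertices (w a))
  refine .forall_lt (P := fun a v => ∃ j < numTiles (w a), TileMatches (w a) (R a) v j ∧
    P (tileText (w a) j 2)) hw.numVertices ?_
  exact .exists_lt (P := fun (p : Below fun a => numVertices (w a)) j =>
    TileMatches (w p.base) (R p.base) p.idx j ∧ P (tileText (w p.base) j 2)) hm
    ((hw.lift.lift.tileMatches hR.lift.lift hv.lift hm.lift_idx).and
      (hP (hw.lift.lift.tileText hm.lift_idx 2)))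

/-! ### The Boolean semiring -/

namespace BoolSemiring

theorem val_sum {κ : Type} (s : Finset κ) (f : κ → BoolSemiring) :
    (∑ i ∈ s, f i).val = true ↔ ∃ i ∈ s, (f i).val = true := by
  classical
  induction s using Finset.induction_on with
  | empty =>
    rw [Finset.sum_empty]
    change false = true ↔ _
    simp
  | insert i s hi ih =>
    rw [Finset.sum_insert hi]
    change ((f i).val || (∑ i ∈ s, f i).val) = true ↔ _
    rw [Bool.or_eq_true, ih, Finset.exists_mem_insert]

theorem val_prod {κ : Type} (s : Finset κ) (f : κ → BoolSemiring) :
    (∏ i ∈ s, f i).val = true ↔ ∀ i ∈ s, (f i).val = true := by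
  classical
  induction s using Finset.induction_on with
  | empty =>
    rw [Finset.prod_empty]
    change true = true ↔ _
    simp
  | insert i s hi ih =>
    rw [Finset.prod_insert hi]
    change ((f i).val && (∏ i ∈ s, f i).val) = true ↔ _
    rw [Bool.and_eq_true, ih, Finset.forall_mem_insert]

end BoolSemiring

-- Sums are existential and products universal: the value is `1` if and only if in some labelling
-- every vertex has a permissible tile of weight `1`.
open InstanceWord in
theorem inFPSpace_boolean :
    InFPSpace (EvalInstance.word fun x : BoolSemiring => [bit x.val]) (fun x => [bit x.val])
      (EvalInstance.value : EvalInstance BoolSemiring → BoolSemiring) := by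
  classical
  set enc : BoolSemiring → List Letter := fun x => [bit x.val] with henc
  have henc' : ∀ x, ∀ y ∈ enc x, y ≠ semicolon ∧ y ≠ bar := by
    intro x y hy
    rw [henc, List.mem_singleton] at hy
    simp [hy]
  set P : List Letter → Prop := fun u => u[0]? = some (bit true) with hP
  have hval : ∀ I : EvalInstance BoolSemiring,
      I.value.val = true ↔ ∃ R < numLabellings (I.word enc), AllWeights P (I.word enc) R := by
    intro I
    rw [I.value_eq_sum henc', BoolSemiring.val_sum, I.numLabellings_word henc']
    refine exists_congr fun R => and_congr Finset.mem_range ?_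
    rw [BoolSemiring.val_prod, AllWeights, I.numVertices_word henc', I.numTiles_word henc']
    refine forall_congr' fun v => imp_congr Finset.mem_range ?_
    rw [BoolSemiring.val_sum]
    refine exists_congr fun j => ?_
    rw [Finset.mem_range]
    refine and_congr_right fun hj => ?_
    rw [hP, I.tileText_two henc' j hj, henc, I.weightAt_eq j hj]
    split_ifs with h
    · simp [h]
    · simp only [h, false_and]
  refine PSpace.inFPSpace ?_
  have hw := EvalInstance.pspaceWord_word enc
  have hPS : WordPSpacePred P := fun hw => hw.letter .zero _
  have h : PSpacePred _ _ fun I : EvalInstance BoolSemiring => I.value.val = true :=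
    (PSpacePred.exists_lt (P := fun (I : EvalInstance BoolSemiring) R =>
      AllWeights P (I.word enc) R) hw.numLabellings
        (hPS.allWeights hw.lift hw.numLabellings.lift_idx)).of_iff fun I => (hval I).symm
  refine (PSpaceWord.ite h (.const [bit true]) (.const [bit false])).of_eq fun I => ?_
  split_ifs with hI
  · simp only [henc, hI]
  · simp only [henc, Bool.eq_false_iff.2 hI]

/-! ### Tropical semirings -/

open Classical in
/-- The least `i < N` that satisfies `P`, or `N`. -/
noncomputable def leastBelow (P : ℕ → Prop) : ℕ → ℕ
  | 0 => 0
  | N + 1 => if leastBelow P N < N ∨ P N then leastBelow P N else N + 1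

theorem leastBelow_spec (P : ℕ → Prop) (N : ℕ) : leastBelow P N ≤ N ∧
    (leastBelow P N < N → P (leastBelow P N)) ∧ (leastBelow P N = N → ∀ i < N, ¬P i) := by
  induction N with
  | zero => exact ⟨le_rfl, fun h => absurd h (lt_irrefl _), fun _ i hi => absurd hi i.not_lt_zero⟩
  | succ N ih =>
    obtain ⟨h1, h2, h3⟩ := ih
    rw [leastBelow]
    split_ifs with h
    · refine ⟨h1.trans N.le_succ, fun _ => ?_, fun e => by omega⟩
      rcases h1.lt_or_eq with hlt | heq
      · exact h2 hlt
      · rw [heq] at h ⊢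
        exact h.resolve_left (lt_irrefl _)
    · push Not at h
      refine ⟨le_rfl, fun h => absurd h (lt_irrefl _), fun _ i hi => ?_⟩
      rcases (Nat.lt_succ_iff.1 hi).lt_or_eq with hlt | rfl
      · exact h3 (le_antisymm h1 h.1) i hlt
      · exact h.2

theorem PSpacePred.leastBelow {ι : Type} {n : ι → ℕ} {X : Set (ι → ℕ)} {N : ι → ℕ}
    {P : ι → ℕ → Prop} (hN : PSpace n X N)
    (hP : PSpacePred (fun p : Below N => n p.base) (Below.vars N X) (fun p => P p.base p.idx)) :
    PSpace n X (fun a => leastBelow (P a) (N a)) := by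
  classical
  refine PSpace.rec (h := fun a i => _root_.leastBelow (P a) i) hN .zero
    ⟨_, hN.1, fun a i hi => Nat.size_le_size ((leastBelow_spec _ _).1.trans hi)⟩ fun Y hY h => ?_
  have hi := hN.lift_idx.mono hY
  exact (PSpace.ite (.or (.lt h hi) (hP.mono hY)) h hi.succ).of_eq fun p => by
    rw [_root_.leastBelow]

/-- The word of an extended integer in the dual order if `b = 1`. -/
def tropWord (b : ℕ) : WithTop ℤ → List Letter
  | ⊤ => [infinity]
  | WithTop.some z => intWord ((-1) ^ b * z)

theorem tropWord_coe (b : ℕ) (z : ℤ) : tropWord b (z : WithTop ℤ) = intWord ((-1) ^ b * z) := rfl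

theorem infinity_notMem_intWord (z : ℤ) : infinity ∉ intWord z := fun h => by
  rcases mem_intWord h with ⟨b, hb⟩ | hb <;> cases hb

theorem tropWord_letters (b : ℕ) (x : WithTop ℤ) :
    ∀ y ∈ tropWord b x, y ≠ semicolon ∧ y ≠ bar := by
  intro y hy
  induction x with
  | top => rw [List.mem_singleton.1 hy]; simp
  | coe z => rcases mem_intWord hy with ⟨b, rfl⟩ | rfl <;> simp

theorem tropWord_eq_infinity (b : ℕ) (x : WithTop ℤ) :
    (tropWord b x)[0]? = some infinity ↔ x = ⊤ := by
  induction x with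
  | top => simp [tropWord]
  | coe z =>
    simp only [tropWord, WithTop.coe_ne_top, iff_false]
    exact fun h => infinity_notMem_intWord _ (List.mem_of_getElem? h)

namespace InstanceWord

open Classical in
/-- The absolute value of the `j`-th weight if its sign is `b`, and zero otherwise. -/
noncomputable def signedPart (b : ℕ) (w : List Letter) (j : ℕ) : ℕ :=
  if intSign (tileText w j 2) = b then intAbs (tileText w j 2) else 0

/-- All tiles of the labelling with the number `R` have finite weights. -/
def FiniteWeights (w : List Letter) (R : ℕ) : Prop :=
  AllWeights (fun u => u[0]? ≠ some infinity) w R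

/-- The labelling with the number `R` has the least sum of the weights, the natural order of the
weights being reversed if `b = 1`. -/
def IsBest (b : ℕ) (w : List Letter) (R : ℕ) : Prop :=
  FiniteWeights w R ∧ ∀ R' < numLabellings w, FiniteWeights w R' →
    selectedSum (signedPart b) w R + selectedSum (signedPart (1 - b)) w R' ≤
      selectedSum (signedPart b) w R' + selectedSum (signedPart (1 - b)) w R

/-- The search fails, with result `numLabellings w`, exactly if no labelling has finite weight. -/
noncomputable def best (b : ℕ) (w : List Letter) : ℕ :=
  leastBelow (IsBest b w) (numLabellings w)

end InstanceWord

open InstanceWord in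
theorem wordPSpace_signedPart (b : ℕ) : WordPSpace (signedPart b) := fun hw hj =>
  have h := hw.tileText hj 2
  PSpace.ite (.eq h.intSign (.const b)) h.intAbs .zero

section PSpace

open InstanceWord

variable {ι : Type} {n : ι → ℕ} {X : Set (ι → ℕ)} {w : ι → List Letter} {R : ι → ℕ}

theorem PSpaceWord.finiteWeights (hw : PSpaceWord n X w) (hR : PSpace n X R) :
    PSpacePred n X (fun a => FiniteWeights (w a) (R a)) :=
  WordPSpacePred.allWeights (fun hw => (hw.letter .zero _).not) hw hR

theorem PSpaceWord.isBest (b : ℕ) (hw : PSpaceWord n X w) (hR : PSpace n X R) :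
    PSpacePred n X (fun a => IsBest b (w a) (R a)) := by
  refine (hw.finiteWeights hR).and (.forall_lt (P := fun a R' => FiniteWeights (w a) R' →
    selectedSum (signedPart b) (w a) (R a) + selectedSum (signedPart (1 - b)) (w a) R' ≤
      selectedSum (signedPart b) (w a) R' + selectedSum (signedPart (1 - b)) (w a) (R a))
    hw.numLabellings ?_)
  have hi := hw.numLabellings.lift_idx
  have h (b R) (hR : PSpace _ _ R) := WordPSpace.selectedSum (wordPSpace_signedPart b)
    (hw.lift (N := fun a => InstanceWord.numLabellings (w a))) hR
  exact (hw.lift.finiteWeights hi).imp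
    (.le ((h _ _ hR.lift).add (h _ _ hi)) ((h _ _ hi).add (h _ _ hR.lift)))

theorem PSpaceWord.best (b : ℕ) (hw : PSpaceWord n X w) : PSpace n X (fun a => best b (w a)) :=
  PSpacePred.leastBelow hw.numLabellings (hw.lift.isBest b hw.numLabellings.lift_idx)

end PSpace

open Tropical in
/-- A monotone additive map, applied to the elements of a tropical semiring. -/
def tropicalMap {L : Type} [AddCancelCommMonoid L] [LinearOrder L] [IsOrderedAddMonoid L] (f : L →+ ℤ)
    (hf : Monotone f) : Tropical (WithTop L) →+* Tropical (WithTop ℤ) where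
  toFun x := trop ((untrop x).map f)
  map_zero' := by simp
  map_one' := congrArg (fun z : ℤ => trop (z : WithTop ℤ)) (map_zero f)
  map_mul' x y := by
    rw [untrop_mul, WithTop.map_add f]
    rfl
  map_add' x y := by
    rw [untrop_add, (hf.withTop_map).map_min]
    rfl

namespace EvalInstance

open InstanceWord Tropical

variable {S : Type} [CommSemiring S] (φ : S →+* Tropical (WithTop ℤ)) {b : ℕ} (hb : b < 2)
  {enc : S → List Letter} (henc : ∀ x, enc x = tropWord b (untrop (φ x))) (I : EvalInstance S)

include henc

theorem tropWord_enc (x : S) : ∀ y ∈ enc x, y ≠ semicolon ∧ y ≠ bar := by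
  rw [henc]
  exact tropWord_letters b _

-- The input shows `(-1) ^ b * z`. Hence the part of sign `b` is the positive part of `z`, and the
-- part of the other sign its negative part.
include hb in
theorem eq_signedPart_sub {j : ℕ} (hj : j < I.tileList.length) {z : ℤ}
    (hz : untrop (φ (I.weightAt j)) = z) :
    z = (signedPart b (I.word enc) j : ℤ) - signedPart (1 - b) (I.word enc) j := by
  have ht : tileText (I.word enc) j 2 = intWord ((-1) ^ b * z) := by
    rw [I.tileText_two (tropWord_enc φ henc) j hj, henc, ← I.weightAt_eq j hj, hz]
    rfl
  have h := eq_sign_mul_abs ((-1) ^ b * z)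
  have hs : intSign (intWord ((-1) ^ b * z)) < 2 := by
    rw [intSign, truthValue]
    split_ifs <;> omega
  rw [signedPart, signedPart, ht]
  generalize intSign (intWord ((-1) ^ b * z)) = s at h hs ⊢
  generalize intAbs (intWord ((-1) ^ b * z)) = k at h ⊢
  interval_cases b <;> interval_cases s <;> simp at h ⊢ <;> omega

-- The sum is `⊤` for two reasons that need not be told apart: no permissible tile matches, or the
-- matching tile has infinite weight.
open Classical in
include hb in
theorem untrop_sum_weights (R v : ℕ) (hR : R < I.numStates ^ I.numVertices)
    (hv : v < I.numVertices) :
    untrop (∑ j ∈ Finset.range I.tileList.length,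
      if TileMatches (I.word enc) R v j then φ (I.weightAt j) else 0) =
    if ∃ j < I.tileList.length, TileMatches (I.word enc) R v j ∧
        (tileText (I.word enc) j 2)[0]? ≠ some infinity then
      (((selected (signedPart b) (I.word enc) R v : ℤ) -
        selected (signedPart (1 - b)) (I.word enc) R v : ℤ) : WithTop ℤ) else ⊤ := by
  have henc' := tropWord_enc φ henc
  have hinf : ∀ j < I.tileList.length, (tileText (I.word enc) j 2)[0]? = some infinity ↔
      untrop (φ (I.weightAt j)) = ⊤ := fun j hj => by
    rw [I.tileText_two henc' j hj, henc, ← I.weightAt_eq j hj, tropWord_eq_infinity]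
  rw [I.selected_word henc', I.selected_word henc']
  lift R to Fin _ using hR
  lift v to Fin _ using hv
  by_cases hex : ∃ j < I.tileList.length, TileMatches (I.word enc) R v j ∧
        (tileText (I.word enc) j 2)[0]? ≠ some infinity
  · rw [if_pos hex]
    obtain ⟨j, hj, hm, hfin⟩ := hex
    rcases I.selection_cases henc' R v with h | ⟨j', hj', hm', h⟩
    -- The constant function `1` counts the matching tiles, and there is one.
    · exact absurd (h (K := ℕ) fun _ => 1) (Finset.sum_pos' (fun _ _ => Nat.zero_le _)
        ⟨j, Finset.mem_range.2 hj, by rw [if_pos hm]; exact one_pos⟩).ne'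
    · obtain rfl := I.tileMatches_unique henc' R v hj hj' hm hm'
      rw [h, h, h]
      obtain ⟨z, hz⟩ := WithTop.ne_top_iff_exists.1 (fun e => hfin ((hinf j hj).2 e))
      rw [← I.eq_signedPart_sub φ hb henc hj hz.symm, hz]
  · rw [if_neg hex]
    rcases I.selection_cases henc' R v with h | ⟨j, hj, hm, h⟩
    · rw [h]
      rfl
    · rw [h]
      by_contra hne
      exact hex ⟨j, hj, hm, fun e => hne ((hinf j hj).1 e)⟩

-- Tropical products are sums in `WithTop ℤ`, which are infinite as soon as one summand is.
open Classical in
include hb in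
theorem untrop_prod_weights (R : ℕ) (hR : R < I.numStates ^ I.numVertices) :
    untrop (∏ v ∈ Finset.range I.numVertices, ∑ j ∈ Finset.range I.tileList.length,
      if TileMatches (I.word enc) R v j then φ (I.weightAt j) else 0) =
    if FiniteWeights (I.word enc) R then
      (((selectedSum (signedPart b) (I.word enc) R : ℤ) -
        selectedSum (signedPart (1 - b)) (I.word enc) R : ℤ) : WithTop ℤ) else ⊤ := by
  have henc' := tropWord_enc φ henc
  rw [untrop_prod, Finset.sum_congr rfl fun v hv =>
    I.untrop_sum_weights φ hb henc R v hR (Finset.mem_range.1 hv), FiniteWeights, AllWeights,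
    I.numTiles_word henc', I.numVertices_word henc']
  split_ifs with h
  · rw [Finset.sum_congr rfl fun v hv => if_pos (h v (Finset.mem_range.1 hv)), ← WithTop.coe_sum,
      Finset.sum_sub_distrib, selectedSum, selectedSum, I.numVertices_word henc', Nat.cast_sum,
      Nat.cast_sum]
  · push Not at h
    obtain ⟨v, hv, h⟩ := h
    refine WithTop.sum_eq_top.2 ⟨v, Finset.mem_range.2 hv, if_neg ?_⟩
    push Not
    exact h

-- A tropical sum is a minimum, attained at any labelling of finite and least weight, in particular
-- at `best`.
include hb in
theorem untrop_map_value : untrop (φ I.value) =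
    if best b (I.word enc) < numLabellings (I.word enc) then
      (((selectedSum (signedPart b) (I.word enc) (best b (I.word enc)) : ℤ) -
        selectedSum (signedPart (1 - b)) (I.word enc) (best b (I.word enc)) : ℤ) : WithTop ℤ)
    else ⊤ := by
  classical
  have henc' := tropWord_enc φ henc
  set c : ℕ → WithTop ℤ := fun R => if FiniteWeights (I.word enc) R then
      (((selectedSum (signedPart b) (I.word enc) R : ℤ) -
        selectedSum (signedPart (1 - b)) (I.word enc) R : ℤ) : WithTop ℤ) else ⊤ with hc
  have hval : untrop (φ I.value) = (Finset.range (numLabellings (I.word enc))).inf c := by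
    rw [I.value_eq_sum henc', map_sum, Finset.untrop_sum', I.numLabellings_word henc']
    refine Finset.inf_congr rfl fun R hR => ?_
    refine Eq.trans ?_ (I.untrop_prod_weights φ hb henc R (Finset.mem_range.1 hR))
    rw [Function.comp_apply, map_prod]
    refine congrArg untrop (Finset.prod_congr rfl fun v _ => ?_)
    rw [map_sum]
    exact Finset.sum_congr rfl fun j _ => by rw [apply_ite φ, map_zero]
  obtain ⟨-, h2, h3⟩ := leastBelow_spec (IsBest b (I.word enc)) (numLabellings (I.word enc))
  have h1 := (leastBelow_spec (IsBest b (I.word enc)) (numLabellings (I.word enc))).1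
  rw [hval]
  rw [best]
  split_ifs with h
  · obtain ⟨hf, hmin⟩ := h2 h
    refine le_antisymm ((Finset.inf_le (Finset.mem_range.2 h)).trans_eq (if_pos hf)) ?_
    refine Finset.le_inf fun R hR => ?_
    simp only [hc]
    split_ifs with hR'
    · have := hmin R (Finset.mem_range.1 hR) hR'
      rw [WithTop.coe_le_coe]
      omega
    · exact le_top
  · rw [eq_top_iff]
    refine Finset.le_inf fun R hR => top_le_iff.2 ?_
    -- If some labelling had finite weight, one of least weight would exist among the finitely many,
    -- and the search would not have failed.
    by_contra hne
    have hfin : ∃ R ∈ (Finset.range (numLabellings (I.word enc))).filter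
        (FiniteWeights (I.word enc)), True := by
      refine ⟨R, Finset.mem_filter.2 ⟨hR, ?_⟩, trivial⟩
      by_contra hR'
      exact hne (if_neg hR')
    obtain ⟨R₀, hR₀, -⟩ := hfin
    obtain ⟨R₁, hR₁, hmin⟩ := Finset.exists_min_image _ (fun R =>
      (selectedSum (signedPart b) (I.word enc) R : ℤ) -
        selectedSum (signedPart (1 - b)) (I.word enc) R) ⟨R₀, hR₀⟩
    rw [Finset.mem_filter, Finset.mem_range] at hR₁
    refine h3 (le_antisymm h1 (not_lt.1 h)) R₁ hR₁.1 ⟨hR₁.2, fun R' hR' hf => ?_⟩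
    have := hmin R' (Finset.mem_filter.2 ⟨Finset.mem_range.2 hR', hf⟩)
    omega

end EvalInstance

open InstanceWord Tropical in
/-- The evaluation problem over a tropical semiring of integers. -/
theorem inFPSpace_of_tropical {S : Type} [CommSemiring S] (φ : S →+* Tropical (WithTop ℤ)) {b : ℕ}
    (hb : b < 2) {enc : S → List Letter} (henc : ∀ x, enc x = tropWord b (untrop (φ x))) :
    InFPSpace (EvalInstance.word enc) enc (EvalInstance.value : EvalInstance S → S) := by
  classical
  refine PSpace.inFPSpace ?_
  have hw := EvalInstance.pspaceWord_word enc
  have h (c) := WordPSpace.selectedSum (wordPSpace_signedPart c) hw (hw.best b)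
  refine (PSpaceWord.ite (.lt (hw.best b) hw.numLabellings)
    -- For `b = 1` the number to be written is the negative of the minimum, so the difference is
    -- reversed.
    (.ite (.eq (.const b) .zero) (.intWord_sub (h b) (h (1 - b))) (.intWord_sub (h (1 - b)) (h b)))
    (.const [infinity])).of_eq fun I => ?_
  rw [henc, I.untrop_map_value φ hb henc]
  split_ifs with h1 h2
  · rw [tropWord_coe, h2, pow_zero, one_mul]
  · obtain rfl : b = 1 := by omega
    rw [tropWord_coe, pow_one, neg_one_mul, neg_sub]
  · rfl

/-! ### The evaluation problem over the nine semirings -/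

theorem intWord_natCast (k : ℕ) : intWord (k : ℤ) = natWord k := by
  rw [intWord, if_neg (by omega), Int.natAbs_natCast]

theorem ratWord_nnratCast (q : ℚ≥0) :
    ratWord (q : ℚ) = natWord q.num ++ [slash] ++ natWord q.den := by
  rw [ratWord, NNRat.num_coe, NNRat.den_coe, intWord_natCast]

theorem tropWord_one_coe (z : ℤ) : tropWord 1 (z : WithTop ℤ) = intWord (-z) := by
  rw [tropWord_coe, pow_one, neg_one_mul]

theorem tropWord_zero_coe (z : ℤ) : tropWord 0 (z : WithTop ℤ) = intWord z := by
  rw [tropWord_coe, pow_zero, one_mul]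

theorem mainTheorem6 (s : SemiringName) :
    InFPSpace (EvalInstance.word s.word) s.word
      (EvalInstance.value : EvalInstance s.Carrier → s.Carrier) := by
  cases s
  · exact inFPSpace_boolean
  · exact inFPSpace_of_int (S := ℕ) (Nat.castRingHom ℤ) fun x => (intWord_natCast x).symm
  · exact inFPSpace_of_int (S := ℤ) (RingHom.id ℤ) fun x => rfl
  · exact inFPSpace_of_rat (S := ℚ) (RingHom.id ℚ) fun x => rfl
  · exact inFPSpace_of_rat (S := ℚ≥0) NNRat.coeHom fun x => (ratWord_nnratCast x).symm
  -- Negation turns `max` into `min`; with `b = 1` the encoding undoes it, so that input and output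
  -- show the original numbers.
  · refine inFPSpace_of_tropical (S := Tropical (WithTop ℕᵒᵈ)) (tropicalMap
      { toFun := fun k => -((OrderDual.ofDual k : ℕ) : ℤ), map_zero' := by simp,
        map_add' := fun x y => (congrArg Neg.neg (Nat.cast_add _ _)).trans (neg_add _ _) }
      fun x y (h : OrderDual.ofDual y ≤ OrderDual.ofDual x) =>
        neg_le_neg (Int.ofNat_le.2 h)) (b := 1) one_lt_two fun x => ?_
    induction x using Tropical.tropRec with | h x => ?_
    induction x with
    | top => rfl
    | coe k => exact ((tropWord_one_coe _).trans ((congrArg intWord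
      (neg_neg ((OrderDual.ofDual k : ℕ) : ℤ))).trans (intWord_natCast _))).symm
  · refine inFPSpace_of_tropical (S := Tropical (WithTop ℤᵒᵈ)) (tropicalMap
      { toFun := fun k => -(OrderDual.ofDual k : ℤ), map_zero' := by simp,
        map_add' := fun x y => neg_add _ _ }
      fun x y (h : OrderDual.ofDual y ≤ OrderDual.ofDual x) => neg_le_neg h) (b := 1) one_lt_two
      fun x => ?_
    induction x using Tropical.tropRec with | h x => ?_
    induction x with
    | top => rfl
    | coe k => exact ((tropWord_one_coe _).trans (congrArg _ (neg_neg _))).symm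
  · refine inFPSpace_of_tropical (S := Tropical (WithTop ℕ)) (tropicalMap (Nat.castAddMonoidHom ℤ)
      Nat.mono_cast) (b := 0) two_pos fun x => ?_
    induction x using Tropical.tropRec with | h x => ?_
    induction x with
    | top => rfl
    | coe k => exact ((tropWord_zero_coe _).trans (intWord_natCast k)).symm
  · refine inFPSpace_of_tropical (S := Tropical (WithTop ℤ)) (RingHom.id _) (b := 0) two_pos
      fun x => ?_
    induction x using Tropical.tropRec with | h x => ?_
    induction x with
    | top => rfl
    | coe k => exact (tropWord_zero_coe _).symm
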